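/- A rooted planar map is a proper embedding of a connected planar graph (loops and multiple edges allowed) in the oriented sphere, up to orientation-preserving homeomorphism, with one oriented edge, the root-edge $(s,t)$. Its root-vertex is the origin $s$ of the root-edge, and its root-face is the face to the right of the root-edge; the degree of a vertex or face is the number of edges incident to it, counted with multiplicity. A bipolar orientation of a rooted map is an acyclic orientation of its edges such that $s$ is the single source and $t$ the single sink. "The number of bipolar orientations of planar maps" with given parameters is the number of rooted planar maps with these parameters equipped with a bipolar orientation. For integers $a,b$ the binomial coefficient is $\binom ab=\frac{a(a-1)\cdots(a-b+1)}{b!}$ if $b\ge 0$, $\binom ab=\binom a{a-b}$ if $b<0$ and $b\le a$, and $\binom ab=0$ otherwise (so that $\binom{-1}{-1}=\binom{-1}{0}=1$). For $1\le m<n$, the number of bipolar orientations of planar maps having $n$ edges and $m+1$ vertices is $$\frac 2{(n-1)n^2}\binom n{m-1}\binom nm\binom n{m+1}.$$ For $1\le m<n$ and $2\le j\le m+1$, the number of bipolar orientations of planar maps having $n$ edges, $m+1$ vertices and a root-face of degree $j$ is $$\frac{j(j-1)}{(n-1)n^2}\binom nm\binom n{m+1}\binom{n-j-1}{m-j+1}.$$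 For $n\ge 3$, $1\le m<n$, $2\le i\le n-m+1$ and $2\le j\le m+1$, the number of bipolar orientations of planar maps having $n$ edges, $m+1$ vertices, a root-vertex of degree $i$ and a root-face of degree $j$ is $$\frac{(i-1)(j-1)}{(n-1)n}\binom nm\left[\binom{n-j-1}{n-m-2}\binom{n-i-1}{m-2}-\binom{n-j-1}{n-m-1}\binom{n-i-1}{m-1}\right].$$ The associated generating functions, which count planar maps equipped with a bipolar orientation by edges and non-root vertices; by edges, non-root vertices and root-face degree; and by edges, non-root vertices, root-vertex degree and root-face degree, are D-finite over $\mathbb Q$: with respect to each of its variables, each of these series satisfies a non-trivial linear differential equation whose coefficients are polynomials in all its variables. -/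

import Mathlib

noncomputable section

/-- A rooted non-atomic map on an oriented closed surface, with set of darts (half-edges) `D`,
described by its rotation system. Each dart leaves one vertex; `rot` sends a dart to the next dart
around its vertex in counterclockwise order, and `opp` exchanges the two darts of an edge.
Connectedness of the map is transitivity of the group generated by `rot` and `opp`.
The root-edge is oriented along the dart `root`. -/
structure RootedMap (D : Type) where
  rot : Equiv.Perm D
  opp : Equiv.Perm D
  root : D
  opp_opp : ∀ d, opp (opp d) = d
  opp_ne : ∀ d, opp d ≠ d
  connected : ∀ a b : D, ∃ g ∈ Subgroup.closure {rot, opp}, g a = b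

namespace RootedMap

variable {D : Type} (M : RootedMap D)

/-- The face permutation: the next dart when one walks along the boundary of the face that lies
to the right of a dart. -/
def face : Equiv.Perm D := M.rot * M.opp

/-- The vertices are the cycles of `rot`. -/
abbrev Vertex : Type := Quotient (Equiv.Perm.SameCycle.setoid M.rot)

/-- The edges are the cycles of `opp`. -/
abbrev Edge : Type := Quotient (Equiv.Perm.SameCycle.setoid M.opp)

/-- The faces are the cycles of `face`. -/
abbrev Face : Type := Quotient (Equiv.Perm.SameCycle.setoid M.face)

/-- The map is drawn on the sphere (Euler's relation). -/
def IsPlanar : Prop :=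
  Nat.card M.Vertex + Nat.card M.Face = Nat.card M.Edge + 2

/-- The vertex that the dart `d` leaves. -/
def origin (d : D) : M.Vertex := Quotient.mk _ d

/-- The vertex at the other end of the edge of `d`. -/
def target (d : D) : M.Vertex := M.origin (M.opp d)

/-- The degree of the root-vertex, i.e. of the origin of the root-edge. -/
def rootVertexDegree : ℕ := {d : D | M.rot.SameCycle M.root d}.ncard

/-- The degree of the root-face, i.e. of the face to the right of the root-edge. -/
def rootFaceDegree : ℕ := {d : D | M.face.SameCycle M.root d}.ncard

/-- An orientation of the edges: a set of darts that contains exactly one of the two darts of each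
edge. The edge of a dart `d ∈ O` is directed from `M.origin d` to `M.target d`. -/
def IsOrientation (O : Set D) : Prop := ∀ d, d ∈ O ↔ M.opp d ∉ O

/-- There is an edge directed from `u` to `v`. -/
def Arc (O : Set D) (u v : M.Vertex) : Prop := ∃ d ∈ O, M.origin d = u ∧ M.target d = v

/-- There is no directed cycle. -/
def IsAcyclic (O : Set D) : Prop := ∀ v, ¬ Relation.TransGen (M.Arc O) v v

/-- No edge is directed towards `v`. -/
def IsSource (O : Set D) (v : M.Vertex) : Prop := ∀ u, ¬ M.Arc O u v

/-- No edge is directed away from `v`. -/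
def IsSink (O : Set D) (v : M.Vertex) : Prop := ∀ u, ¬ M.Arc O v u

/-- A bipolar orientation: an acyclic orientation whose single source and single sink are the
origin and the end of the root-edge. -/
def IsBipolar (O : Set D) : Prop :=
  M.IsOrientation O ∧ M.IsAcyclic O ∧
    (∀ v, M.IsSource O v ↔ v = M.origin M.root) ∧
    (∀ v, M.IsSink O v ↔ v = M.target M.root)

end RootedMap

/-- A rooted planar map with `n` edges (hence `2 * n` darts), equipped with a bipolar
orientation. -/
structure BipolarMap (n : ℕ) extends RootedMap (Fin (2 * n)) where
  planar : toRootedMap.IsPlanar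
  orient : Set (Fin (2 * n))
  bipolar : toRootedMap.IsBipolar orient

/-- Isomorphism (orientation preserving homeomorphism) of rooted planar maps that carry a bipolar
orientation: a relabelling of the darts that respects all the structure. -/
def BipolarMap.Iso {n : ℕ} (M N : BipolarMap n) : Prop :=
  ∃ τ : Equiv.Perm (Fin (2 * n)),
    (∀ d, τ (M.rot d) = N.rot (τ d)) ∧ (∀ d, τ (M.opp d) = N.opp (τ d)) ∧
    τ M.root = N.root ∧ (∀ d, d ∈ M.orient ↔ τ d ∈ N.orient)

instance BipolarMap.setoid (n : ℕ) : Setoid (BipolarMap n) where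
  r := BipolarMap.Iso
  iseqv :=
    { refl := fun M => ⟨1, by simp⟩
      symm := by
        rintro M N ⟨τ, h1, h2, h3, h4⟩
        refine ⟨τ.symm, fun d => ?_, fun d => ?_, ?_, fun d => ?_⟩
        · rw [Equiv.symm_apply_eq, h1, Equiv.apply_symm_apply]
        · rw [Equiv.symm_apply_eq, h2, Equiv.apply_symm_apply]
        · rw [Equiv.symm_apply_eq, h3]
        · rw [h4, Equiv.apply_symm_apply]
      trans := by
        rintro M N P ⟨τ, h1, h2, h3, h4⟩ ⟨τ', k1, k2, k3, k4⟩
        refine ⟨τ.trans τ', fun d => ?_, fun d => ?_, ?_, fun d => ?_⟩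
        · simp [h1, k1]
        · simp [h2, k2]
        · simp [h3, k3]
        · simp [h4 d, k4 (τ d)] }

/-- Number of bipolar orientations of planar maps with `n` edges and `m + 1` vertices: the number
of isomorphism classes of such oriented maps. -/
def bipolarCount (n m : ℕ) : ℕ :=
  ((Quotient.mk (BipolarMap.setoid n)) ''
    {M | Nat.card M.Vertex = m + 1}).ncard

/-- The same, with root-face of degree `j`. -/
def bipolarCountFace (n m j : ℕ) : ℕ :=
  ((Quotient.mk (BipolarMap.setoid n)) ''
    {M | Nat.card M.Vertex = m + 1 ∧ M.rootFaceDegree = j}).ncard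

/-- The same, with root-vertex of degree `i` and root-face of degree `j`. -/
def bipolarCountVertexFace (n m i j : ℕ) : ℕ :=
  ((Quotient.mk (BipolarMap.setoid n)) ''
    {M | Nat.card M.Vertex = m + 1 ∧ M.rootVertexDegree = i ∧ M.rootFaceDegree = j}).ncard

/-- The binomial coefficient for integers `a` and `b`, extended to `b < 0` by the symmetry
`binom a b = binom a (a - b)`. For `b ≥ 0` it is `a (a - 1) ⋯ (a - b + 1) / b !`;
for `b < 0` and `b ≤ a` it is `a (a - 1) ⋯ (b + 1) / (a - b) !` (which is `0` if `0 ≤ a`);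
otherwise it is `0`. -/
def binom (a b : ℤ) : ℤ :=
  if 0 ≤ b then Ring.choose a b.toNat
  else if b ≤ a then Ring.choose a (a - b).toNat
  else 0

/-- `F` is D-finite: in each variable `x i` it satisfies a non-trivial linear differential equation
`∑ r ≤ N, p r * (∂ / ∂ x i) ^ r F = 0` with polynomial coefficients. -/
def IsDFinite {σ K : Type*} [Field K] (F : MvPowerSeries σ K) : Prop :=
  ∀ i : σ, ∃ (N : ℕ) (p : Fin (N + 1) → MvPolynomial σ K), p ≠ 0 ∧
    ∑ r : Fin (N + 1),
      (p r : MvPowerSeries σ K) * (fun G => MvPowerSeries.pderiv K i G)^[(r : ℕ)] F = 0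

/-- Generating function by edges (variable 0) and non-root vertices (variable 1). -/
def bipolarGF : MvPowerSeries (Fin 2) ℚ :=
  fun e => (bipolarCount (e 0) (e 1) : ℚ)

/-- Generating function by edges (variable 0), non-root vertices (variable 1) and degree of the
root-face (variable 2). -/
def bipolarGFFace : MvPowerSeries (Fin 3) ℚ :=
  fun e => (bipolarCountFace (e 0) (e 1) (e 2) : ℚ)

/-- Generating function by edges (variable 0), non-root vertices (variable 1), degree of the
root-vertex (variable 2) and degree of the root-face (variable 3). -/
def bipolarGFVertexFace : MvPowerSeries (Fin 4) ℚ :=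
  fun e => (bipolarCountVertexFace (e 0) (e 1) (e 2) (e 3) : ℚ)

end

/-! ### Cycles of permutations: inserting a point, multiplying by a transposition -/

namespace Equiv.Perm

variable {D : Type*}

/-! Counting. Everything rests on a recurrence in the number of edges. Let `e` be the edge just
before the root-edge in the rotation around the source. If the head of `e` has another incoming
edge, delete `e`; otherwise contract it. Deletion keeps the vertices, lowers the root-vertex degree
by one, and is undone by cutting the root-face of the smaller map; the degree `j` of the new
root-face says where to cut, and any old degree `b ≥ j` allows it. Contraction is the dual
operation, with the source cut in place of the root-face. Writing `N(n; m, i, j)` for the refined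
count, `N(n+1; m, i, j) = ∑_{b ≥ j} N(n; m, i-1, b) + ∑_{a ≥ i} N(n; m-1, a, j-1)` for `n ≥ 1` and
`i, j ≥ 2` (`BipolarMap.classCount_succ`).

The structural input is that in a planar bipolar map each face has a single top
(`OrientedMap.Valid.eq_of_top`), by counting corners against Euler's relation. Hence the root is the
only ascending dart of its face (`eq_root_of_mem_out`), which decides on which face or vertex the
deleted or contracted edge can have been attached. In terms of permutations the operations insert
points into cycles and multiply by one transposition, so numbers of cycles and cycle lengths are
easy to follow. The recurrence is proved for labelled maps. A map has no non-trivial automorphism,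
so the labelled count is `(2n)!` times the number of isomorphism classes
(`classCount_mul_factorial`).

The closed form `refined` satisfies the recurrence because its partial sums telescope
(`refined_rec`). Putting `i = 2`, and then `j = 2`, kills one term of the recurrence and turns the
other into an unrestricted sum, so the coarser counts are special values of the refined one.

D-finiteness. For a series in `d` variables consider the `(C+1)^(d+1)` series `x^α x_v^r ∂_v^r F`
with all `α_i` and `r` at most `C`. If their coefficient functions lie in a space of dimension at
most `C (C+1)^d`, they are linearly dependent, and a dependence is a differential equation
(`Holonomy.isDFinite_of_growth`). The coefficients here are products of factorials and inverse
factorials. All shifts of size `O(D)` of such a product are one common base function times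
polynomials of degree `O(D)`, which gives the required dimension. Places where the factorial
expression fails or a variable must be cut off are isolated by indicator functions of slices; on a
slice one variable is bound, so the dimension count survives. -/

theorem apply_inv_apply (π : Perm D) (d : D) : π (π⁻¹ d) = d := π.apply_symm_apply d

theorem SameCycle.apply_eq_of_invariant {β : Type*} {π : Perm D} {f : D → β}
    (hf : ∀ d, f (π d) = f d) {c d : D} (h : SameCycle π c d) : f c = f d := by
  obtain ⟨k, rfl⟩ := h
  have hinv : ∀ d, f (π⁻¹ d) = f d := fun d => by
    conv_rhs => rw [← apply_inv_apply π d, hf]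
  induction k with
  | zero => rfl
  | succ k ih => rw [add_comm, zpow_add, zpow_one, mul_apply, hf, ← ih]
  | pred k ih =>
    rw [sub_eq_add_neg, add_comm, zpow_add, zpow_neg_one, mul_apply, hinv, ← ih]

/-- On a finite set every point of a cycle is reached by a non-negative power, so forward invariance
is enough. -/
theorem SameCycle.mem_of_mapsTo [Finite D] {π : Perm D} {A : Set D} (hA : ∀ d ∈ A, π d ∈ A)
    {c d : D} (h : SameCycle π c d) (hc : c ∈ A) : d ∈ A := by
  obtain ⟨k, -, rfl⟩ := h.exists_nat_pow_eq
  clear h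
  induction k with
  | zero => exact hc
  | succ k ih => rw [pow_succ', mul_apply]; exact hA _ ih

theorem sameCycle_self_apply (π : Perm D) (d : D) : SameCycle π d (π d) :=
  ⟨1, by simp⟩

/-- The number of cycles of a permutation, fixed points included. -/
noncomputable def numCycles (π : Perm D) : ℕ := Nat.card (Quotient (SameCycle.setoid π))

theorem card_quotient_eq_of_surjective {A B : Type*} {r : Setoid A} {s : Setoid B} (f : A → B)
    (hf : Function.Surjective f) (h : ∀ a a', r a a' ↔ s (f a) (f a')) :
    Nat.card (Quotient r) = Nat.card (Quotient s) := by
  refine Nat.card_eq_of_bijective (Quotient.map f fun a a' haa => (h a a').1 haa) ⟨?_, ?_⟩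
  · rintro ⟨a⟩ ⟨a'⟩ haa
    exact Quotient.sound ((h a a').2 (Quotient.exact haa))
  · rintro ⟨b⟩
    obtain ⟨a, rfl⟩ := hf b
    exact ⟨Quotient.mk _ a, rfl⟩

theorem ncard_sameCycle_eq_minimalPeriod [Finite D] (π : Perm D) (x : D) :
    {d | SameCycle π x d}.ncard = Function.minimalPeriod π x := by
  have hpos : 0 < Function.minimalPeriod π x :=
    Function.minimalPeriod_pos_of_mem_periodicPts
      (Function.Injective.mem_periodicPts π.injective x)
  have : {d | SameCycle π x d} = (fun i => π^[i] x) '' Set.Iio (Function.minimalPeriod π x) := by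
    ext d
    constructor
    · intro h
      obtain ⟨k, -, rfl⟩ := SameCycle.exists_nat_pow_eq h
      refine ⟨k % Function.minimalPeriod π x, Nat.mod_lt _ hpos, ?_⟩
      simp [Function.iterate_mod_minimalPeriod_eq, ← iterate_eq_pow]
    · rintro ⟨i, -, rfl⟩
      exact ⟨i, by simp [iterate_eq_pow]⟩
  rw [this, Set.InjOn.ncard_image (Function.iterate_injOn_Iio_minimalPeriod)]
  simp [Set.ncard_eq_toFinset_card']

theorem SameCycle.exists_pow_lt_ncard [Finite D] {π : Perm D} {x y : D} (h : SameCycle π x y) :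
    ∃ t < {d | SameCycle π x d}.ncard, (π ^ t) x = y := by
  have hpos : 0 < Function.minimalPeriod π x :=
    Function.minimalPeriod_pos_of_mem_periodicPts
      (Function.Injective.mem_periodicPts π.injective x)
  obtain ⟨k, -, rfl⟩ := SameCycle.exists_nat_pow_eq h
  refine ⟨k % Function.minimalPeriod π x, ?_, ?_⟩
  · rw [ncard_sameCycle_eq_minimalPeriod]; exact Nat.mod_lt _ hpos
  · simp [Function.iterate_mod_minimalPeriod_eq, ← iterate_eq_pow]

theorem pow_apply_injOn [Finite D] (π : Perm D) (x : D) {i j : ℕ}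
    (hi : i < {d | SameCycle π x d}.ncard) (hj : j < {d | SameCycle π x d}.ncard)
    (h : (π ^ i) x = (π ^ j) x) : i = j := by
  rw [ncard_sameCycle_eq_minimalPeriod] at hi hj
  exact Function.iterate_injOn_Iio_minimalPeriod hi hj (by simpa [iterate_eq_pow] using h)

theorem SameCycle.exists_pow_of_ne [Finite D] {π : Perm D} {x y : D} (h : SameCycle π x y)
    (hxy : x ≠ y) : ∃ t, 0 < t ∧ t < {d | SameCycle π x d}.ncard ∧ (π ^ t) x = y := by
  obtain ⟨t, ht, hy⟩ := h.exists_pow_lt_ncard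
  refine ⟨t, Nat.pos_of_ne_zero ?_, ht, hy⟩
  rintro rfl
  exact hxy (by simpa using hy)

theorem pow_ne_self_of_lt [Finite D] (π : Perm D) (x : D) {t : ℕ} (ht : 0 < t)
    (ht' : t < {d | SameCycle π x d}.ncard) : (π ^ t) x ≠ x := by
  intro h
  have := pow_apply_injOn π x (i := t) (j := 0) ht' (by omega) (by simpa using h)
  omega

section Insert

variable [DecidableEq D]

/-- Insert the new point `none` into the cycle of `x`, just before `x`. -/
def insertBefore (π : Perm D) (x : D) : Perm (Option D) :=
  Equiv.swap none (some x) * Equiv.optionCongr π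

@[simp] theorem insertBefore_none (π : Perm D) (x : D) : insertBefore π x none = some x := by
  simp [insertBefore]

theorem insertBefore_some (π : Perm D) (x d : D) :
    insertBefore π x (some d) = if π d = x then none else some (π d) := by
  unfold insertBefore
  split_ifs with h
  · simp [h]
  · simp [Equiv.swap_apply_of_ne_of_ne, h]

theorem insertBefore_inj {π ρ : Perm D} {x y : D} (h : insertBefore π x = insertBefore ρ y) :
    π = ρ ∧ x = y := by
  have hx : x = y := by
    have := congrArg (fun σ => σ none) h
    simpa using this
  subst hx
  refine ⟨?_, rfl⟩
  have h2 : Equiv.optionCongr π = Equiv.optionCongr ρ := mul_left_cancel h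
  exact Equiv.optionCongr_injective h2

theorem exists_eq_insertBefore {σ : Perm (Option D)} {x : D} (h : σ none = some x) :
    ∃ π, σ = insertBefore π x := by
  refine ⟨(Equiv.Perm.decomposeOption σ).2, ?_⟩
  have := Equiv.Perm.decomposeOption.symm_apply_apply σ
  rw [Equiv.Perm.decomposeOption_symm_apply] at this
  rw [insertBefore, ← h]
  exact this.symm

/-- The new point joins the cycle of `x` and no cycle merges or splits; `getD x` is the collapse
that identifies `none` with `x`. -/
theorem sameCycle_insertBefore (π : Perm D) (x : D) (c d : Option D) :
    SameCycle (insertBefore π x) c d ↔ SameCycle π (c.getD x) (d.getD x) := by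
  constructor
  · intro h
    have := SameCycle.apply_eq_of_invariant
      (f := fun c : Option D => Quotient.mk (SameCycle.setoid π) (c.getD x)) ?_ h
    · exact Quotient.exact this
    · rintro (_ | d)
      · simp
      · rw [insertBefore_some]
        refine Quotient.sound ?_
        have := (sameCycle_self_apply π d).symm
        split_ifs with hx
        · rw [← hx]; exact this
        · exact this
  · have key : ∀ {c d : D}, SameCycle π c d → SameCycle (insertBefore π x) (some c) (some d) := by
      intro c d h
      have := SameCycle.apply_eq_of_invariant
        (f := fun c : D => Quotient.mk (SameCycle.setoid (insertBefore π x)) (some c)) ?_ h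
      · exact Quotient.exact this
      · intro d
        refine Quotient.sound (SameCycle.symm ?_)
        have h1 := sameCycle_self_apply (insertBefore π x) (some d)
        rw [insertBefore_some] at h1
        split_ifs at h1 with hx
        · rw [hx]
          have h2 := sameCycle_self_apply (insertBefore π x) none
          rw [insertBefore_none] at h2
          exact h1.trans h2
        · exact h1
    have h0 : ∀ c : Option D, SameCycle (insertBefore π x) c (some (c.getD x)) := by
      rintro (_ | c)
      · simpa using sameCycle_self_apply (insertBefore π x) none
      · exact SameCycle.refl _ _
    intro h
    exact (h0 c).trans ((key h).trans (h0 d).symm)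

theorem numCycles_insertBefore (π : Perm D) (x : D) :
    numCycles (insertBefore π x) = numCycles π :=
  card_quotient_eq_of_surjective (fun c : Option D => c.getD x) (fun d => ⟨some d, rfl⟩)
    (sameCycle_insertBefore π x)

open Classical in
theorem ncard_sameCycle_insertBefore [Finite D] (π : Perm D) (x r : D) :
    {d | SameCycle (insertBefore π x) (some r) d}.ncard =
      {d | SameCycle π r d}.ncard + if SameCycle π r x then 1 else 0 := by
  have h : {d | SameCycle (insertBefore π x) (some r) d} =
      some '' {d | SameCycle π r d} ∪ {d | d = none ∧ SameCycle π r x} := by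
    ext (_ | d) <;> simp [sameCycle_insertBefore]
  rw [h, Set.ncard_union_eq ?_ (Set.toFinite _) (Set.toFinite _),
    Set.ncard_image_of_injective _ (Option.some_injective D)]
  · congr 1
    split_ifs with h1 <;> simp [h1]
  · rw [Set.disjoint_left]
    rintro _ ⟨d, -, rfl⟩ ⟨h, -⟩
    cases h

end Insert

section Swap

variable [DecidableEq D]

theorem swap_mul_apply_cases (π : Perm D) (x y d : D) :
    (π d = x ∧ (Equiv.swap x y * π) d = y) ∨ (π d = y ∧ (Equiv.swap x y * π) d = x) ∨
      (π d ≠ x ∧ π d ≠ y ∧ (Equiv.swap x y * π) d = π d) := by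
  rw [mul_apply]
  by_cases hx : π d = x
  · left; simp [hx]
  by_cases hy : π d = y
  · right; left; simp [hy]
  · right; right; exact ⟨hx, hy, Equiv.swap_apply_of_ne_of_ne hx hy⟩

theorem swap_mul_swap_mul (π : Perm D) (x y : D) :
    Equiv.swap x y * (Equiv.swap x y * π) = π := by
  rw [← mul_assoc, Equiv.swap_mul_self, one_mul]

/-- If the two cycles were not merged, the points lying both in the old cycle of `x` and in the new
cycle of `y` would be stable under `π⁻¹`. This set contains `π⁻¹ x`, hence it would contain `x`. -/
theorem sameCycle_swap_mul_of_not [Finite D] {π : Perm D} {x y : D} (h : ¬ SameCycle π x y) :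
    SameCycle (Equiv.swap x y * π) x y := by
  by_contra hσ
  set σ := Equiv.swap x y * π with hσdef
  have hB : ∀ d ∈ {d | SameCycle σ y d ∧ SameCycle π x d}, π⁻¹ d ∈
      {d | SameCycle σ y d ∧ SameCycle π x d} := by
    rintro d ⟨h1, h2⟩
    refine ⟨?_, h2.trans (by simpa using (sameCycle_self_apply π (π⁻¹ d)).symm)⟩
    have h3 : σ (π⁻¹ d) = d := by
      rcases swap_mul_apply_cases π x y (π⁻¹ d) with h4 | h4 | h4
      · rw [apply_inv_apply] at h4
        exact absurd (h4.1 ▸ h1).symm hσ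
      · rw [apply_inv_apply] at h4
        exact absurd (h4.1 ▸ h2) h
      · rw [hσdef, h4.2.2, apply_inv_apply]
    have h4 := sameCycle_self_apply σ (π⁻¹ d)
    rw [h3] at h4
    exact h1.trans h4.symm
  have h1 : π⁻¹ x ∈ {d | SameCycle σ y d ∧ SameCycle π x d} := by
    refine ⟨?_, by simpa using (sameCycle_self_apply π (π⁻¹ x)).symm⟩
    have : σ (π⁻¹ x) = y := by simp [hσdef]
    have h4 := sameCycle_self_apply σ (π⁻¹ x)
    rw [this] at h4
    exact h4.symm
  have h2 := SameCycle.mem_of_mapsTo (d := x) hB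
    (sameCycle_inv.2 (by simpa using (sameCycle_self_apply π (π⁻¹ x)))) h1
  exact hσ h2.1.symm

open Classical in
theorem sameCycle_swap_mul_iff [Finite D] {π : Perm D} {x y : D} (h : ¬ SameCycle π x y)
    (c d : D) : SameCycle (Equiv.swap x y * π) c d ↔ SameCycle π c d ∨
      ((SameCycle π x c ∨ SameCycle π y c) ∧ (SameCycle π x d ∨ SameCycle π y d)) := by
  constructor
  · intro hcd
    have key := SameCycle.apply_eq_of_invariant
      (f := fun c => if SameCycle π x c ∨ SameCycle π y c then none else
        some (Quotient.mk (SameCycle.setoid π) c)) ?_ hcd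
    · by_cases hc : SameCycle π x c ∨ SameCycle π y c <;>
        by_cases hd : SameCycle π x d ∨ SameCycle π y d
      · exact Or.inr ⟨hc, hd⟩
      · simp [hc, hd] at key
      · simp [hc, hd] at key
      · simp only [hc, hd, if_false, Option.some.injEq] at key
        exact Or.inl (Quotient.exact key)
    · intro e
      have he := sameCycle_self_apply π e
      rcases swap_mul_apply_cases π x y e with h4 | h4 | h4
      · have : SameCycle π x e := (h4.1 ▸ he).symm
        simp [h4.2, this, SameCycle.refl]
      · have : SameCycle π y e := (h4.1 ▸ he).symm
        simp [h4.2, this, SameCycle.refl]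
      · simp only [h4.2.2, sameCycle_apply_right]
        have : Quotient.mk (SameCycle.setoid π) (π e) = Quotient.mk (SameCycle.setoid π) e :=
          Quotient.sound he.symm
        rw [this]
  · have hxy := sameCycle_swap_mul_of_not h
    have key : ∀ {c d}, SameCycle π c d → SameCycle (Equiv.swap x y * π) c d := by
      intro c d hcd
      have := SameCycle.apply_eq_of_invariant
        (f := fun c => Quotient.mk (SameCycle.setoid (Equiv.swap x y * π)) c) ?_ hcd
      · exact Quotient.exact this
      · intro e
        refine Quotient.sound ?_
        have he := (sameCycle_self_apply (Equiv.swap x y * π) e).symm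
        rcases swap_mul_apply_cases π x y e with h4 | h4 | h4
        · rw [h4.2] at he; rw [h4.1]; exact hxy.trans he
        · rw [h4.2] at he; rw [h4.1]; exact hxy.symm.trans he
        · rw [h4.2.2] at he; exact he
    have key2 : ∀ {c}, SameCycle π x c ∨ SameCycle π y c →
        SameCycle (Equiv.swap x y * π) x c := by
      rintro c (hc | hc)
      · exact key hc
      · exact hxy.trans (key hc)
    rintro (hcd | ⟨hc, hd⟩)
    · exact key hcd
    · exact (key2 hc).symm.trans (key2 hd)

/-- The cycles other than that of `y` form a system of representatives for the merged partition.
This and its converse `SameCycle.numCycles_swap_mul` carry all the Euler bookkeeping below. -/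
theorem numCycles_eq_of_not_sameCycle [Finite D] {π : Perm D} {x y : D}
    (h : ¬ SameCycle π x y) : numCycles π = numCycles (Equiv.swap x y * π) + 1 := by
  set σ := Equiv.swap x y * π with hσ
  let Q := Quotient (SameCycle.setoid π)
  let qy : Q := Quotient.mk _ y
  have hiff := sameCycle_swap_mul_iff h
  let F : Q → Quotient (SameCycle.setoid σ) :=
    Quotient.map id fun c d hcd => (hiff c d).2 (Or.inl hcd)
  have hbij : Set.BijOn F {q | q ≠ qy} _root_.Set.univ := by
    refine ⟨fun _ _ => Set.mem_univ _, ?_, ?_⟩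
    · rintro ⟨c⟩ hc ⟨d⟩ hd hcd
      have hc' : ¬ SameCycle π y c := fun hh => hc (Quotient.sound hh.symm)
      have hd' : ¬ SameCycle π y d := fun hh => hd (Quotient.sound hh.symm)
      have := (hiff c d).1 (Quotient.exact hcd)
      refine Quotient.sound ?_
      simp only [hc', hd', or_false] at this
      rcases this with h1 | ⟨h1, h2⟩
      · exact h1
      · exact h1.symm.trans h2
    · rintro ⟨d⟩ -
      by_cases hd : SameCycle π y d
      · refine ⟨Quotient.mk _ x, fun hh => h (Quotient.exact hh), ?_⟩
        exact Quotient.sound ((hiff x d).2 (Or.inr ⟨Or.inl (SameCycle.refl _ _), Or.inr hd⟩))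
      · exact ⟨Quotient.mk _ d, fun hh => hd (Quotient.exact hh).symm, rfl⟩
  have h1 : {q : Q | q ≠ qy}.ncard = Nat.card (Quotient (SameCycle.setoid σ)) := by
    rw [← Set.ncard_univ, ← hbij.image_eq, hbij.injOn.ncard_image]
  have h2 : {q : Q | q ≠ qy}.ncard + 1 = Nat.card Q := by
    have h3 := Set.ncard_sdiff_singleton_add_one (Set.mem_univ qy)
    rw [Set.ncard_univ] at h3
    rw [← h3]
    congr 2
    ext q; simp
  exact h2.symm.trans (by rw [h1]; rfl)

/-- Multiplying by the transposition of `x` and `π ^ t x` cuts off a cycle with `t` points. -/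
theorem sameCycle_swap_mul_pow [Finite D] (π : Perm D) (x : D) {t : ℕ} (ht : 0 < t)
    (ht' : t < {d | SameCycle π x d}.ncard) (d : D) :
    SameCycle (Equiv.swap x ((π ^ t) x) * π) x d ↔ ∃ i < t, d = (π ^ i) x := by
  set σ := Equiv.swap x ((π ^ t) x) * π with hσ
  have hstep : ∀ i, i + 1 < t → σ ((π ^ i) x) = (π ^ (i + 1)) x := by
    intro i hi
    rw [hσ, mul_apply, ← mul_apply π, ← pow_succ']
    refine Equiv.swap_apply_of_ne_of_ne (fun hh => ?_) (fun hh => ?_)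
    · have := pow_apply_injOn π x (i := i + 1) (j := 0) (by omega) (by omega) (by simpa using hh)
      omega
    · have := pow_apply_injOn π x (i := i + 1) (j := t) (by omega) (by omega) hh
      omega
  constructor
  · intro h
    refine SameCycle.mem_of_mapsTo (A := {d | ∃ i < t, d = (π ^ i) x}) ?_ h ⟨0, ht, by simp⟩
    rintro _ ⟨i, hi, rfl⟩
    by_cases hi' : i + 1 < t
    · exact ⟨i + 1, hi', hstep i hi'⟩
    · have hit : i + 1 = t := by omega
      refine ⟨0, ht, ?_⟩
      rw [hσ, mul_apply, ← mul_apply π, ← pow_succ', hit]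
      simp
  · rintro ⟨i, hi, rfl⟩
    induction i with
    | zero => exact SameCycle.refl _ _
    | succ i ih =>
      rw [← hstep i hi]
      exact (ih (by omega)).trans (sameCycle_self_apply σ _)

theorem ncard_sameCycle_swap_mul_pow [Finite D] (π : Perm D) (x : D) {t : ℕ} (ht : 0 < t)
    (ht' : t < {d | SameCycle π x d}.ncard) :
    {d | SameCycle (Equiv.swap x ((π ^ t) x) * π) x d}.ncard = t := by
  have : {d | SameCycle (Equiv.swap x ((π ^ t) x) * π) x d} =
      (fun i => (π ^ i) x) '' Set.Iio t := by
    ext d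
    rw [Set.mem_ofPred_eq, sameCycle_swap_mul_pow π x ht ht']
    simp only [Set.mem_image, Set.mem_Iio, eq_comm]
  rw [this, Set.InjOn.ncard_image]
  · simp [Set.ncard_eq_toFinset_card']
  · intro i hi j hj h
    exact pow_apply_injOn π x (lt_trans hi ht') (lt_trans hj ht') h

theorem SameCycle.not_swap_mul [Finite D] {π : Perm D} {x y : D} (h : SameCycle π x y)
    (hxy : x ≠ y) : ¬ SameCycle (Equiv.swap x y * π) x y := by
  obtain ⟨t, h0, ht, rfl⟩ := h.exists_pow_of_ne hxy
  rw [sameCycle_swap_mul_pow π x h0 ht]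
  rintro ⟨i, hi, hit⟩
  have := pow_apply_injOn π x (by omega) (by omega) hit
  omega

theorem SameCycle.numCycles_swap_mul [Finite D] {π : Perm D} {x y : D} (h : SameCycle π x y)
    (hxy : x ≠ y) : numCycles (Equiv.swap x y * π) = numCycles π + 1 := by
  rw [numCycles_eq_of_not_sameCycle (h.not_swap_mul hxy), swap_mul_swap_mul]

/-- The length of the cut-off cycle determines the point at which a cycle has been cut. -/
theorem SameCycle.pow_ncard_swap_mul [Finite D] {π : Perm D} {x y : D} (h : SameCycle π x y)
    (hxy : x ≠ y) {t : ℕ} (ht : {d | SameCycle (Equiv.swap x y * π) x d}.ncard = t) :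
    0 < t ∧ t < {d | SameCycle π x d}.ncard ∧ (π ^ t) x = y := by
  obtain ⟨s, h0, hs, rfl⟩ := h.exists_pow_of_ne hxy
  rw [ncard_sameCycle_swap_mul_pow π x h0 hs] at ht
  subst ht
  exact ⟨h0, hs, Eq.refl _⟩

end Swap

end Equiv.Perm

/-! ### Planar bipolar maps and the tops of their faces -/

open Equiv.Perm in
theorem Equiv.Perm.exists_mem_apply_notMem {D : Type*} [Finite D] {π : Equiv.Perm D} {A : Set D}
    {c d : D} (h : SameCycle π c d) (hc : c ∈ A) (hd : d ∉ A) :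
    ∃ e, SameCycle π c e ∧ e ∈ A ∧ π e ∉ A := by
  by_contra! hno
  exact hd (SameCycle.mem_of_mapsTo (A := {e | SameCycle π c e ∧ e ∈ A})
    (fun e he => ⟨he.1.trans (sameCycle_self_apply π e), hno e he.1 he.2⟩) h
    ⟨SameCycle.refl _ _, hc⟩).2

/-- A rooted map described by darts, with a set `out` of darts that directs its edges. -/
@[ext]
structure OrientedMap (D : Type) where
  rot : Equiv.Perm D
  opp : Equiv.Perm D
  root : D
  out : Set D

namespace OrientedMap

open Equiv.Perm

variable {D : Type}

def face (M : OrientedMap D) : Equiv.Perm D := M.rot * M.opp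

theorem face_apply (M : OrientedMap D) (d : D) : M.face d = M.rot (M.opp d) := rfl

/-- `M` is planar and bipolar. Acyclicity is expressed by a potential. -/
structure Valid (M : OrientedMap D) : Prop where
  opp_opp : ∀ d, M.opp (M.opp d) = d
  opp_ne : ∀ d, M.opp d ≠ d
  orient : ∀ d, d ∈ M.out ↔ M.opp d ∉ M.out
  potential : ∃ h : D → ℕ, (∀ d, h (M.rot d) = h d) ∧ ∀ d ∈ M.out, h d < h (M.opp d)
  source : ∀ d, (∀ e, SameCycle M.rot d e → e ∈ M.out) ↔ SameCycle M.rot M.root d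
  sink : ∀ d, (∀ e, SameCycle M.rot d e → e ∉ M.out) ↔ SameCycle M.rot (M.opp M.root) d
  euler : 2 * (numCycles M.rot + numCycles M.face) = Nat.card D + 4

namespace Valid

variable {M : OrientedMap D} (hM : M.Valid)
include hM

theorem mem_out_of_source {d : D} (h : SameCycle M.rot M.root d) : d ∈ M.out :=
  (hM.source M.root).2 (SameCycle.refl _ _) d h

theorem root_mem : M.root ∈ M.out := hM.mem_out_of_source (SameCycle.refl _ _)

theorem notMem_out_of_sink {d : D} (h : SameCycle M.rot (M.opp M.root) d) : d ∉ M.out :=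
  (hM.sink (M.opp M.root)).2 (SameCycle.refl _ _) d h

theorem opp_mem_iff {d : D} : M.opp d ∈ M.out ↔ d ∉ M.out := by
  rw [hM.orient d, not_not]

theorem face_root_notMem : M.face M.root ∉ M.out :=
  hM.notMem_out_of_sink (sameCycle_self_apply _ _)

theorem exists_notMem {d : D} (h : ¬ SameCycle M.rot M.root d) :
    ∃ e, SameCycle M.rot d e ∧ e ∉ M.out := by
  by_contra! hno
  exact h ((hM.source d).1 hno)

theorem exists_mem {d : D} (h : ¬ SameCycle M.rot (M.opp M.root) d) :
    ∃ e, SameCycle M.rot d e ∧ e ∈ M.out := by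
  by_contra! hno
  exact h ((hM.sink d).1 hno)

/-- Along descending darts the potential strictly decreases, which cannot go on round a whole face:
look at a dart of minimal potential. -/
theorem exists_mem_face [Finite D] (c : D) : ∃ e, SameCycle M.face c e ∧ e ∈ M.out := by
  obtain ⟨h, hrot, hlt⟩ := hM.potential
  by_contra! hno
  obtain ⟨d, hd, hmin⟩ := Set.exists_min_image {e | SameCycle M.face c e} h (Set.toFinite _)
    ⟨c, SameCycle.refl _ _⟩
  have h1 := hmin (M.face d) (hd.trans (sameCycle_self_apply _ _))
  have h2 := hlt (M.opp d) (hM.opp_mem_iff.2 (hno d hd))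
  rw [hM.opp_opp] at h2
  rw [face_apply, hrot] at h1
  omega

theorem exists_notMem_face [Finite D] (c : D) : ∃ e, SameCycle M.face c e ∧ e ∉ M.out := by
  obtain ⟨h, hrot, hlt⟩ := hM.potential
  by_contra! hno
  obtain ⟨d, hd, hmax⟩ := Set.exists_max_image {e | SameCycle M.face c e} h (Set.toFinite _)
    ⟨c, SameCycle.refl _ _⟩
  have h1 := hmax (M.face d) (hd.trans (sameCycle_self_apply _ _))
  have h2 := hlt d (hno d hd)
  rw [face_apply, hrot] at h1
  omega

/-- Every face has at most one dart at which its boundary turns from ascending to descending. -/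
theorem eq_of_top [Finite D] {c d : D} (hcd : SameCycle M.face c d) (hc : c ∈ M.out)
    (hc' : M.face c ∉ M.out) (hd : d ∈ M.out) (hd' : M.face d ∉ M.out) : c = d := by
  by_contra hne
  let A : Set D := {e | e ∈ M.out ∧ M.face e ∉ M.out}
  let B : Set D := {e | e ∉ M.out ∧ M.face e ∈ M.out}
  let C : Set D := {e | e ∈ M.out ∧ M.rot e ∉ M.out}
  let E : Set D := {e | e ∉ M.out ∧ M.rot e ∈ M.out}
  -- Each face has a top, and the face of `d` still has the second top `c`, so removing `d` leaves
  -- every face with one.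
  have hA : numCycles M.face ≤ (A \ {d}).ncard := by
    have : Quotient.mk (SameCycle.setoid M.face) '' (A \ {d}) = Set.univ := by
      rw [Set.eq_univ_iff_forall]
      rintro ⟨x⟩
      by_cases hx : SameCycle M.face x c
      · exact ⟨c, ⟨⟨hc, hc'⟩, hne⟩, Quotient.sound hx.symm⟩
      · obtain ⟨e, he, heo⟩ := hM.exists_mem_face x
        obtain ⟨e', he', heo'⟩ := hM.exists_notMem_face e
        obtain ⟨f, hf, hf1, hf2⟩ := exists_mem_apply_notMem he' heo heo'
        refine ⟨f, ⟨⟨hf1, hf2⟩, ?_⟩, Quotient.sound (he.trans hf).symm⟩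
        rintro rfl
        exact hx ((he.trans hf).trans hcd.symm)
    rw [numCycles, ← Set.ncard_univ, ← this]
    exact Set.ncard_image_le (Set.toFinite _)
  have hB : numCycles M.face ≤ B.ncard := by
    have : Quotient.mk (SameCycle.setoid M.face) '' B = Set.univ := by
      rw [Set.eq_univ_iff_forall]
      rintro ⟨x⟩
      obtain ⟨e, he, heo⟩ := hM.exists_notMem_face x
      obtain ⟨e', he', heo'⟩ := hM.exists_mem_face e
      obtain ⟨f, hf, hf1, hf2⟩ := exists_mem_apply_notMem (A := M.outᶜ) he' heo (not_not.2 heo')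
      exact ⟨f, ⟨hf1, not_not.1 hf2⟩, Quotient.sound (he.trans hf).symm⟩
    rw [numCycles, ← Set.ncard_univ, ← this]
    exact Set.ncard_image_le (Set.toFinite _)
  have hpoles : ∀ X : Set D, (∀ x, ¬ SameCycle M.rot M.root x →
      ¬ SameCycle M.rot (M.opp M.root) x → ∃ f ∈ X, SameCycle M.rot x f) →
      numCycles M.rot ≤ X.ncard + 2 := by
    intro X hX
    let q : D → Quotient (SameCycle.setoid M.rot) := Quotient.mk _
    have : q '' X ∪ {q M.root, q (M.opp M.root)} = Set.univ := by
      rw [Set.eq_univ_iff_forall]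
      rintro ⟨x⟩
      by_cases h1 : SameCycle M.rot M.root x
      · right; left; exact Quotient.sound h1.symm
      by_cases h2 : SameCycle M.rot (M.opp M.root) x
      · right; right; exact Quotient.sound h2.symm
      obtain ⟨f, hf, hxf⟩ := hX x h1 h2
      exact Or.inl ⟨f, hf, Quotient.sound hxf.symm⟩
    rw [numCycles, ← Set.ncard_univ, ← this]
    refine (Set.ncard_union_le _ _).trans ?_
    exact Nat.add_le_add (Set.ncard_image_le (Set.toFinite _)) (Set.ncard_insert_le _ _ |>.trans
      (by simp))
  have hC : numCycles M.rot ≤ C.ncard + 2 := by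
    refine hpoles C fun x h1 h2 => ?_
    obtain ⟨e, he, heo⟩ := hM.exists_mem h2
    obtain ⟨e', he', heo'⟩ := hM.exists_notMem (fun h => h1 (h.trans he.symm))
    obtain ⟨f, hf, hf1, hf2⟩ := exists_mem_apply_notMem he' heo heo'
    exact ⟨f, ⟨hf1, hf2⟩, he.trans hf⟩
  have hE : numCycles M.rot ≤ E.ncard + 2 := by
    refine hpoles E fun x h1 h2 => ?_
    obtain ⟨e, he, heo⟩ := hM.exists_notMem h1
    obtain ⟨e', he', heo'⟩ := hM.exists_mem (fun h => h2 (h.trans he.symm))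
    obtain ⟨f, hf, hf1, hf2⟩ := exists_mem_apply_notMem (A := M.outᶜ) he' heo (not_not.2 heo')
    exact ⟨f, ⟨hf1, not_not.1 hf2⟩, he.trans hf⟩
  have hAd : (A \ {d}).ncard + 1 = A.ncard := Set.ncard_sdiff_singleton_add_one ⟨hd, hd'⟩
  have hA' : (M.opp '' A).ncard = A.ncard := Set.ncard_image_of_injective _ M.opp.injective
  have hB' : (M.opp '' B).ncard = B.ncard := Set.ncard_image_of_injective _ M.opp.injective
  -- The corners `(y, M.rot y)` split into four types: outgoing-incoming `C`, incoming-outgoing `E`,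
  -- both incoming (tops of faces, through `opp`), both outgoing (bottoms of faces). With `V`, `F`
  -- the numbers of vertices and faces, a second top makes their number at least `2 (V - 2) + 2 F +
  -- 1`, whereas Euler's relation makes it `2 (V - 2) + 2 F`.
  have memA : ∀ y, y ∈ M.opp '' A ↔ y ∉ M.out ∧ M.rot y ∉ M.out := by
    intro y
    constructor
    · rintro ⟨e, ⟨h1, h2⟩, rfl⟩
      exact ⟨(hM.orient e).1 h1, h2⟩
    · rintro ⟨h1, h2⟩
      refine ⟨M.opp y, ⟨hM.opp_mem_iff.2 h1, ?_⟩, hM.opp_opp y⟩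
      rwa [face_apply, hM.opp_opp]
  have memB : ∀ y, y ∈ M.opp '' B ↔ y ∈ M.out ∧ M.rot y ∈ M.out := by
    intro y
    constructor
    · rintro ⟨e, ⟨h1, h2⟩, rfl⟩
      exact ⟨hM.opp_mem_iff.2 h1, h2⟩
    · rintro ⟨h1, h2⟩
      refine ⟨M.opp y, ⟨(hM.orient y).1 h1, ?_⟩, hM.opp_opp y⟩
      rwa [face_apply, hM.opp_opp]
  have e1 : (C ∪ E).ncard = C.ncard + E.ncard :=
    Set.ncard_union_eq (Set.disjoint_left.2 fun y h1 h2 => h2.1 h1.1)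
  have e2 : (M.opp '' A ∪ M.opp '' B).ncard = A.ncard + B.ncard := by
    rw [Set.ncard_union_eq (Set.disjoint_left.2 fun y h1 h2 => ((memA y).1 h1).1 ((memB y).1 h2).1),
      hA', hB']
  have e3 : ((C ∪ E) ∪ (M.opp '' A ∪ M.opp '' B)).ncard =
      (C.ncard + E.ncard) + (A.ncard + B.ncard) := by
    rw [Set.ncard_union_eq ?_, e1, e2]
    rw [Set.disjoint_left]
    rintro y (h1 | h1) (h2 | h2)
    · exact ((memA y).1 h2).1 h1.1
    · exact h1.2 ((memB y).1 h2).2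
    · exact ((memA y).1 h2).2 h1.2
    · exact h1.1 ((memB y).1 h2).1
  have e4 : ((C ∪ E) ∪ (M.opp '' A ∪ M.opp '' B)).ncard ≤ Nat.card D := by
    rw [← Set.ncard_univ]
    exact Set.ncard_le_ncard (Set.subset_univ _)
  have := hM.euler
  omega

/-- The root is the only ascending dart of the root-face. -/
theorem eq_root_of_mem_out [Finite D] {d : D} (h : SameCycle M.face M.root d) (hd : d ∈ M.out) :
    d = M.root := by
  by_contra hne
  -- The dart before the root on its face ends at the source, so it descends. As the root is the
  -- unique top of its face, any other ascending dart is followed by an ascending dart different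
  -- from the root; iterating never reaches the root.
  have hpre : M.face⁻¹ M.root ∉ M.out := by
    have h1 : M.rot (M.opp (M.face⁻¹ M.root)) = M.root := apply_inv_apply M.face M.root
    rw [← hM.opp_mem_iff]
    refine hM.mem_out_of_source (SameCycle.symm ?_)
    have := sameCycle_self_apply M.rot (M.opp (M.face⁻¹ M.root))
    rwa [h1] at this
  have := SameCycle.mem_of_mapsTo (A := {e | SameCycle M.face M.root e ∧ e ∈ M.out ∧ e ≠ M.root})
    ?_ h.symm ⟨h, hd, hne⟩
  · exact this.2.2 rfl
  · rintro e ⟨h1, h2, h3⟩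
    have h4 : M.face e ∈ M.out := by
      by_contra h4
      exact h3 (hM.eq_of_top h1 hM.root_mem hM.face_root_notMem h2 h4).symm
    refine ⟨h1.trans (sameCycle_self_apply _ _), h4, fun h5 => ?_⟩
    rw [← h5, show M.face⁻¹ (M.face e) = e from M.face.symm_apply_apply e] at hpre
    exact hpre h2

end Valid

end OrientedMap

/-! ### Adding, deleting and contracting the edge before the root -/

namespace OrientedMap

open Equiv.Perm

variable {D : Type} [DecidableEq D]

/-- Add an edge with darts `some none`, leaving the root-vertex just before the root, and `none`,
leaving the vertex of `x` just before `x`. -/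
def addEdge (M : OrientedMap D) (x : D) : OrientedMap (Option (Option D)) where
  rot := insertBefore (insertBefore M.rot M.root) (some x)
  opp := Equiv.swap none (some none) * Equiv.optionCongr (Equiv.optionCongr M.opp)
  root := some (some M.root)
  out := {c | c = some none ∨ ∃ d ∈ M.out, c = some (some d)}

/-- Cut the root-vertex at `x`, or glue the vertex of `x` to it. -/
def twist (M : OrientedMap D) (x : D) : OrientedMap D :=
  { M with rot := Equiv.swap M.root x * M.rot }

@[simp] theorem twist_twist (M : OrientedMap D) (x : D) : (M.twist x).twist x = M := by
  ext1 <;> simp [twist]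

theorem twist_rot (M : OrientedMap D) (x : D) :
    (M.twist x).rot = Equiv.swap M.root x * M.rot := rfl

@[simp] theorem twist_opp (M : OrientedMap D) (x : D) : (M.twist x).opp = M.opp := rfl

@[simp] theorem twist_root (M : OrientedMap D) (x : D) : (M.twist x).root = M.root := rfl

@[simp] theorem twist_out (M : OrientedMap D) (x : D) : (M.twist x).out = M.out := rfl

/-- The transposition multiplies on the left, so it acts on vertices and faces alike: one `twist`
cuts or glues both the root-vertex and the root-face. -/
theorem twist_face (M : OrientedMap D) (x : D) :
    (M.twist x).face = Equiv.swap M.root x * M.face := by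
  simp [face, twist, mul_assoc]

section addEdge

variable (M : OrientedMap D) (x : D)

@[simp] theorem addEdge_opp_none : (M.addEdge x).opp none = some none := by simp [addEdge]

@[simp] theorem addEdge_opp_some_none : (M.addEdge x).opp (some none) = none := by simp [addEdge]

@[simp] theorem addEdge_opp_some_some (d : D) :
    (M.addEdge x).opp (some (some d)) = some (some (M.opp d)) := by
  simp [addEdge, Equiv.swap_apply_of_ne_of_ne]

@[simp] theorem addEdge_root : (M.addEdge x).root = some (some M.root) := rfl

@[simp] theorem none_notMem_addEdge_out : none ∉ (M.addEdge x).out := by simp [addEdge]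

@[simp] theorem some_none_mem_addEdge_out : some none ∈ (M.addEdge x).out := by simp [addEdge]

@[simp] theorem some_some_mem_addEdge_out (d : D) :
    some (some d) ∈ (M.addEdge x).out ↔ d ∈ M.out := by simp [addEdge]

theorem addEdge_rot_none : (M.addEdge x).rot none = some (some x) := by simp [addEdge]

theorem addEdge_rot_some_none (h : x ≠ M.root) :
    (M.addEdge x).rot (some none) = some (some M.root) := by
  simp [addEdge, insertBefore_some, h.symm]

theorem sameCycle_addEdge_rot (c d : Option (Option D)) :
    SameCycle (M.addEdge x).rot c d ↔
      SameCycle M.rot ((c.getD (some x)).getD M.root) ((d.getD (some x)).getD M.root) := by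
  rw [addEdge, sameCycle_insertBefore, sameCycle_insertBefore]

/-- Joining two corners by an edge changes the faces by the transposition of `M.root` and `x`, after
which the two new darts are inserted. Thus faces of the enlarged map are read off from those of
`M.twist x`. -/
theorem addEdge_face (h : x ≠ M.root) : (M.addEdge x).face =
    insertBefore (insertBefore (M.twist x).face x) (some M.root) := by
  ext1 c
  rw [twist_face]
  rcases c with (_ | _ | d)
  · rw [face_apply, addEdge_opp_none, addEdge_rot_some_none _ _ h, insertBefore_none]
  · rw [face_apply, addEdge_opp_some_none, addEdge_rot_none, insertBefore_some, insertBefore_none]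
    simp [h]
  · rw [face_apply, addEdge_opp_some_some]
    simp only [addEdge, insertBefore_some]
    rcases swap_mul_apply_cases M.face M.root x d with h4 | h4 | h4
    · rw [face_apply] at h4
      simp [h4.2, h4.1]
    · rw [face_apply] at h4
      simp [h4.2, h4.1, h, h.symm]
    · rw [h4.2.2, face_apply]
      rw [face_apply] at h4
      simp [h4.1, h4.2.1]

theorem sameCycle_addEdge_face (h : x ≠ M.root) (c d : Option (Option D)) :
    SameCycle (M.addEdge x).face c d ↔
      SameCycle (M.twist x).face ((c.getD (some M.root)).getD x)
        ((d.getD (some M.root)).getD x) := by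
  rw [addEdge_face M x h, sameCycle_insertBefore, sameCycle_insertBefore]

theorem numCycles_addEdge_rot : numCycles (M.addEdge x).rot = numCycles M.rot := by
  rw [addEdge, numCycles_insertBefore, numCycles_insertBefore]

theorem numCycles_addEdge_face (h : x ≠ M.root) :
    numCycles (M.addEdge x).face = numCycles (M.twist x).face := by
  rw [addEdge_face M x h, numCycles_insertBefore, numCycles_insertBefore]

end addEdge

open Classical in
-- The inverse of a deletion. The new edge cuts the root-face in two, so both the edges and the
-- faces increase by one. Since `x` descends, it is not at the source and no loop is created.
theorem Valid.addEdge [Finite D] {M : OrientedMap D} (hM : M.Valid) {x : D}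
    (hx : SameCycle M.face M.root x) (hne : x ≠ M.root) : (M.addEdge x).Valid := by
  have hxo : x ∉ M.out := fun h => hne (hM.eq_root_of_mem_out hx h)
  have hsx : ¬ SameCycle M.rot M.root x := fun h => hxo (hM.mem_out_of_source h)
  refine ⟨?_, ?_, ?_, ?_, ?_, ?_, ?_⟩
  · rintro (_ | _ | d) <;> simp [hM.opp_opp]
  · rintro (_ | _ | d) <;> simp [hM.opp_ne]
  · rintro (_ | _ | d) <;> simp
    exact hM.orient d
  · obtain ⟨h, hrot, hlt⟩ := hM.potential
    -- Lowering the source to `0` and raising all other vertices by `1` makes the new edge ascend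
    -- whatever `h` was; no edge ends at the source, so the old edges still ascend.
    refine ⟨fun c => if SameCycle M.rot M.root ((c.getD (some x)).getD M.root) then 0 else
      h ((c.getD (some x)).getD M.root) + 1, fun c => ?_, ?_⟩
    · have h1 := sameCycle_self_apply (M.addEdge x).rot c
      rw [sameCycle_addEdge_rot] at h1
      have h2 := SameCycle.apply_eq_of_invariant hrot h1
      have h3 : SameCycle M.rot M.root ((c.getD (some x)).getD M.root) ↔
          SameCycle M.rot M.root ((((M.addEdge x).rot c).getD (some x)).getD M.root) :=
        ⟨fun h => h.trans h1, fun h => h.trans h1.symm⟩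
      simp only [h2, h3]
    · rintro (_ | _ | d) hd
      · simp at hd
      · simp [SameCycle.refl, hsx]
      · have hd' : d ∈ M.out := by simpa using hd
        have : ¬ SameCycle M.rot M.root (M.opp d) := fun h =>
          (hM.orient d).1 hd' (hM.mem_out_of_source h)
        simp only [Option.getD_some, addEdge_opp_some_some, this, if_false]
        have := hlt d hd'
        split_ifs <;> omega
  · intro c
    simp only [sameCycle_addEdge_rot, addEdge_root, Option.getD_some]
    constructor
    · intro h
      by_contra hc
      obtain ⟨e, he, heo⟩ := hM.exists_notMem hc
      have := h (some (some e)) he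
      exact heo (by simpa using this)
    · rintro h (_ | _ | d) hd
      · exact absurd (h.trans hd) hsx
      · simp
      · simpa using hM.mem_out_of_source (h.trans hd)
  · intro c
    simp only [sameCycle_addEdge_rot, addEdge_root, Option.getD_some, addEdge_opp_some_some]
    constructor
    · intro h
      refine (hM.sink _).1 fun e he => ?_
      simpa using h (some (some e)) he
    · rintro h (_ | _ | d) hd
      · simp
      · exact absurd hM.root_mem (hM.notMem_out_of_sink (h.trans hd))
      · simpa using hM.notMem_out_of_sink (h.trans hd)
  · rw [numCycles_addEdge_rot, numCycles_addEdge_face M x hne, twist_face,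
      hx.numCycles_swap_mul hne.symm]
    have := hM.euler
    simp only [Finite.card_option]
    omega

open Classical in
-- The inverse of a contraction: the source of the valid map `M.twist x` is split into the vertices
-- of `M.root` and `x`, which the new edge joins. All old darts at both vertices are outgoing, so
-- the new edge is the only one entering the vertex of `x`.
theorem Valid.addEdge_of_twist [Finite D] {M : OrientedMap D} {x : D} (hM : (M.twist x).Valid)
    (hx : SameCycle (M.twist x).rot M.root x) (hne : x ≠ M.root) : (M.addEdge x).Valid := by
  have hsx : ¬ SameCycle M.rot M.root x := by
    have := hx.not_swap_mul hne.symm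
    rwa [twist_rot, swap_mul_swap_mul] at this
  have hiff := sameCycle_swap_mul_iff hsx
  rw [← twist_rot] at hiff
  have hout : ∀ d, SameCycle M.rot M.root d ∨ SameCycle M.rot x d → d ∈ M.out := fun d hd =>
    hM.mem_out_of_source ((hiff M.root d).2 (Or.inr ⟨Or.inl (SameCycle.refl _ _), hd⟩))
  have hrootc : ∀ d, SameCycle (M.twist x).rot M.root d ↔
      SameCycle M.rot M.root d ∨ SameCycle M.rot x d := fun d => by
    rw [hiff]
    constructor
    · rintro (h | h)
      exacts [Or.inl h, h.2]
    · exact fun h => Or.inr ⟨Or.inl (SameCycle.refl _ _), h⟩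
  have hother : ∀ c d, ¬ (SameCycle M.rot M.root c ∨ SameCycle M.rot x c) →
      (SameCycle (M.twist x).rot c d ↔ SameCycle M.rot c d) := fun c d hc => by
    rw [hiff]; simp [hc]
  have htn : ¬ (SameCycle M.rot M.root (M.opp M.root) ∨ SameCycle M.rot x (M.opp M.root)) :=
    fun h => (hM.orient M.root).1 hM.root_mem (hout _ h)
  refine ⟨?_, ?_, ?_, ?_, ?_, ?_, ?_⟩
  · rintro (_ | _ | d) <;> simp
    exact hM.opp_opp d
  · rintro (_ | _ | d) <;> simp
    exact hM.opp_ne d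
  · rintro (_ | _ | d) <;> simp
    exact hM.orient d
  · obtain ⟨h, hrot, hlt⟩ := hM.potential
    -- The two halves of the old source get potentials `0` and `1`, below all other vertices.
    refine ⟨fun c => if SameCycle M.rot M.root ((c.getD (some x)).getD M.root) then 0 else
      if SameCycle M.rot x ((c.getD (some x)).getD M.root) then 1 else
      h ((c.getD (some x)).getD M.root) + 2, fun c => ?_, ?_⟩
    · have h1 := sameCycle_self_apply (M.addEdge x).rot c
      rw [sameCycle_addEdge_rot] at h1
      have h2 := SameCycle.apply_eq_of_invariant hrot ((hiff _ _).2 (Or.inl h1))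
      have h3 : ∀ z, SameCycle M.rot z ((c.getD (some x)).getD M.root) ↔
          SameCycle M.rot z ((((M.addEdge x).rot c).getD (some x)).getD M.root) := fun z =>
        ⟨fun h => h.trans h1, fun h => h.trans h1.symm⟩
      simp only [h2, h3]
    · rintro (_ | _ | d) hd
      · simp at hd
      · simp [SameCycle.refl, hsx]
      · have hd' : d ∈ M.out := by simpa using hd
        have : ¬ (SameCycle M.rot M.root (M.opp d) ∨ SameCycle M.rot x (M.opp d)) := fun h =>
          (hM.orient d).1 hd' (hout _ h)
        rw [not_or] at this
        simp only [Option.getD_some, addEdge_opp_some_some, this, if_false]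
        have : h d < h (M.opp d) := hlt d hd'
        split_ifs <;> omega
  · intro c
    simp only [sameCycle_addEdge_rot, addEdge_root, Option.getD_some]
    constructor
    · intro h
      by_contra hc
      by_cases hxc : SameCycle M.rot x ((c.getD (some x)).getD M.root)
      · have := h none hxc.symm
        simp at this
      · have hno : ¬ (SameCycle M.rot M.root ((c.getD (some x)).getD M.root) ∨
          SameCycle M.rot x ((c.getD (some x)).getD M.root)) := by simp [hc, hxc]
        obtain ⟨e, he, heo⟩ := hM.exists_notMem (fun h => hno ((hrootc _).1 h))
        have := h (some (some e)) ((hother _ _ hno).1 he)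
        exact heo (by simpa using this)
    · rintro h (_ | _ | d) hd
      · exact absurd (h.trans hd) hsx
      · simp
      · simpa using hout d (Or.inl (h.trans hd))
  · intro c
    simp only [sameCycle_addEdge_rot, addEdge_root, Option.getD_some, addEdge_opp_some_some]
    constructor
    · intro h
      have hno : ¬ (SameCycle M.rot M.root ((c.getD (some x)).getD M.root) ∨
          SameCycle M.rot x ((c.getD (some x)).getD M.root)) := by
        intro hc
        have h1 : (c.getD (some x)).getD M.root ∈ M.out := hout _ hc
        have := h (some (some ((c.getD (some x)).getD M.root))) (SameCycle.refl _ _)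
        simp [h1] at this
      have := (hM.sink ((c.getD (some x)).getD M.root)).1 fun e he => ?_
      · exact (hother _ _ htn).1 this
      · simpa using h (some (some e)) ((hother _ _ hno).1 he)
    · intro h
      have key : ∀ d, SameCycle M.rot ((c.getD (some x)).getD M.root) d → d ∉ M.out := fun d hd =>
        hM.notMem_out_of_sink ((hiff _ _).2 (Or.inl (h.trans hd)))
      rintro (_ | _ | d) hd
      · simp
      · exact absurd hM.root_mem (key _ hd)
      · simpa using key d hd
  · rw [numCycles_addEdge_rot, numCycles_addEdge_face M x hne, numCycles_eq_of_not_sameCycle hsx,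
      ← twist_rot]
    have := hM.euler
    simp only [Finite.card_option]
    omega

section Remove

variable {M : OrientedMap D} {x : D} (hN : (M.addEdge x).Valid)
include hN

/-- Otherwise the new edge would be a loop, along which no potential can increase. -/
theorem Valid.not_sameCycle_of_addEdge : ¬ SameCycle M.rot M.root x := by
  obtain ⟨h, hrot, hlt⟩ := hN.potential
  intro hx
  have h1 : SameCycle (M.addEdge x).rot (some none) none := by
    rw [sameCycle_addEdge_rot]; exact hx
  have h2 := SameCycle.apply_eq_of_invariant hrot h1
  have h3 := hlt (some none) (by simp)
  rw [addEdge_opp_some_none] at h3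
  omega

theorem Valid.of_addEdge_opp_opp (d : D) : M.opp (M.opp d) = d := by
  simpa using hN.opp_opp (some (some d))

theorem Valid.of_addEdge_opp_ne (d : D) : M.opp d ≠ d := by
  simpa using hN.opp_ne (some (some d))

theorem Valid.of_addEdge_orient (d : D) : d ∈ M.out ↔ M.opp d ∉ M.out := by
  simpa using hN.orient (some (some d))

theorem Valid.of_addEdge_potential :
    ∃ h : D → ℕ, (∀ d, h (M.rot d) = h d) ∧ ∀ d ∈ M.out, h d < h (M.opp d) := by
  obtain ⟨h, hrot, hlt⟩ := hN.potential
  refine ⟨fun d => h (some (some d)), fun d => ?_, fun d hd => ?_⟩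
  · refine (SameCycle.apply_eq_of_invariant hrot ?_).symm
    rw [sameCycle_addEdge_rot]
    exact sameCycle_self_apply M.rot d
  · simpa using hlt (some (some d)) (by simpa using hd)

theorem Valid.of_addEdge_mem_out {d : D} (hd : SameCycle M.rot M.root d) : d ∈ M.out := by
  have : SameCycle (M.addEdge x).rot (M.addEdge x).root (some (some d)) := by
    rw [sameCycle_addEdge_rot]; exact hd
  simpa using hN.mem_out_of_source this

theorem Valid.of_addEdge_notMem_out {d : D} (hd : SameCycle M.rot (M.opp M.root) d) :
    d ∉ M.out := by
  have : SameCycle (M.addEdge x).rot ((M.addEdge x).opp (M.addEdge x).root) (some (some d)) := by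
    rw [sameCycle_addEdge_rot]; simpa using hd
  simpa using hN.notMem_out_of_sink this

/-- The deletion of an edge whose end has another incoming edge. -/
theorem Valid.of_addEdge [Finite D] (hne : x ≠ M.root) {e : D} (he : SameCycle M.rot x e)
    (heo : e ∉ M.out) : M.Valid ∧ SameCycle M.face M.root x := by
  -- If `M.root` and `x` were on different faces of `M`, the new edge would merge these, and its
  -- ascending dart `some none` would lie on the root-face beside the root, against
  -- `eq_root_of_mem_out`.
  have hface : SameCycle M.face M.root x := by
    have h1 : ¬ SameCycle (M.addEdge x).face (M.addEdge x).root (some none) := fun h => by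
      have := hN.eq_root_of_mem_out h (by simp)
      simp at this
    rw [sameCycle_addEdge_face M x hne, twist_face] at h1
    by_contra h2
    exact h1 (sameCycle_swap_mul_of_not h2)
  refine ⟨⟨hN.of_addEdge_opp_opp, hN.of_addEdge_opp_ne, hN.of_addEdge_orient,
    hN.of_addEdge_potential, fun d => ⟨fun h => ?_, fun h f hf => ?_⟩,
    fun d => ⟨fun h => ?_, fun h f hf => ?_⟩, ?_⟩, hface⟩
  · have := (hN.source (some (some d))).1 ?_
    · rw [sameCycle_addEdge_rot] at this; exact this
    · rintro (_ | _ | f) hf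
      · rw [sameCycle_addEdge_rot] at hf
        exact absurd (h e (hf.trans he)) heo
      · simp
      · rw [sameCycle_addEdge_rot] at hf
        simpa using h f hf
  · exact hN.of_addEdge_mem_out (h.trans hf)
  · have := (hN.sink (some (some d))).1 ?_
    · rw [sameCycle_addEdge_rot] at this; simpa using this
    · rintro (_ | _ | f) hf
      · simp
      · rw [sameCycle_addEdge_rot] at hf
        exact absurd (hN.of_addEdge_mem_out (SameCycle.refl _ _)) (h _ hf)
      · rw [sameCycle_addEdge_rot] at hf
        simpa using h f hf
  · exact hN.of_addEdge_notMem_out (h.trans hf)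
  · have := hN.euler
    rw [numCycles_addEdge_rot, numCycles_addEdge_face M x hne, twist_face,
      hface.numCycles_swap_mul hne.symm] at this
    simp only [Finite.card_option] at this
    omega

open Classical in
/-- The contraction of an edge whose end has no other incoming edge. -/
theorem Valid.twist_of_addEdge [Finite D] (hne : x ≠ M.root)
    (hx : ∀ e, SameCycle M.rot x e → e ∈ M.out) :
    (M.twist x).Valid ∧ SameCycle (M.twist x).rot M.root x := by
  have hsx := hN.not_sameCycle_of_addEdge
  have hiff := sameCycle_swap_mul_iff hsx
  rw [← twist_rot] at hiff
  have hout : ∀ d, SameCycle M.rot M.root d ∨ SameCycle M.rot x d → d ∈ M.out := by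
    rintro d (hd | hd)
    · exact hN.of_addEdge_mem_out hd
    · exact hx d hd
  have hrootc : ∀ d, SameCycle (M.twist x).rot M.root d ↔
      SameCycle M.rot M.root d ∨ SameCycle M.rot x d := fun d => by
    rw [hiff]
    constructor
    · rintro (h | h)
      exacts [Or.inl h, h.2]
    · exact fun h => Or.inr ⟨Or.inl (SameCycle.refl _ _), h⟩
  have hother : ∀ c d, ¬ (SameCycle M.rot M.root c ∨ SameCycle M.rot x c) →
      (SameCycle (M.twist x).rot c d ↔ SameCycle M.rot c d) := fun c d hc => by
    rw [hiff]; simp [hc]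
  have hrm : M.root ∈ M.out := hout _ (Or.inl (SameCycle.refl _ _))
  have htn : ¬ (SameCycle M.rot M.root (M.opp M.root) ∨ SameCycle M.rot x (M.opp M.root)) :=
    fun h => (hN.of_addEdge_orient M.root).1 hrm (hout _ h)
  have hrx : SameCycle (M.twist x).rot M.root x := (hrootc x).2 (Or.inr (SameCycle.refl _ _))
  refine ⟨⟨hN.of_addEdge_opp_opp, hN.of_addEdge_opp_ne, hN.of_addEdge_orient,
    ?_, fun d => ⟨fun h => ?_, fun h f hf => ?_⟩,
    fun d => ⟨fun h => ?_, fun h f hf => ?_⟩, ?_⟩, hrx⟩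
  · obtain ⟨h, hrot, hlt⟩ := hN.of_addEdge_potential
    -- The glued vertex has outgoing darts only, so it can be put at the bottom.
    refine ⟨fun d => if SameCycle (M.twist x).rot M.root d then 0 else h d + 1, fun d => ?_, ?_⟩
    · have h1 : SameCycle (M.twist x).rot M.root ((M.twist x).rot d) ↔
        SameCycle (M.twist x).rot M.root d := sameCycle_apply_right
      simp only [h1]
      split_ifs with h2
      · rfl
      · have h3 := (hother d _ (fun h => h2 ((hrootc d).2 h))).1 (sameCycle_self_apply _ d)
        rw [SameCycle.apply_eq_of_invariant hrot h3]
    · intro d hd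
      have : ¬ SameCycle (M.twist x).rot M.root (M.opp d) := fun h =>
        (hN.of_addEdge_orient d).1 hd (hout _ ((hrootc _).1 h))
      have h2 : (M.twist x).opp d = M.opp d := rfl
      simp only [h2, this, if_false]
      have := hlt d hd
      split_ifs <;> omega
  · change SameCycle (M.twist x).rot M.root d
    by_contra hd
    have hno : ¬ (SameCycle M.rot M.root d ∨ SameCycle M.rot x d) :=
      fun hh => hd ((hrootc d).2 hh)
    have := (hN.source (some (some d))).1 ?_
    · rw [sameCycle_addEdge_rot] at this
      exact hno (Or.inl this)
    · rintro (_ | _ | f) hf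
      · rw [sameCycle_addEdge_rot] at hf
        exact absurd (Or.inr hf.symm) hno
      · simp
      · rw [sameCycle_addEdge_rot] at hf
        simpa using h f ((hother _ _ hno).2 hf)
  · exact hout f ((hrootc f).1 (SameCycle.trans h hf))
  · have hno : ¬ (SameCycle M.rot M.root d ∨ SameCycle M.rot x d) := fun hd =>
      h d (SameCycle.refl _ _) (hout d hd)
    refine (hother (M.opp M.root) d htn).2 ?_
    have := (hN.sink (some (some d))).1 ?_
    · rw [sameCycle_addEdge_rot] at this; simpa using this
    · rintro (_ | _ | f) hf
      · simp
      · rw [sameCycle_addEdge_rot] at hf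
        exact absurd (Or.inl hf.symm) hno
      · rw [sameCycle_addEdge_rot] at hf
        simpa using h f ((hother _ _ hno).2 hf)
  · have h1 : SameCycle (M.twist x).rot (M.opp M.root) d := h
    exact hN.of_addEdge_notMem_out ((hother _ _ htn).1 (h1.trans hf))
  · have := hN.euler
    rw [numCycles_addEdge_rot, numCycles_addEdge_face M x hne,
      numCycles_eq_of_not_sameCycle hsx, ← twist_rot] at this
    simp only [Finite.card_option] at this
    omega

end Remove

end OrientedMap

/-! ### Degrees, and the recurrence with two marked darts -/

theorem Equiv.Perm.exists_eq_optionCongr {D : Type*} [DecidableEq D] {σ : Equiv.Perm (Option D)}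
    (h : σ none = none) : ∃ π : Equiv.Perm D, σ = Equiv.optionCongr π := by
  refine ⟨(Equiv.Perm.decomposeOption σ).2, ?_⟩
  have := Equiv.Perm.decomposeOption.symm_apply_apply σ
  rw [Equiv.Perm.decomposeOption_symm_apply] at this
  have h1 : (Equiv.Perm.decomposeOption σ).1 = none := h
  rw [h1, Equiv.swap_self] at this
  exact this.symm

namespace OrientedMap

open Equiv.Perm

variable {D : Type}

noncomputable def numVertices (M : OrientedMap D) : ℕ := numCycles M.rot

noncomputable def rootVertexDegree (M : OrientedMap D) : ℕ := {d | SameCycle M.rot M.root d}.ncard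

noncomputable def rootFaceDegree (M : OrientedMap D) : ℕ := {d | SameCycle M.face M.root d}.ncard

/-- If the source has degree one, the lowest non-source vertex is entered from the source, hence by
the root-edge, hence is the sink. But every tail lies strictly below the sink, so every tail is the
source. -/
theorem Valid.eq_root_of_rot_root [Finite D] {M : OrientedMap D} (hM : M.Valid)
    (hr : M.rot M.root = M.root) {e : D} (he : e ∈ M.out) : e = M.root := by
  have hfix : ∀ d, SameCycle M.rot M.root d → d = M.root := fun d hd =>
    SameCycle.mem_of_mapsTo (A := {M.root}) (by rintro _ rfl; exact hr) hd rfl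
  obtain ⟨h, hrot, hlt⟩ := hM.potential
  have htm := (hM.orient _).1 hM.root_mem
  have hmin : ∀ d ∉ M.out, h (M.opp M.root) ≤ h d := by
    obtain ⟨d, hd, hmin⟩ := Set.exists_min_image M.outᶜ h (Set.toFinite _) ⟨_, htm⟩
    have hdo := hM.opp_mem_iff.2 hd
    have hlt' := hlt _ hdo
    rw [hM.opp_opp] at hlt'
    have : SameCycle M.rot M.root (M.opp d) := by
      by_contra hno
      obtain ⟨e, he, heo⟩ := hM.exists_notMem hno
      have := hmin e heo
      have := SameCycle.apply_eq_of_invariant hrot he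
      omega
    rw [← hfix _ this, hM.opp_opp]
    exact hmin
  have hmax : ∀ d ∈ M.out, h d < h (M.opp M.root) := by
    obtain ⟨d, hd, hmax⟩ := Set.exists_max_image M.out h (Set.toFinite _) ⟨_, hM.root_mem⟩
    have : SameCycle M.rot (M.opp M.root) (M.opp d) := by
      by_contra hno
      obtain ⟨e, he, heo⟩ := hM.exists_mem hno
      have := hmax e heo
      have := SameCycle.apply_eq_of_invariant hrot he
      have := hlt d hd
      omega
    rw [SameCycle.apply_eq_of_invariant hrot this]
    exact fun f hf => (hmax f hf).trans_lt (hlt d hd)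
  refine hfix e ?_
  by_contra hno
  obtain ⟨f, hf, hfo⟩ := hM.exists_notMem hno
  have h1 := hmin f hfo
  have h2 := hmax e he
  have h3 := SameCycle.apply_eq_of_invariant hrot hf
  omega

theorem Valid.rot_root_ne [Finite D] {M : OrientedMap D} (hM : M.Valid) (hD : 3 ≤ Nat.card D) :
    M.rot M.root ≠ M.root := by
  classical
  intro hr
  have := Fintype.ofFinite D
  obtain ⟨e, he⟩ : ∃ e, e ∉ ({M.root, M.opp M.root} : Finset D) := by
    by_contra! hall
    have h1 : (Finset.univ : Finset D) ⊆ {M.root, M.opp M.root} := fun e _ => hall e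
    have h2 := (Finset.card_le_card h1).trans Finset.card_le_two
    rw [Finset.card_univ, ← Nat.card_eq_fintype_card] at h2
    omega
  simp only [Finset.mem_insert, Finset.mem_singleton, not_or] at he
  by_cases h : e ∈ M.out
  · exact he.1 (hM.eq_root_of_rot_root hr h)
  · refine he.2 ?_
    rw [← hM.eq_root_of_rot_root hr (hM.opp_mem_iff.2 h), hM.opp_opp]

theorem Valid.two_le_rootVertexDegree [Finite D] {M : OrientedMap D} (hM : M.Valid)
    (hD : 3 ≤ Nat.card D) : 2 ≤ M.rootVertexDegree := by
  have h1 : ({M.root, M.rot M.root} : Set D) ⊆ {d | SameCycle M.rot M.root d} := by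
    rintro d (rfl | rfl)
    exacts [SameCycle.refl _ _, sameCycle_self_apply _ _]
  have := Set.ncard_le_ncard h1 (Set.toFinite _)
  rwa [Set.ncard_pair (hM.rot_root_ne hD).symm] at this

theorem Valid.two_le_rootFaceDegree [Finite D] {M : OrientedMap D} (hM : M.Valid) :
    2 ≤ M.rootFaceDegree := by
  have h1 : ({M.root, M.face M.root} : Set D) ⊆ {d | SameCycle M.face M.root d} := by
    rintro d (rfl | rfl)
    exacts [SameCycle.refl _ _, sameCycle_self_apply _ _]
  have := Set.ncard_le_ncard h1 (Set.toFinite _)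
  rwa [Set.ncard_pair] at this
  intro h
  have := hM.face_root_notMem
  rw [← h] at this
  exact this hM.root_mem

variable [DecidableEq D]

theorem addEdge_inj {M M' : OrientedMap D} {x x' : D} (h : M.addEdge x = M'.addEdge x') :
    M = M' ∧ x = x' := by
  have h1 := insertBefore_inj (congrArg OrientedMap.rot h)
  have h2 := insertBefore_inj h1.1
  refine ⟨?_, by simpa using h1.2⟩
  ext1
  · exact h2.1
  · ext1 d
    have := congrArg (fun N => N.opp (some (some d))) h
    simpa using this
  · exact h2.2
  · ext d
    have := congrArg (fun N => some (some d) ∈ N.out) h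
    simpa using this

/-- Erasing the two darts from their cycles needs a dart `x` after `none`. It is not `some none`,
since the edge is no loop. It is not `none` either: the head of the edge would then be a sink of
degree one, which would make the edge the root-edge. -/
theorem Valid.exists_eq_addEdge [Finite D] {N : OrientedMap (Option (Option D))} (hN : N.Valid)
    (hD : Nonempty D) (hrot : N.rot (some none) = N.root) (hopp : N.opp none = some none) :
    ∃ (M : OrientedMap D) (x : D), x ≠ M.root ∧ N = M.addEdge x := by
  have hopp' : N.opp (some none) = none := by rw [← hopp, hN.opp_opp]
  have hsa : SameCycle N.rot N.root (some none) := by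
    have := (sameCycle_self_apply N.rot (some none)).symm
    rwa [hrot] at this
  have hao : some none ∈ N.out := hN.mem_out_of_source hsa
  have hbo : none ∉ N.out := by
    have := (hN.orient _).1 hao
    rwa [hopp'] at this
  have hra : N.root ≠ some none := by
    intro h
    refine hN.rot_root_ne ?_ (by rw [h, hrot, h])
    have := Nat.card_pos (α := D)
    simp only [Finite.card_option]
    omega
  obtain ⟨r, hr⟩ : ∃ r, N.root = some (some r) := by
    rcases hroot : N.root with (_ | _ | r)
    · exact absurd (hroot ▸ hN.root_mem) hbo
    · exact absurd hroot hra
    · exact ⟨r, rfl⟩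
  obtain ⟨x, hx⟩ : ∃ x, N.rot none = some (some x) := by
    rcases hrn : N.rot none with (_ | _ | x)
    · have hfix : ∀ d, SameCycle N.rot none d → d = none := fun d hd =>
        SameCycle.mem_of_mapsTo (A := {none}) (by rintro _ rfl; exact hrn) hd rfl
      have := (hN.sink none).1 (fun e he => hfix e he ▸ hbo)
      have h1 := hfix _ this.symm
      exact absurd (by rw [← hopp, ← h1, hN.opp_opp]) hra
    · obtain ⟨h, hhrot, hlt⟩ := hN.potential
      have h1 := hlt _ hao
      have h2 := hhrot none
      rw [hopp'] at h1
      rw [hrn] at h2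
      omega
    · exact ⟨x, rfl⟩
  have hxr : x ≠ r := by
    rintro rfl
    have := N.rot.injective (hx.trans (hr.symm.trans hrot.symm))
    simp at this
  obtain ⟨σ, hσ⟩ := exists_eq_insertBefore hx
  have hσn : σ none = some r := by
    have h1 := hrot
    rw [hσ, insertBefore_some, hr] at h1
    split_ifs at h1
    simpa using h1
  obtain ⟨ρ, rfl⟩ := exists_eq_insertBefore hσn
  obtain ⟨o, ho⟩ := exists_eq_insertBefore hopp
  have hon : o none = none := by
    have h1 := hopp'
    rw [ho, insertBefore_some] at h1
    split_ifs at h1 with h2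
    exact h2
  obtain ⟨π, rfl⟩ := exists_eq_optionCongr hon
  refine ⟨⟨ρ, π, r, {d | some (some d) ∈ N.out}⟩, x, hxr, ?_⟩
  ext1
  · exact hσ
  · exact ho
  · exact hr
  · ext (_ | _ | d)
    · simpa using hbo
    · simpa using hao
    · simp

theorem rootVertexDegree_addEdge [Finite D] {M : OrientedMap D} {x : D}
    (h : ¬ SameCycle M.rot M.root x) :
    (M.addEdge x).rootVertexDegree = M.rootVertexDegree + 1 := by
  classical
  unfold rootVertexDegree
  rw [addEdge_root, addEdge, ncard_sameCycle_insertBefore, ncard_sameCycle_insertBefore,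
    sameCycle_insertBefore]
  simp [h, SameCycle.refl]

/-- Of the two new darts only `none` is inserted on the root-face; `some none` goes to the face of
`x`. -/
theorem rootFaceDegree_addEdge [Finite D] {M : OrientedMap D} {x : D} (hne : x ≠ M.root)
    (h : ¬ SameCycle (M.twist x).face M.root x) :
    (M.addEdge x).rootFaceDegree = (M.twist x).rootFaceDegree + 1 := by
  classical
  unfold rootFaceDegree
  rw [addEdge_root, addEdge_face M x hne, ncard_sameCycle_insertBefore,
    ncard_sameCycle_insertBefore, sameCycle_insertBefore]
  simp [h, SameCycle.refl]

/-- The valid maps whose number of vertices, root-vertex degree and root-face degree satisfy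
`P`. -/
def validSet (D : Type) (P : ℕ → ℕ → ℕ → Prop) : Set (OrientedMap D) :=
  {M | M.Valid ∧ P M.numVertices M.rootVertexDegree M.rootFaceDegree}

instance [Finite D] : Finite (OrientedMap D) := by
  refine Finite.of_injective
    (fun M : OrientedMap D => (M.rot, M.opp, M.root, M.out)) fun M N h => ?_
  simp only [Prod.mk.injEq] at h
  exact OrientedMap.ext h.1 h.2.1 h.2.2.1 h.2.2.2

/-- The two summands are deletion (`f` is its inverse) and contraction (inverse `g`). A
transposition cuts a cycle into pieces whose lengths determine the cutting point, so prescribing `j`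
fixes `x` as the `(j-1)`-st dart after the root on the root-face of `M`, and prescribing `i` fixes
it as the `(i-1)`-st dart after the root around the source. The inequalities `j ≤ b` and `i ≤ a` say
that this dart exists and is not the root again. -/
theorem ncard_validSet_option_option [Finite D] (hD : Nonempty D) (m i j : ℕ) (hi : 2 ≤ i)
    (hj : 2 ≤ j) :
    {N | N ∈ validSet (Option (Option D)) (fun v a b => v = m + 1 ∧ a = i ∧ b = j) ∧
      N.rot (some none) = N.root ∧ N.opp none = some none}.ncard =
    (validSet D fun v a b => v = m + 1 ∧ a + 1 = i ∧ j ≤ b).ncard +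
      (validSet D fun v a b => v = m ∧ i ≤ a ∧ b + 1 = j).ncard := by
  let f : OrientedMap D → OrientedMap (Option (Option D)) :=
    fun M => M.addEdge ((M.face ^ (j - 1)) M.root)
  let g : OrientedMap D → OrientedMap (Option (Option D)) :=
    fun M => (M.twist ((M.rot ^ (i - 1)) M.root)).addEdge ((M.rot ^ (i - 1)) M.root)
  set X := validSet D fun v a b => v = m + 1 ∧ a + 1 = i ∧ j ≤ b with hX
  set Y := validSet D fun v a b => v = m ∧ i ≤ a ∧ b + 1 = j with hY
  have hf : Set.InjOn f X := fun M _ M' _ h => (addEdge_inj h).1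
  have hg : Set.InjOn g Y := fun M _ M' _ h => by
    have h1 := addEdge_inj h
    have h2 := h1.1
    rw [h1.2] at h2
    rw [← twist_twist M _, h2, twist_twist]
  -- The dart `x` descends in the deletion case and ascends in the contraction case.
  have hdisj : Disjoint (f '' X) (g '' Y) := by
    rw [Set.disjoint_left]
    rintro _ ⟨M, ⟨hM, -, -, hMj⟩, rfl⟩ ⟨M', ⟨hM', -, hMi, -⟩, h⟩
    obtain ⟨h1, h2⟩ := addEdge_inj h
    have h3 : (M'.rot ^ (i - 1)) M'.root ∈ M'.out := hM'.mem_out_of_source ⟨(i - 1 : ℕ), by simp⟩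
    have h4 : (M'.rot ^ (i - 1)) M'.root ∈ M.out := by
      rw [← h1]; exact h3
    rw [h2] at h4
    exact pow_ne_self_of_lt M.face M.root (t := j - 1) (by omega)
      (by unfold rootFaceDegree at hMj; omega)
      (hM.eq_root_of_mem_out ⟨(j - 1 : ℕ), by simp⟩ h4)
  rw [← hf.ncard_image, ← hg.ncard_image, ← Set.ncard_union_eq hdisj]
  congr 1
  ext N
  constructor
  · rintro ⟨⟨hN, hv, ha, hb⟩, hrot, hopp⟩
    obtain ⟨M, x, hne, rfl⟩ := hN.exists_eq_addEdge hD hrot hopp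
    have hsx := hN.not_sameCycle_of_addEdge
    rw [numVertices, numCycles_addEdge_rot] at hv
    rw [rootVertexDegree_addEdge hsx] at ha
    by_cases hx : ∀ e, SameCycle M.rot x e → e ∈ M.out
    · right
      obtain ⟨hT, hTx⟩ := hN.twist_of_addEdge hne hx
      have hxo := hx x (SameCycle.refl _ _)
      have hfx : ¬ SameCycle (M.twist x).face M.root x := fun h =>
        hne (hT.eq_root_of_mem_out h hxo)
      rw [rootFaceDegree_addEdge hne hfx] at hb
      have hcut := SameCycle.pow_ncard_swap_mul (t := i - 1) hTx hne.symm (by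
        rw [twist_rot, swap_mul_swap_mul]
        unfold rootVertexDegree at ha
        omega)
      refine ⟨M.twist x, ⟨hT, ?_, ?_, hb⟩, ?_⟩
      · have := numCycles_eq_of_not_sameCycle hsx
        rw [← twist_rot] at this
        unfold numVertices
        omega
      · have := hcut.2.1
        unfold rootVertexDegree
        rw [twist_root]
        omega
      · simp only [g]
        rw [twist_root, hcut.2.2, twist_twist]
    · left
      push Not at hx
      obtain ⟨e, he, heo⟩ := hx
      obtain ⟨hM, hfx⟩ := hN.of_addEdge hne he heo
      have hfx' : ¬ SameCycle (M.twist x).face M.root x := by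
        rw [twist_face]; exact hfx.not_swap_mul hne.symm
      rw [rootFaceDegree_addEdge hne hfx'] at hb
      have hcut := SameCycle.pow_ncard_swap_mul (t := j - 1) hfx hne.symm (by
        rw [← twist_face]
        unfold rootFaceDegree at hb
        rw [twist_root] at hb
        omega)
      refine ⟨M, ⟨hM, hv, ha, ?_⟩, ?_⟩
      · have := hcut.2.1
        unfold rootFaceDegree
        omega
      · simp only [f]
        rw [hcut.2.2]
  · rintro (⟨M, ⟨hM, hv, ha, hb⟩, rfl⟩ | ⟨M, ⟨hM, hv, ha, hb⟩, rfl⟩)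
    · have hlt : j - 1 < {d | SameCycle M.face M.root d}.ncard := by
        unfold rootFaceDegree at hb; omega
      have hne := pow_ne_self_of_lt M.face M.root (by omega : 0 < j - 1) hlt
      have hcut := ncard_sameCycle_swap_mul_pow M.face M.root (by omega : 0 < j - 1) hlt
      simp only [f]
      set x := (M.face ^ (j - 1)) M.root with hx
      have hfx : SameCycle M.face M.root x := ⟨(j - 1 : ℕ), by simp [hx]⟩
      have hN := hM.addEdge hfx hne
      refine ⟨⟨hN, ?_, ?_, ?_⟩, addEdge_rot_some_none M x hne, addEdge_opp_none M x⟩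
      · rw [numVertices, numCycles_addEdge_rot]; exact hv
      · rw [rootVertexDegree_addEdge hN.not_sameCycle_of_addEdge]; exact ha
      · rw [rootFaceDegree_addEdge hne]
        · rw [rootFaceDegree, twist_face, twist_root, hcut]
          omega
        · rw [twist_face]; exact hfx.not_swap_mul hne.symm
    · have hlt : i - 1 < {d | SameCycle M.rot M.root d}.ncard := by
        unfold rootVertexDegree at ha; omega
      have hne := pow_ne_self_of_lt M.rot M.root (by omega : 0 < i - 1) hlt
      have hcut := ncard_sameCycle_swap_mul_pow M.rot M.root (by omega : 0 < i - 1) hlt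
      simp only [g]
      set x := (M.rot ^ (i - 1)) M.root with hx
      have hrx : SameCycle M.rot M.root x := ⟨(i - 1 : ℕ), by simp [hx]⟩
      have hN : ((M.twist x).addEdge x).Valid := Valid.addEdge_of_twist
        (by rw [twist_twist]; exact hM) (by rw [twist_twist]; exact hrx) hne
      refine ⟨⟨hN, ?_, ?_, ?_⟩, addEdge_rot_some_none _ x hne, addEdge_opp_none _ x⟩
      · rw [numVertices, numCycles_addEdge_rot, twist_rot, hrx.numCycles_swap_mul hne.symm]
        rw [numVertices] at hv
        rw [hv]
      · rw [rootVertexDegree_addEdge hN.not_sameCycle_of_addEdge, rootVertexDegree, twist_rot,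
          twist_root, hcut]
        omega
      · rw [rootFaceDegree_addEdge (M := M.twist x) hne, twist_twist]
        · exact hb
        · rw [twist_twist]
          exact fun h => hne (hM.eq_root_of_mem_out h (hM.mem_out_of_source hrx))

end OrientedMap

/-! ### Relabelling of darts, rigidity, and the labelled recurrence -/

theorem Equiv.Perm.sameCycle_permCongr {D E : Type*} (τ : D ≃ E) (π : Equiv.Perm D) (c d : D) :
    Equiv.Perm.SameCycle (τ.permCongr π) (τ c) (τ d) ↔ Equiv.Perm.SameCycle π c d := by
  have key : ∀ k : ℤ, ((τ.permCongr π) ^ k) (τ c) = τ ((π ^ k) c) := fun k => by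
    have : (τ.permCongr π) ^ k = τ.permCongr (π ^ k) := (map_zpow τ.permCongrHom π k).symm
    rw [this]
    simp
  constructor
  · rintro ⟨k, hk⟩
    rw [key] at hk
    exact ⟨k, τ.injective hk⟩
  · rintro ⟨k, rfl⟩
    exact ⟨k, key k⟩

namespace OrientedMap

open Equiv.Perm

variable {D E : Type}

/-- Transport of a map along a bijection of the darts. -/
def relabel (τ : D ≃ E) (M : OrientedMap D) : OrientedMap E where
  rot := τ.permCongr M.rot
  opp := τ.permCongr M.opp
  root := τ M.root
  out := {e | τ.symm e ∈ M.out}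

section relabel

variable (τ : D ≃ E) (M : OrientedMap D)

@[simp] theorem relabel_root : (M.relabel τ).root = τ M.root := rfl

@[simp] theorem relabel_rot (d : D) : (M.relabel τ).rot (τ d) = τ (M.rot d) := by simp [relabel]

@[simp] theorem relabel_opp (d : D) : (M.relabel τ).opp (τ d) = τ (M.opp d) := by simp [relabel]

@[simp] theorem mem_relabel_out (d : D) : τ d ∈ (M.relabel τ).out ↔ d ∈ M.out := by simp [relabel]

theorem relabel_face : (M.relabel τ).face = τ.permCongr M.face :=
  (map_mul τ.permCongrHom M.rot M.opp).symm

@[simp] theorem sameCycle_relabel_rot (c d : D) :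
    SameCycle (M.relabel τ).rot (τ c) (τ d) ↔ SameCycle M.rot c d :=
  sameCycle_permCongr τ M.rot c d

@[simp] theorem sameCycle_relabel_face (c d : D) :
    SameCycle (M.relabel τ).face (τ c) (τ d) ↔ SameCycle M.face c d := by
  rw [relabel_face]; exact sameCycle_permCongr τ M.face c d

theorem numCycles_permCongr (π : Equiv.Perm D) : numCycles (τ.permCongr π) = numCycles π :=
  (card_quotient_eq_of_surjective τ τ.surjective
    fun c d => (sameCycle_permCongr τ π c d).symm).symm

theorem relabel_numVertices : (M.relabel τ).numVertices = M.numVertices :=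
  numCycles_permCongr τ M.rot

theorem relabel_rootVertexDegree : (M.relabel τ).rootVertexDegree = M.rootVertexDegree := by
  unfold rootVertexDegree
  rw [← Set.ncard_image_of_injective _ τ.injective]
  congr 1
  ext e
  obtain ⟨d, rfl⟩ := τ.surjective e
  simp

theorem relabel_rootFaceDegree : (M.relabel τ).rootFaceDegree = M.rootFaceDegree := by
  unfold rootFaceDegree
  rw [← Set.ncard_image_of_injective _ τ.injective]
  congr 1
  ext e
  obtain ⟨d, rfl⟩ := τ.surjective e
  simp

theorem relabel_eq_iff (N : OrientedMap E) : N = M.relabel τ ↔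
    (∀ d, τ (M.rot d) = N.rot (τ d)) ∧ (∀ d, τ (M.opp d) = N.opp (τ d)) ∧
    τ M.root = N.root ∧ (∀ d, d ∈ M.out ↔ τ d ∈ N.out) := by
  constructor
  · rintro rfl
    simp
  · rintro ⟨h1, h2, h3, h4⟩
    ext e
    · obtain ⟨d, rfl⟩ := τ.surjective e
      rw [relabel_rot, h1]
    · obtain ⟨d, rfl⟩ := τ.surjective e
      rw [relabel_opp, h2]
    · exact h3.symm
    · obtain ⟨d, rfl⟩ := τ.surjective e
      rw [mem_relabel_out, h4]

@[simp] theorem relabel_symm_relabel : (M.relabel τ).relabel τ.symm = M := by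
  symm
  rw [relabel_eq_iff]
  refine ⟨fun e => ?_, fun e => ?_, by simp, fun e => ?_⟩ <;>
  · obtain ⟨d, rfl⟩ := τ.surjective e
    simp

variable {M}

theorem Valid.relabel (hM : M.Valid) : (M.relabel τ).Valid := by
  refine ⟨τ.surjective.forall.2 fun d => ?_, τ.surjective.forall.2 fun d => ?_,
    τ.surjective.forall.2 fun d => ?_, ?_, τ.surjective.forall.2 fun d => ?_,
    τ.surjective.forall.2 fun d => ?_, ?_⟩
  · simp [hM.opp_opp]
  · simpa using hM.opp_ne d
  · simpa using hM.orient d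
  · obtain ⟨h, hrot, hlt⟩ := hM.potential
    refine ⟨h ∘ τ.symm, τ.surjective.forall.2 fun d => ?_, τ.surjective.forall.2 fun d hd => ?_⟩
    · simp [hrot]
    · simpa using hlt d (by simpa using hd)
  · rw [τ.surjective.forall]
    simpa using hM.source d
  · rw [τ.surjective.forall]
    simpa using hM.sink d
  · rw [relabel_face]
    rw [numCycles_permCongr, ← Nat.card_congr τ, ← hM.euler]
    exact congrArg (fun n => 2 * (n + _)) (numCycles_permCongr τ M.rot)

variable {P : ℕ → ℕ → ℕ → Prop}

theorem relabel_mem_validSet (hM : M ∈ validSet D P) : M.relabel τ ∈ validSet E P := by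
  refine ⟨hM.1.relabel τ, ?_⟩
  rw [relabel_numVertices, relabel_rootVertexDegree, relabel_rootFaceDegree]
  exact hM.2

end relabel

theorem relabel_injective (τ : D ≃ E) : Function.Injective (relabel τ) := fun M N h => by
  rw [← relabel_symm_relabel τ M, h, relabel_symm_relabel]

theorem ncard_validSet_congr (τ : D ≃ E) (P : ℕ → ℕ → ℕ → Prop) :
    (validSet D P).ncard = (validSet E P).ncard := by
  rw [← Set.ncard_image_of_injective _ (relabel_injective τ)]
  congr 1
  ext N
  constructor
  · rintro ⟨M, hM, rfl⟩
    exact relabel_mem_validSet τ hM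
  · intro hN
    exact ⟨N.relabel τ.symm, relabel_mem_validSet τ.symm hN, relabel_symm_relabel τ.symm N⟩

/-- The maps in which `a` is the dart just before the root and `b` its opposite are equally
numerous for all pairs of distinct darts `a`, `b`. -/
theorem ncard_validSet_eq_mul [Finite E] (P : ℕ → ℕ → ℕ → Prop) {a b : E} (hab : a ≠ b) :
    (validSet E P).ncard = Nat.card E * (Nat.card E - 1) *
      {N | N ∈ validSet E P ∧ N.rot a = N.root ∧ N.opp b = a}.ncard := by
  classical
  have := Fintype.ofFinite E
  have hX : (validSet E P).Finite := Set.toFinite _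
  let F : E × E → Set (OrientedMap E) := fun p =>
    {N | N ∈ validSet E P ∧ N.rot p.1 = N.root ∧ N.opp p.2 = p.1}
  have hF : ∀ p ∈ (Finset.univ : Finset E).offDiag, (F p).ncard = (F (a, b)).ncard := by
    rintro ⟨c, d⟩ hcd
    rw [Finset.mem_offDiag] at hcd
    have hcd : c ≠ d := hcd.2.2
    -- A relabelling that sends `(c, d)` to `(a, b)`; it carries one fibre onto the other.
    let τ : E ≃ E := Equiv.swap (Equiv.swap c a d) b * Equiv.swap c a
    have hd' : a ≠ Equiv.swap c a d := by
      intro h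
      have : Equiv.swap c a c = Equiv.swap c a d := by rw [Equiv.swap_apply_left]; exact h
      exact hcd ((Equiv.swap c a).injective this)
    have h1 : τ c = a := by
      simp only [τ, mul_apply, Equiv.swap_apply_left]
      exact Equiv.swap_apply_of_ne_of_ne hd' hab
    have h2 : τ d = b := by simp [τ]
    rw [← Set.ncard_image_of_injective _ (relabel_injective τ)]
    congr 1
    ext N
    constructor
    · rintro ⟨M, ⟨hM, h3, h4⟩, rfl⟩
      refine ⟨relabel_mem_validSet τ hM, ?_, ?_⟩
      · simp only at h3 ⊢
        rw [← h1, relabel_rot, h3, relabel_root]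
      · simp only at h4 ⊢
        rw [← h2, relabel_opp, h4, h1]
    · rintro ⟨hN, h3, h4⟩
      simp only at h3 h4
      refine ⟨N.relabel τ.symm, ⟨relabel_mem_validSet τ.symm hN, ?_, ?_⟩,
        relabel_symm_relabel τ.symm N⟩
      · rw [show (c, d).1 = τ.symm a by simp [← h1], relabel_rot, h3, relabel_root]
      · rw [show (c, d).1 = τ.symm a by simp [← h1], show (c, d).2 = τ.symm b by simp [← h2],
          relabel_opp, h4]
  have hmaps : Set.MapsTo (fun N : OrientedMap E => (N.rot⁻¹ N.root, N.opp (N.rot⁻¹ N.root)))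
      hX.toFinset (Finset.univ : Finset E).offDiag := by
    intro N hN
    have hN' : N ∈ validSet E P := by simpa using hN
    simp only [Finset.mem_coe, Finset.mem_offDiag, Finset.mem_univ, true_and]
    exact (hN'.1.opp_ne _).symm
  rw [Set.ncard_eq_toFinset_card _ hX, Finset.card_eq_sum_card_fiberwise hmaps]
  rw [Finset.sum_congr rfl (g := fun _ => (F (a, b)).ncard), Finset.sum_const,
    Finset.offDiag_card, smul_eq_mul, Finset.card_univ, ← Nat.card_eq_fintype_card, Nat.mul_sub,
    mul_one]
  intro p hp
  rw [← hF p hp, ← Set.ncard_coe_finset]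
  congr 1
  ext N
  simp only [Finset.coe_filter, Set.Finite.mem_toFinset, Set.mem_ofPred_eq, F, Prod.ext_iff]
  refine and_congr_right fun hN => ?_
  constructor
  · rintro ⟨h1, h2⟩
    rw [← h2, ← h1]
    exact ⟨apply_inv_apply _ _, hN.1.opp_opp _⟩
  · rintro ⟨h1, h2⟩
    have h3 : N.rot⁻¹ N.root = p.1 := by rw [← h1]; exact N.rot.symm_apply_apply _
    exact ⟨h3, by rw [h3, ← h2, hN.1.opp_opp]⟩

/-- The factor counts the ordered pairs of distinct labels available for the two darts of the edge
before the root. -/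
theorem ncard_validSet_succ {n : ℕ} (hn : 1 ≤ n) (m i j : ℕ) (hi : 2 ≤ i) (hj : 2 ≤ j) :
    (validSet (Fin (2 * (n + 1))) (fun v a b => v = m + 1 ∧ a = i ∧ b = j)).ncard =
    (2 * n + 2) * (2 * n + 1) *
    ((validSet (Fin (2 * n)) fun v a b => v = m + 1 ∧ a + 1 = i ∧ j ≤ b).ncard +
      (validSet (Fin (2 * n)) fun v a b => v = m ∧ i ≤ a ∧ b + 1 = j).ncard) := by
  have e : Fin (2 * (n + 1)) ≃ Option (Option (Fin (2 * n))) :=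
    Fintype.equivOfCardEq (by simp; ring)
  rw [ncard_validSet_congr e, ncard_validSet_eq_mul _ (a := some none) (b := none) (by simp),
    ncard_validSet_option_option ⟨⟨0, by omega⟩⟩ m i j hi hj]
  simp

/-- Validity makes a map connected. -/
theorem Valid.connected [Finite D] {M : OrientedMap D} (hM : M.Valid) (a b : D) :
    ∃ g ∈ Subgroup.closure {M.rot, M.opp}, g a = b := by
  set G := Subgroup.closure {M.rot, M.opp} with hG
  have hr : M.rot ∈ G := Subgroup.subset_closure (by simp)
  have ho : M.opp ∈ G := Subgroup.subset_closure (by simp)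
  -- From any vertex an ascending path ends at the only sink: among the darts that cannot reach it,
  -- one of maximal potential leads to a contradiction.
  have key : ∀ d, ∃ g ∈ G, g d = M.opp M.root := by
    obtain ⟨h, hrot, hlt⟩ := hM.potential
    by_contra! hno
    obtain ⟨d, hd, hmax⟩ := Set.exists_max_image {d | ∀ g ∈ G, g d ≠ M.opp M.root} h
      (Set.toFinite _) hno
    by_cases hs : SameCycle M.rot (M.opp M.root) d
    · obtain ⟨k, hk⟩ := hs.symm
      exact hd _ (G.zpow_mem hr k) hk
    · obtain ⟨e, he, heo⟩ := hM.exists_mem hs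
      have h1 := hlt e heo
      have h2 := SameCycle.apply_eq_of_invariant hrot he
      obtain ⟨k, rfl⟩ := he
      by_cases h3 : ∀ g ∈ G, g (M.opp ((M.rot ^ k) d)) ≠ M.opp M.root
      · have := hmax _ h3
        omega
      · push Not at h3
        obtain ⟨g, hg, hgd⟩ := h3
        exact hd (g * M.opp * M.rot ^ k)
          (G.mul_mem (G.mul_mem hg ho) (G.zpow_mem hr k)) hgd
  obtain ⟨g, hg, hga⟩ := key a
  obtain ⟨g', hg', hgb⟩ := key b
  exact ⟨g'⁻¹ * g, G.mul_mem (G.inv_mem hg') hg, by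
    rw [mul_apply, hga, ← hgb]
    exact g'.symm_apply_apply b⟩

/-- A valid map has no non-trivial automorphism. -/
theorem Valid.eq_one_of_relabel [Finite D] {M : OrientedMap D} (hM : M.Valid) {τ : Equiv.Perm D}
    (h : M = M.relabel τ) : τ = 1 := by
  obtain ⟨h1, h2, h3, -⟩ := (relabel_eq_iff τ M M).1 h
  have hc : Subgroup.closure {M.rot, M.opp} ≤ Subgroup.centralizer {τ} := by
    rw [Subgroup.closure_le]
    rintro _ (rfl | rfl) <;> rw [SetLike.mem_coe, Subgroup.mem_centralizer_iff] <;>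
      rintro _ rfl <;> ext1 d
    · exact h1 d
    · exact h2 d
  ext1 d
  obtain ⟨g, hg, rfl⟩ := hM.connected M.root d
  have h4 := (Subgroup.mem_centralizer_iff.1 (hc hg)) τ rfl
  have h5 := congrArg (fun σ : Equiv.Perm D => σ M.root) h4
  simp only [mul_apply, h3] at h5
  simpa using h5

end OrientedMap

/-! ### Comparison with the given definitions and passage to isomorphism classes -/

namespace OrientedMap

open Equiv.Perm

variable {D : Type}

theorem two_mul_numCycles_opp [Finite D] {M : OrientedMap D} (hopp : ∀ d, M.opp (M.opp d) = d)
    (hor : ∀ d, d ∈ M.out ↔ M.opp d ∉ M.out) : 2 * numCycles M.opp = Nat.card D := by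
  have hclass : ∀ c d, SameCycle M.opp c d → d = c ∨ d = M.opp c := fun c d h =>
    SameCycle.mem_of_mapsTo (A := {c, M.opp c})
      (by rintro _ (rfl | rfl); exacts [Or.inr rfl, Or.inl (hopp _)]) h (Or.inl rfl)
  have hbij : Set.BijOn (Quotient.mk (SameCycle.setoid M.opp)) M.out Set.univ := by
    refine ⟨fun _ _ => Set.mem_univ _, fun c hc d hd hcd => ?_, ?_⟩
    · rcases hclass c d (Quotient.exact hcd) with rfl | rfl
      · rfl
      · exact absurd hd ((hor c).1 hc)
    · rintro ⟨d⟩ -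
      by_cases hd : d ∈ M.out
      · exact ⟨d, hd, rfl⟩
      · exact ⟨M.opp d, by rw [hor, hopp]; exact hd,
          Quotient.sound (sameCycle_self_apply M.opp d).symm⟩
  have h1 : numCycles M.opp = M.out.ncard := by
    rw [numCycles, ← Set.ncard_univ, ← hbij.image_eq, hbij.injOn.ncard_image]
  have h2 : M.out ∪ M.opp '' M.out = Set.univ := by
    rw [Set.eq_univ_iff_forall]
    intro d
    by_cases hd : d ∈ M.out
    · exact Or.inl hd
    · exact Or.inr ⟨M.opp d, by rw [hor, hopp]; exact hd, hopp d⟩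
  have h3 : Disjoint M.out (M.opp '' M.out) := by
    rw [Set.disjoint_left]
    rintro _ h ⟨d, hd, rfl⟩
    exact (hor d).1 hd h
  rw [← Set.ncard_univ, ← h2, Set.ncard_union_eq h3,
    Set.ncard_image_of_injective _ M.opp.injective, h1, two_mul]

end OrientedMap

namespace RootedMap

open Equiv.Perm

variable {D : Type} (M : RootedMap D) (O : Set D)

/-- The map `M` with its edges directed by `O`. -/
def toOriented : OrientedMap D := ⟨M.rot, M.opp, M.root, O⟩

variable {O}

theorem origin_eq_iff (c d : D) : M.origin c = M.origin d ↔ SameCycle M.rot c d :=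
  ⟨fun h => Quotient.exact h, fun h => Quotient.sound h⟩

theorem isSource_origin_iff (hO : M.IsOrientation O) (c : D) :
    M.IsSource O (M.origin c) ↔ ∀ e, SameCycle M.rot c e → e ∈ O := by
  constructor
  · intro h e he
    by_contra heo
    refine h (M.origin (M.opp e)) ⟨M.opp e, ?_, rfl, ?_⟩
    · by_contra h1
      exact heo ((hO e).2 h1)
    · rw [target, M.opp_opp, origin_eq_iff]
      exact he.symm
  · rintro h u ⟨d, hd, -, h2⟩
    rw [target, origin_eq_iff] at h2
    exact (hO d).1 hd (h _ h2.symm)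

theorem isSink_origin_iff (c : D) :
    M.IsSink O (M.origin c) ↔ ∀ e, SameCycle M.rot c e → e ∉ O := by
  constructor
  · intro h e he heo
    exact h (M.target e) ⟨e, heo, (M.origin_eq_iff _ _).2 he.symm, rfl⟩
  · rintro h u ⟨d, hd, h1, -⟩
    exact h d ((M.origin_eq_iff _ _).1 h1).symm hd

theorem isAcyclic_iff_exists_potential [Finite D] : M.IsAcyclic O ↔
    ∃ h : D → ℕ, (∀ d, h (M.rot d) = h d) ∧ ∀ d ∈ O, h d < h (M.opp d) := by
  constructor
  · intro hac
    have : Finite M.Vertex := Quotient.finite _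
    -- The potential of a vertex is its number of strict ancestors; along an arc this set gains at
    -- least the tail of the arc.
    refine ⟨fun d => {u | Relation.TransGen (M.Arc O) u (M.origin d)}.ncard, fun d => ?_,
      fun d hd => ?_⟩
    · have : M.origin (M.rot d) = M.origin d :=
        (M.origin_eq_iff _ _).2 (sameCycle_self_apply M.rot d).symm
      simp only [this]
    · have harc : M.Arc O (M.origin d) (M.origin (M.opp d)) := ⟨d, hd, rfl, rfl⟩
      refine Set.ncard_lt_ncard ⟨fun u hu => hu.tail harc, fun hsub => ?_⟩ (Set.toFinite _)
      exact hac _ (hsub (Relation.TransGen.single harc))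
  · rintro ⟨h, hrot, hlt⟩ v hv
    let H : M.Vertex → ℕ := Quotient.lift h fun c d hcd =>
      SameCycle.apply_eq_of_invariant hrot hcd
    have hH : ∀ u w, Relation.TransGen (M.Arc O) u w → H u < H w := by
      intro u w huw
      induction huw with
      | single h1 =>
        obtain ⟨d, hd, rfl, rfl⟩ := h1
        exact hlt d hd
      | tail _ h1 ih =>
        obtain ⟨d, hd, rfl, rfl⟩ := h1
        exact ih.trans (hlt d hd)
    exact lt_irrefl _ (hH v v hv)

theorem valid_toOriented_iff [Finite D] :
    (M.toOriented O).Valid ↔ M.IsPlanar ∧ M.IsBipolar O := by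
  have hV : Nat.card M.Vertex = numCycles M.rot := rfl
  have hF : Nat.card M.Face = numCycles (M.toOriented O).face := rfl
  have hE : Nat.card M.Edge = numCycles M.opp := rfl
  have hsrc : M.IsOrientation O → ((∀ v, M.IsSource O v ↔ v = M.origin M.root) ↔
      ∀ d, (∀ e, SameCycle M.rot d e → e ∈ O) ↔ SameCycle M.rot M.root d) := by
    intro hO
    constructor
    · intro h d
      rw [← M.isSource_origin_iff hO, h, M.origin_eq_iff]
      exact ⟨SameCycle.symm, SameCycle.symm⟩
    · rintro h ⟨d⟩
      have := h d
      rw [← M.isSource_origin_iff hO] at this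
      exact this.trans ⟨fun hh => (M.origin_eq_iff _ _).2 hh.symm,
        fun hh => ((M.origin_eq_iff _ _).1 hh).symm⟩
  have hsnk : ((∀ v, M.IsSink O v ↔ v = M.target M.root) ↔
      ∀ d, (∀ e, SameCycle M.rot d e → e ∉ O) ↔ SameCycle M.rot (M.opp M.root) d) := by
    constructor
    · intro h d
      rw [← M.isSink_origin_iff, h, target, M.origin_eq_iff]
      exact ⟨SameCycle.symm, SameCycle.symm⟩
    · rintro h ⟨d⟩
      have := h d
      rw [← M.isSink_origin_iff] at this
      exact this.trans ⟨fun hh => (M.origin_eq_iff _ _).2 hh.symm,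
        fun hh => ((M.origin_eq_iff _ _).1 hh).symm⟩
  constructor
  · intro h
    have hO : M.IsOrientation O := h.orient
    have h2 := OrientedMap.two_mul_numCycles_opp h.opp_opp h.orient
    refine ⟨?_, hO, M.isAcyclic_iff_exists_potential.2 h.potential, (hsrc hO).2 h.source,
      hsnk.2 h.sink⟩
    have h3 := h.euler
    have h4 : numCycles (M.toOriented O).rot = numCycles M.rot := rfl
    have h5 : numCycles (M.toOriented O).opp = numCycles M.opp := rfl
    unfold IsPlanar
    omega
  · rintro ⟨hp, hO, hac, hs, ht⟩
    have h2 := OrientedMap.two_mul_numCycles_opp (M := M.toOriented O) M.opp_opp hO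
    refine ⟨M.opp_opp, M.opp_ne, hO, M.isAcyclic_iff_exists_potential.1 hac, (hsrc hO).1 hs,
      hsnk.1 ht, ?_⟩
    have h4 : numCycles (M.toOriented O).rot = numCycles M.rot := rfl
    have h5 : numCycles (M.toOriented O).opp = numCycles M.opp := rfl
    unfold IsPlanar at hp
    omega

end RootedMap

namespace BipolarMap

open OrientedMap

variable {n : ℕ}

def toOriented (M : BipolarMap n) : OrientedMap (Fin (2 * n)) := M.toRootedMap.toOriented M.orient

theorem toOriented_valid (M : BipolarMap n) : M.toOriented.Valid :=
  (M.toRootedMap.valid_toOriented_iff).2 ⟨M.planar, M.bipolar⟩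

theorem exists_toOriented_eq {N : OrientedMap (Fin (2 * n))} (hN : N.Valid) :
    ∃ M : BipolarMap n, M.toOriented = N := by
  let R : RootedMap (Fin (2 * n)) := ⟨N.rot, N.opp, N.root, hN.opp_opp, hN.opp_ne, hN.connected⟩
  have h : (R.toOriented N.out).Valid := hN
  rw [R.valid_toOriented_iff] at h
  exact ⟨⟨R, h.1, N.out, h.2⟩, rfl⟩

theorem equiv_iff (M N : BipolarMap n) :
    M ≈ N ↔ ∃ τ : Equiv.Perm (Fin (2 * n)), N.toOriented = M.toOriented.relabel τ := by
  simp only [relabel_eq_iff]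
  rfl

/-- The number of isomorphism classes of bipolar maps with `n` edges whose number of vertices,
root-vertex degree and root-face degree satisfy `P`. -/
noncomputable def classCount (n : ℕ) (P : ℕ → ℕ → ℕ → Prop) : ℕ :=
  (Quotient.mk (BipolarMap.setoid n) ''
    {M | P (Nat.card M.Vertex) M.rootVertexDegree M.rootFaceDegree}).ncard

/-- The relabellings act freely, maps being rigid, and their orbits are the isomorphism classes. So
a labelled map is the same as a class together with a relabelling of its chosen representative. -/
theorem classCount_mul_factorial (n : ℕ) (P : ℕ → ℕ → ℕ → Prop) :
    classCount n P * (2 * n).factorial = (validSet (Fin (2 * n)) P).ncard := by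
  classical
  have hmem : ∀ M : BipolarMap n, P (Nat.card M.Vertex) M.rootVertexDegree M.rootFaceDegree ↔
      M.toOriented ∈ validSet (Fin (2 * n)) P := fun M =>
    ⟨fun h => ⟨M.toOriented_valid, h⟩, fun h => h.2⟩
  set I := Quotient.mk (BipolarMap.setoid n) ''
    {M | P (Nat.card M.Vertex) M.rootVertexDegree M.rootFaceDegree} with hI
  have hcard : (2 * n).factorial = (Set.univ : Set (Equiv.Perm (Fin (2 * n)))).ncard := by
    rw [Set.ncard_univ, Nat.card_eq_fintype_card, Fintype.card_perm, Fintype.card_fin]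
  rw [classCount, hcard, ← Set.ncard_prod]
  let Φ : Quotient (BipolarMap.setoid n) × Equiv.Perm (Fin (2 * n)) →
    OrientedMap (Fin (2 * n)) := fun p => p.1.out.toOriented.relabel p.2
  have hrel : ∀ (N : OrientedMap (Fin (2 * n))) (σ τ : Equiv.Perm (Fin (2 * n))),
      (N.relabel σ).relabel τ = N.relabel (τ * σ) := fun _ _ _ => rfl
  have hbij : Set.BijOn Φ (I ×ˢ Set.univ) (validSet (Fin (2 * n)) P) := by
    refine ⟨?_, ?_, ?_⟩
    · rintro ⟨q, τ⟩ ⟨⟨M, hM, rfl⟩, -⟩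
      obtain ⟨σ, hσ⟩ := (equiv_iff _ _).1 (Setoid.symm (Quotient.mk_out M))
      refine relabel_mem_validSet τ ?_
      rw [hσ]
      exact relabel_mem_validSet σ ((hmem M).1 hM)
    · rintro ⟨q, τ⟩ - ⟨q', τ'⟩ - h
      have h1 : q'.out.toOriented = q.out.toOriented.relabel (τ'⁻¹ * τ) := by
        rw [← hrel, show q.out.toOriented.relabel τ = q'.out.toOriented.relabel τ' from h, hrel,
          inv_mul_cancel, relabel_eq_iff]
        simp
      have h2 : q = q' := by
        rw [← q.out_eq, ← q'.out_eq]
        exact Quotient.sound ((equiv_iff _ _).2 ⟨_, h1⟩)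
      subst h2
      have h3 := q.out.toOriented_valid.eq_one_of_relabel h1
      rw [Prod.mk.injEq]
      exact ⟨rfl, (inv_mul_eq_one.1 h3).symm⟩
    · intro N hN
      obtain ⟨M, rfl⟩ := exists_toOriented_eq hN.1
      obtain ⟨τ, hτ⟩ := (equiv_iff _ _).1 (Quotient.mk_out M)
      exact ⟨(Quotient.mk _ M, τ), ⟨⟨M, (hmem M).2 hN, rfl⟩, Set.mem_univ _⟩, hτ.symm⟩
  rw [← hbij.image_eq, hbij.injOn.ncard_image]

theorem classCount_succ {n : ℕ} (hn : 1 ≤ n) (m i j : ℕ) (hi : 2 ≤ i) (hj : 2 ≤ j) :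
    classCount (n + 1) (fun v a b => v = m + 1 ∧ a = i ∧ b = j) =
    classCount n (fun v a b => v = m + 1 ∧ a + 1 = i ∧ j ≤ b) +
      classCount n (fun v a b => v = m ∧ i ≤ a ∧ b + 1 = j) := by
  have h := ncard_validSet_succ hn m i j hi hj
  rw [← classCount_mul_factorial, ← classCount_mul_factorial, ← classCount_mul_factorial,
    ← add_mul, show 2 * (n + 1) = (2 * n + 1) + 1 by ring, Nat.factorial_succ,
    Nat.factorial_succ] at h
  have hpos : 0 < (2 * n + 2) * (2 * n + 1) * (2 * n).factorial := by positivity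
  refine Nat.eq_of_mul_eq_mul_right hpos ?_
  linarith

theorem classCount_eq_zero {n : ℕ} {P : ℕ → ℕ → ℕ → Prop}
    (h : ∀ M : OrientedMap (Fin (2 * n)), M.Valid →
      ¬ P M.numVertices M.rootVertexDegree M.rootFaceDegree) : classCount n P = 0 := by
  have h1 := classCount_mul_factorial n P
  have h2 : validSet (Fin (2 * n)) P = ∅ := by
    rw [Set.eq_empty_iff_forall_notMem]
    exact fun M hM => h M hM.1 hM.2
  rw [h2, Set.ncard_empty] at h1
  exact (Nat.mul_eq_zero.1 h1).resolve_right (Nat.factorial_ne_zero _)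

theorem classCount_congr {n : ℕ} {P Q : ℕ → ℕ → ℕ → Prop}
    (h : ∀ M : OrientedMap (Fin (2 * n)), M.Valid →
      (P M.numVertices M.rootVertexDegree M.rootFaceDegree ↔
        Q M.numVertices M.rootVertexDegree M.rootFaceDegree)) :
    classCount n P = classCount n Q := by
  unfold classCount
  congr 2
  ext M
  exact h _ M.toOriented_valid

/-- Splitting a class count according to the value of a bounded statistic. -/
theorem classCount_eq_sum {n : ℕ} {P : ℕ → ℕ → ℕ → Prop} (s : ℕ → ℕ → ℕ → ℕ) (T : Finset ℕ)
    (h : ∀ M : OrientedMap (Fin (2 * n)), M.Valid →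
      P M.numVertices M.rootVertexDegree M.rootFaceDegree →
      s M.numVertices M.rootVertexDegree M.rootFaceDegree ∈ T) :
    classCount n P = ∑ t ∈ T, classCount n (fun v a b => P v a b ∧ s v a b = t) := by
  classical
  refine Nat.eq_of_mul_eq_mul_right (Nat.factorial_pos (2 * n)) ?_
  rw [Finset.sum_mul]
  simp only [classCount_mul_factorial]
  have hfin : (validSet (Fin (2 * n)) P).Finite := Set.toFinite _
  rw [Set.ncard_eq_toFinset_card _ hfin, Finset.card_eq_sum_card_fiberwise
    (f := fun M : OrientedMap (Fin (2 * n)) =>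
      s M.numVertices M.rootVertexDegree M.rootFaceDegree) (t := T)]
  · refine Finset.sum_congr rfl fun t _ => ?_
    rw [← Set.ncard_coe_finset]
    congr 1
    ext M
    simp [validSet, and_assoc]
  · intro M hM
    have hM' : M ∈ validSet (Fin (2 * n)) P := by simpa using hM
    exact h M hM'.1 hM'.2

theorem bipolarCount_eq_classCount (n m : ℕ) :
    bipolarCount n m = classCount n fun v _ _ => v = m + 1 := rfl

theorem bipolarCountFace_eq_classCount (n m j : ℕ) :
    bipolarCountFace n m j = classCount n fun v _ b => v = m + 1 ∧ b = j := rfl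

theorem bipolarCountVertexFace_eq_classCount (n m i j : ℕ) :
    bipolarCountVertexFace n m i j = classCount n fun v a b => v = m + 1 ∧ a = i ∧ b = j := rfl

end BipolarMap

/-! ### The single-edge map and bounds on the parameters -/

namespace OrientedMap

open Equiv.Perm

theorem numCycles_one (D : Type) : numCycles (1 : Equiv.Perm D) = Nat.card D := by
  refine (Nat.card_eq_of_bijective (Quotient.mk (SameCycle.setoid (1 : Equiv.Perm D)))
    ⟨fun c d h => ?_, Quotient.mk_surjective⟩).symm
  exact sameCycle_one.1 (Quotient.exact h)

section SingleEdge

variable {M : OrientedMap (Fin 2)} (hM : M.Valid)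
include hM

theorem Valid.eq_root_or (d : Fin 2) : d = M.root ∨ d = M.opp M.root := by
  have := hM.opp_ne M.root
  omega

theorem Valid.rot_eq_one : M.rot = 1 := by
  have h1 : M.rot M.root = M.root := by
    rcases hM.eq_root_or (M.rot M.root) with h | h
    · exact h
    · have h2 := hM.mem_out_of_source (sameCycle_self_apply M.rot M.root)
      rw [h] at h2
      exact absurd h2 ((hM.orient _).1 hM.root_mem)
  ext1 d
  rcases hM.eq_root_or d with rfl | rfl
  · exact h1
  · rcases hM.eq_root_or (M.rot (M.opp M.root)) with h | h
    · have := M.rot.injective (h.trans h1.symm)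
      exact absurd this (hM.opp_ne _)
    · exact h

theorem Valid.numVertices_eq_two : M.numVertices = 2 := by
  rw [numVertices, hM.rot_eq_one, numCycles_one]; simp

theorem Valid.rootVertexDegree_eq_one : M.rootVertexDegree = 1 := by
  rw [rootVertexDegree, hM.rot_eq_one]
  simp

theorem Valid.rootFaceDegree_eq_two : M.rootFaceDegree = 2 := by
  refine le_antisymm ?_ hM.two_le_rootFaceDegree
  refine (Set.ncard_le_ncard (Set.subset_univ _)).trans ?_
  simp [Set.ncard_univ]

theorem Valid.out_eq : M.out = {M.root} := by
  ext d
  rcases hM.eq_root_or d with rfl | rfl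
  · simpa using hM.root_mem
  · simpa [hM.opp_ne] using (hM.orient _).1 hM.root_mem

end SingleEdge

def singleEdge (r : Fin 2) : OrientedMap (Fin 2) := ⟨1, Equiv.swap 0 1, r, {r}⟩

theorem singleEdge_valid (r : Fin 2) : (singleEdge r).Valid := by
  have hopp : ∀ d : Fin 2, Equiv.swap 0 1 d = 1 - d := by decide
  have h1 : ∀ d, (singleEdge r).opp ((singleEdge r).opp d) = d := by simp [singleEdge]
  have h2 : ∀ d, d ∈ (singleEdge r).out ↔ (singleEdge r).opp d ∉ (singleEdge r).out := by
    intro d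
    simp only [singleEdge, Set.mem_singleton_iff, hopp]
    omega
  refine ⟨h1, fun d => ?_, h2, ⟨fun d => if d = r then 0 else 1, fun _ => rfl, ?_⟩,
    fun d => ?_, fun d => ?_, ?_⟩
  · simp only [singleEdge, hopp]
    omega
  · rintro d rfl
    have : (1 : Fin 2) - d ≠ d := by omega
    simp [singleEdge, hopp, this]
  · simp [singleEdge, eq_comm]
  · simp only [singleEdge, sameCycle_one, forall_eq', Set.mem_singleton_iff, hopp]
    omega
  · have h3 := two_mul_numCycles_opp h1 h2
    have h4 : (singleEdge r).face = (singleEdge r).opp := by simp [face, singleEdge]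
    have h5 : numCycles (singleEdge r).rot = 2 := by
      rw [show (singleEdge r).rot = 1 from rfl, numCycles_one]; simp
    rw [h4, h5, Nat.card_eq_fintype_card, Fintype.card_fin] at *
    omega

theorem Valid.numVertices_pos {D : Type} [Finite D] {M : OrientedMap D} (_ : M.Valid) :
    0 < M.numVertices := by
  have : Nonempty (Quotient (SameCycle.setoid M.rot)) := ⟨Quotient.mk _ M.root⟩
  exact Nat.card_pos

end OrientedMap

namespace BipolarMap

open OrientedMap

theorem classCount_one (P : ℕ → ℕ → ℕ → Prop) [Decidable (P 2 1 2)] :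
    classCount 1 P = if P 2 1 2 then 1 else 0 := by
  have key : ∀ M : OrientedMap (Fin (2 * 1)), M.Valid →
      (P M.numVertices M.rootVertexDegree M.rootFaceDegree ↔ P 2 1 2) := fun M hM => by
    rw [Valid.numVertices_eq_two hM, Valid.rootVertexDegree_eq_one hM,
      Valid.rootFaceDegree_eq_two hM]
  split_ifs with h
  · have h1 := classCount_mul_factorial 1 P
    have h2 : validSet (Fin (2 * 1)) P = Set.range singleEdge := by
      ext M
      constructor
      · rintro ⟨hM, -⟩
        refine ⟨M.root, ?_⟩
        ext1
        · exact (Valid.rot_eq_one hM).symm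
        · ext1 d
          have h3 : ∀ a b : Fin 2, b ≠ a → Equiv.swap 0 1 a = b := by decide
          exact h3 _ _ (hM.opp_ne d)
        · rfl
        · exact (Valid.out_eq hM).symm
      · rintro ⟨r, rfl⟩
        exact ⟨singleEdge_valid r, (key _ (singleEdge_valid r)).2 h⟩
    -- A labelling is fixed by the choice of the root among two darts, and `2! = 2`, so there is one
    -- class.
    have h3 : (Set.range singleEdge).ncard = 2 := by
      rw [← Set.image_univ, Set.ncard_image_of_injective _
        (fun r s hrs => congrArg OrientedMap.root hrs)]
      simp [Set.ncard_univ]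
    rw [h2] at h1
    have h4 : classCount 1 P * 2 = 2 := h1.trans h3
    omega
  · exact classCount_eq_zero fun M hM hP => h ((key M hM).1 hP)

theorem classCount_zero (P : ℕ → ℕ → ℕ → Prop) : classCount 0 P = 0 :=
  classCount_eq_zero fun M _ => (Nat.not_lt_zero _ M.root.isLt).elim

theorem classCount_ne_zero {n : ℕ} {P : ℕ → ℕ → ℕ → Prop} {M : OrientedMap (Fin (2 * n))}
    (hM : M.Valid) (hP : P M.numVertices M.rootVertexDegree M.rootFaceDegree) :
    classCount n P ≠ 0 := by
  intro h
  have h1 := classCount_mul_factorial n P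
  rw [h, zero_mul] at h1
  have h2 := (Set.ncard_eq_zero (Set.toFinite _)).1 h1.symm
  have h3 : M ∈ validSet (Fin (2 * n)) P := ⟨hM, hP⟩
  rw [h2] at h3
  exact h3

theorem two_le_rootVertexDegree {n : ℕ} (hn : 2 ≤ n) {M : OrientedMap (Fin (2 * n))}
    (hM : M.Valid) : 2 ≤ M.rootVertexDegree :=
  hM.two_le_rootVertexDegree (by simp; omega)

/-- No geometry is needed: a map violating a bound would make the left side of the recurrence
non-zero, while by induction both terms on the right vanish. -/
theorem bounds {n : ℕ} (hn : 1 ≤ n) : ∀ M : OrientedMap (Fin (2 * n)), M.Valid →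
    2 ≤ M.numVertices ∧ M.rootVertexDegree + M.numVertices ≤ n + 2 ∧
      M.rootFaceDegree ≤ M.numVertices := by
  induction n, hn using Nat.le_induction with
  | base =>
    intro M hM
    rw [Valid.numVertices_eq_two hM, Valid.rootVertexDegree_eq_one hM,
      Valid.rootFaceDegree_eq_two hM]
    omega
  | succ n hn ih =>
    intro M hM
    have hv := hM.numVertices_pos
    have ha := two_le_rootVertexDegree (by omega) hM
    have hb := hM.two_le_rootFaceDegree
    have h1 := classCount_succ hn (M.numVertices - 1) M.rootVertexDegree M.rootFaceDegree ha hb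
    have h2 := classCount_ne_zero
      (P := fun v a b => v = M.numVertices - 1 + 1 ∧ a = M.rootVertexDegree ∧
        b = M.rootFaceDegree) hM ⟨by omega, rfl, rfl⟩
    rw [h1] at h2
    by_contra hno
    refine h2 ?_
    rw [classCount_eq_zero, classCount_eq_zero]
    · rintro N hN ⟨h3, h4, h5⟩
      have := ih N hN
      omega
    · rintro N hN ⟨h3, h4, h5⟩
      have := ih N hN
      omega

end BipolarMap

/-! ### The closed form satisfies the recurrence -/

namespace BipolarMap

open OrientedMap Finset

theorem multichoose_absorb (κ y : ℕ) :
    (y + 1) * Nat.multichoose κ (y + 1) = κ * Nat.multichoose (κ + 1) y := by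
  have h := Nat.choose_succ_right_eq (κ + y) y
  rw [Nat.multichoose_eq, Nat.multichoose_eq, show κ + (y + 1) - 1 = κ + y by omega,
    show κ + 1 + y - 1 = κ + y by omega, mul_comm, h, show κ + y - y = κ by omega, mul_comm]

/-- `multichoose κ (y - s)`, understood as `0` for `y < s`. -/
def shiftChoose (κ y s : ℕ) : ℕ := if s ≤ y then Nat.multichoose κ (y - s) else 0

/-- Hockey-stick summation for the factor `m`; for the factor `t` first the absorption `t *
multichoose κ t = κ * multichoose (κ + 1) (t - 1)`. -/
theorem sum_mul_multichoose (m κ y : ℕ) :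
    ∑ t ∈ range (y + 1), ((m : ℚ) - t) * Nat.multichoose κ t =
      m * Nat.multichoose (κ + 1) y - κ * shiftChoose (κ + 2) y 1 := by
  induction y with
  | zero => simp [shiftChoose]
  | succ y ih =>
    rw [sum_range_succ, ih]
    have h1 : (Nat.multichoose (κ + 1) (y + 1) : ℚ) =
        Nat.multichoose κ (y + 1) + Nat.multichoose (κ + 1) y := by
      rw [Nat.multichoose_succ_succ]; push_cast; ring
    have h2 : ((y : ℚ) + 1) * Nat.multichoose κ (y + 1) = κ * Nat.multichoose (κ + 1) y := by
      exact_mod_cast multichoose_absorb κ y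
    have h3 : (shiftChoose (κ + 2) (y + 1) 1 : ℚ) =
        Nat.multichoose (κ + 1) y + shiftChoose (κ + 2) y 1 := by
      cases y with
      | zero => simp [shiftChoose]
      | succ z =>
        simp only [shiftChoose, le_add_iff_nonneg_left, zero_le, if_true, Nat.add_sub_cancel]
        rw [Nat.multichoose_succ_succ]; push_cast; ring
    rw [h1, h3]
    push_cast
    linear_combination -h2

theorem sum_mul_shiftChoose (m κ y : ℕ) :
    ∑ t ∈ range (y + 1), ((m : ℚ) - t) * shiftChoose κ t 1 =
      (m - 1) * shiftChoose (κ + 1) y 1 - κ * shiftChoose (κ + 2) y 2 := by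
  induction y with
  | zero => simp [shiftChoose]
  | succ y ih =>
    rw [sum_range_succ, ih]
    cases y with
    | zero => simp [shiftChoose]
    | succ z =>
      have h1 : (Nat.multichoose (κ + 1) (z + 1) : ℚ) =
          Nat.multichoose κ (z + 1) + Nat.multichoose (κ + 1) z := by
        rw [Nat.multichoose_succ_succ]; push_cast; ring
      have h2 : ((z : ℚ) + 1) * Nat.multichoose κ (z + 1) = κ * Nat.multichoose (κ + 1) z := by
        exact_mod_cast multichoose_absorb κ z
      have h3 : (shiftChoose (κ + 2) (z + 1 + 1) 2 : ℚ) =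
          Nat.multichoose (κ + 1) z + shiftChoose (κ + 2) (z + 1) 2 := by
        cases z with
        | zero => simp [shiftChoose]
        | succ w =>
          simp only [shiftChoose, show 2 ≤ w + 1 + 1 + 1 by omega, show 2 ≤ w + 1 + 1 by omega,
            if_true, show w + 1 + 1 + 1 - 2 = w + 1 by omega, show w + 1 + 1 - 2 = w by omega]
          rw [Nat.multichoose_succ_succ]; push_cast; ring
      rw [h3]
      simp only [shiftChoose, show 1 ≤ z + 1 + 1 by omega, show 1 ≤ z + 1 by omega,
        show z + 1 + 1 - 1 = z + 1 by omega, show z + 1 - 1 = z by omega, if_true, h1]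
      push_cast
      linear_combination -h2

/-- The number of bipolar maps with `m + 1` vertices, `k + 1` faces, root-vertex degree `p + 1` and
root-face degree `q + 1`. -/
def refined (m k p q : ℕ) : ℚ :=
  (p : ℚ) * q / (((m : ℚ) + k) * (m + k - 1)) * (m + k).choose m *
    (Nat.multichoose (k - 1) (m - q) * Nat.multichoose (m - 1) (k - p) -
      shiftChoose k (m - q) 1 * shiftChoose m (k - p) 1)

/-- The formula reflects planar duality; this halves the summations to be done. -/
theorem refined_comm (m k p q : ℕ) : refined m k p q = refined k m q p := by
  unfold refined
  rw [Nat.choose_symm_add, add_comm m k]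
  ring_nf

theorem sum_refined_face (m k p q : ℕ) (hk : 1 ≤ k) (hq : q ≤ m) :
    ∑ t ∈ Icc q m, refined m k p t =
      (p : ℚ) / (((m : ℚ) + k) * (m + k - 1)) * (m + k).choose m *
      ((m * Nat.multichoose k (m - q) - (k - 1) * shiftChoose (k + 1) (m - q) 1) *
          Nat.multichoose (m - 1) (k - p) -
        ((m - 1) * shiftChoose (k + 1) (m - q) 1 - k * shiftChoose (k + 2) (m - q) 2) *
          shiftChoose m (k - p) 1) := by
  have h1 := sum_mul_multichoose m (k - 1) (m - q)
  have h2 := sum_mul_shiftChoose m k (m - q)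
  rw [show k - 1 + 1 = k by omega, show k - 1 + 2 = k + 1 by omega] at h1
  push_cast [hk] at h1
  rw [← h1, ← h2, sum_mul, sum_mul, ← sum_sub_distrib, mul_sum]
  -- Reversing the order of summation turns the weight `t` of `refined` into `m - t`, as in the two
  -- summation lemmas.
  refine sum_bij' (fun t _ => m - t) (fun t _ => m - t) ?_ ?_ ?_ ?_ ?_
  · intro t ht; simp only [mem_Icc, mem_range] at *; omega
  · intro t ht; simp only [mem_Icc, mem_range] at *; omega
  · intro t ht; simp only [mem_Icc] at *; omega
  · intro t ht; simp only [mem_range] at *; omega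
  · intro t ht
    simp only [mem_Icc] at ht
    unfold refined
    rw [Nat.cast_sub ht.2]
    ring

theorem sum_refined_vertex (m k p q : ℕ) (hm : 1 ≤ m) (hp : p ≤ k) :
    ∑ t ∈ Icc p k, refined m k t q =
      (q : ℚ) / (((m : ℚ) + k) * (m + k - 1)) * (m + k).choose m *
      ((k * Nat.multichoose m (k - p) - (m - 1) * shiftChoose (m + 1) (k - p) 1) *
          Nat.multichoose (k - 1) (m - q) -
        ((k - 1) * shiftChoose (m + 1) (k - p) 1 - m * shiftChoose (m + 2) (k - p) 2) *
          shiftChoose k (m - q) 1) := by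
  simp only [refined_comm m k]
  rw [sum_refined_face k m q p hm hp, Nat.choose_symm_add, add_comm m k]
  ring_nf

theorem mul_shiftChoose_one {k : ℕ} (hk : 1 ≤ k) (y : ℕ) :
    ((k : ℚ) - 1) * shiftChoose k y 1 = y * Nat.multichoose (k - 1) y := by
  cases y with
  | zero => simp [shiftChoose]
  | succ y =>
    have h := multichoose_absorb (k - 1) y
    rw [show k - 1 + 1 = k by omega] at h
    have h2 : ((y : ℚ) + 1) * Nat.multichoose (k - 1) (y + 1) =
        ((k - 1 : ℕ) : ℚ) * Nat.multichoose k y := by exact_mod_cast h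
    push_cast [hk] at h2
    simp [shiftChoose, h2]

theorem mul_shiftChoose_two (k y : ℕ) :
    (k : ℚ) * shiftChoose (k + 1) y 2 = (y - 1) * shiftChoose k y 1 := by
  rcases y with (_ | _ | y)
  · simp [shiftChoose]
  · simp [shiftChoose]
  · have h2 : ((y : ℚ) + 1) * Nat.multichoose k (y + 1) = k * Nat.multichoose (k + 1) y := by
      exact_mod_cast multichoose_absorb k y
    simp [shiftChoose, ← h2]

/-- The closed form satisfies the recurrence obtained by deleting or contracting an edge. -/
theorem refined_rec (m k p q : ℕ) (hp : 1 ≤ p) (hpk : p ≤ k) (hq : 1 ≤ q) (hqm : q ≤ m)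
    (hmk : 3 ≤ m + k) :
    refined m k p q = (if 2 ≤ p then ∑ t ∈ Icc q m, refined m (k - 1) (p - 1) t else 0) +
      if 2 ≤ q then ∑ t ∈ Icc p k, refined (m - 1) k t (q - 1) else 0 := by
  have hm1 : (m : ℚ) + k ≠ 0 := by
    have : (3 : ℚ) ≤ m + k := by exact_mod_cast hmk
    linarith
  have hm2 : (m : ℚ) + k - 1 ≠ 0 := by
    have : (3 : ℚ) ≤ m + k := by exact_mod_cast hmk
    linarith
  have hm3 : (m : ℚ) + k - 2 ≠ 0 := by
    have : (3 : ℚ) ≤ m + k := by exact_mod_cast hmk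
    linarith
  set N := (m + k).choose m with hN
  have hc1 : 2 ≤ k → ((m + (k - 1)).choose m : ℚ) = k / (m + k) * N := by
    intro hk
    have := Nat.choose_mul_succ_eq (m + (k - 1)) m
    rw [show m + (k - 1) + 1 = m + k by omega, show m + k - m = k by omega] at this
    have h2 : ((m + (k - 1)).choose m : ℚ) * (m + k) = N * k := by exact_mod_cast this
    field_simp
    linear_combination h2
  have hc2 : ((m - 1 + k).choose (m - 1) : ℚ) = m / (m + k) * N := by
    have := Nat.add_one_mul_choose_eq (m - 1 + k) (m - 1)
    rw [show m - 1 + k + 1 = m + k by omega, show m - 1 + 1 = m by omega] at this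
    have h2 : ((m : ℚ) + k) * ((m - 1 + k).choose (m - 1) : ℚ) = N * m := by exact_mod_cast this
    field_simp
    linear_combination h2
  -- For `p = 1` the right side vanishes through its factor `p - 1`, so the case distinction
  -- disappears; likewise for `q` below.
  have e1 : (if 2 ≤ p then ∑ t ∈ Icc q m, refined m (k - 1) (p - 1) t else 0) =
      (p - 1) / (((m : ℚ) + k - 1) * (m + k - 2)) * (k / (m + k) * N) *
      ((m * Nat.multichoose (k - 1) (m - q) - (k - 2) * shiftChoose k (m - q) 1) *
          Nat.multichoose (m - 1) (k - p) -
        ((m - 1) * shiftChoose k (m - q) 1 - (k - 1) * shiftChoose (k + 1) (m - q) 2) *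
          shiftChoose m (k - p) 1) := by
    split_ifs with h
    · rw [sum_refined_face m (k - 1) (p - 1) q (by omega) hqm, hc1 (by omega),
        show k - 1 + 1 = k by omega, show k - 1 + 2 = k + 1 by omega,
        show k - 1 - (p - 1) = k - p by omega, Nat.cast_sub hp, Nat.cast_sub (hp.trans hpk)]
      push_cast
      ring_nf
    · have : p = 1 := by omega
      subst this; simp
  have e2 : (if 2 ≤ q then ∑ t ∈ Icc p k, refined (m - 1) k t (q - 1) else 0) =
      (q - 1) / (((m : ℚ) + k - 1) * (m + k - 2)) * (m / (m + k) * N) *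
      ((k * Nat.multichoose (m - 1) (k - p) - (m - 2) * shiftChoose m (k - p) 1) *
          Nat.multichoose (k - 1) (m - q) -
        ((k - 1) * shiftChoose m (k - p) 1 - (m - 1) * shiftChoose (m + 1) (k - p) 2) *
          shiftChoose k (m - q) 1) := by
    split_ifs with h
    · rw [sum_refined_vertex (m - 1) k p (q - 1) (by omega) hpk, hc2,
        show m - 1 + 1 = m by omega, show m - 1 + 2 = m + 1 by omega,
        show m - 1 - (q - 1) = m - q by omega, Nat.cast_sub hq, Nat.cast_sub (hq.trans hqm)]
      push_cast
      ring_nf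
    · have : q = 1 := by omega
      subst this; simp
  rw [e1, e2, refined, ← hN]
  have hy1 := mul_shiftChoose_one (hp.trans hpk) (m - q)
  have hy2 := mul_shiftChoose_two k (m - q)
  have hx1 := mul_shiftChoose_one (hq.trans hqm) (k - p)
  have hx2 := mul_shiftChoose_two m (k - p)
  rw [Nat.cast_sub hqm] at hy1 hy2
  rw [Nat.cast_sub hpk] at hx1 hx2
  -- The generic argument writes every coefficient as a rational multiple of `multichoose (k - 1) (m
  -- - q)` or `multichoose (m - 1) (k - p)`, dividing by `k - 1` and `m - 1`. So `k = 1` and `m = 1`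
  -- are done by hand; the rest is an identity of rational functions.
  by_cases hk : k = 1
  · subst hk
    have hp1 : p = 1 := by omega
    subst hp1
    rcases Nat.eq_or_lt_of_le hqm with rfl | hlt
    · simp only [Nat.sub_self, shiftChoose]
      simp only [Nat.multichoose_zero_right]
      simp
      push_cast at *
      have : (q : ℚ) - 1 ≠ 0 := by intro h; apply hm3; linear_combination h
      have : (q : ℚ) ≠ 0 := by intro h; apply hm2; linear_combination h
      field_simp
      ring_nf
    · obtain ⟨y, hy⟩ : ∃ y, m - q = y + 1 := ⟨m - q - 1, by omega⟩
      simp [hy, shiftChoose]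
  by_cases hm : m = 1
  · subst hm
    have hq1 : q = 1 := by omega
    subst hq1
    rcases Nat.eq_or_lt_of_le hpk with rfl | hlt
    · simp only [Nat.sub_self, shiftChoose]
      simp only [Nat.multichoose_zero_right]
      simp
      push_cast at *
      have : (p : ℚ) - 1 ≠ 0 := by intro h; apply hm3; linear_combination h
      have : (p : ℚ) ≠ 0 := by intro h; apply hm2; linear_combination h
      field_simp
      ring_nf
    · obtain ⟨y, hy⟩ : ∃ y, k - p = y + 1 := ⟨k - p - 1, by omega⟩
      simp [hy, shiftChoose]
  have hk1 : (k : ℚ) - 1 ≠ 0 := by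
    have : (2 : ℚ) ≤ k := by exact_mod_cast (by omega : 2 ≤ k)
    linarith
  have hm1' : (m : ℚ) - 1 ≠ 0 := by
    have : (2 : ℚ) ≤ m := by exact_mod_cast (by omega : 2 ≤ m)
    linarith
  have hk0 : (k : ℚ) ≠ 0 := by exact_mod_cast (by omega : k ≠ 0)
  have hm0 : (m : ℚ) ≠ 0 := by exact_mod_cast (by omega : m ≠ 0)
  have hy1' : (shiftChoose k (m - q) 1 : ℚ) =
      (m - q) * Nat.multichoose (k - 1) (m - q) / (k - 1) := by
    field_simp; linear_combination hy1
  have hx1' : (shiftChoose m (k - p) 1 : ℚ) =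
      (k - p) * Nat.multichoose (m - 1) (k - p) / (m - 1) := by
    field_simp; linear_combination hx1
  have hy2' : (shiftChoose (k + 1) (m - q) 2 : ℚ) =
      (m - q - 1) * shiftChoose k (m - q) 1 / k := by
    field_simp; linear_combination hy2
  have hx2' : (shiftChoose (m + 1) (k - p) 2 : ℚ) =
      (k - p - 1) * shiftChoose m (k - p) 1 / m := by
    field_simp; linear_combination hx2
  rw [hy2', hx2', hy1', hx1']
  generalize (Nat.multichoose (k - 1) (m - q) : ℚ) = A
  generalize (Nat.multichoose (m - 1) (k - p) : ℚ) = B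
  generalize (N : ℚ) = C
  field_simp
  ring

end BipolarMap

/-! ### The three counting formulas -/

namespace BipolarMap

open OrientedMap Finset

/-- The recurrence determines the counts. The induction starts at two edges, because the single-edge
map has root-vertex degree one; `bounds` turns the open sums into sums over `Icc q m` and `Icc p k`.
-/
theorem classCount_eq_refined {n : ℕ} (hn : 2 ≤ n) : ∀ m k p q : ℕ, m + k = n → 1 ≤ p → p ≤ k →
    1 ≤ q → q ≤ m →
    (classCount n (fun v a b => v = m + 1 ∧ a = p + 1 ∧ b = q + 1) : ℚ) = refined m k p q := by
  induction n, hn using Nat.le_induction with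
  | base =>
    intro m k p q hmk hp hpk hq hqm
    obtain ⟨rfl, rfl, rfl, rfl⟩ : m = 1 ∧ k = 1 ∧ p = 1 ∧ q = 1 := by omega
    rw [classCount_succ le_rfl 1 (1 + 1) (1 + 1) le_rfl le_rfl, classCount_one, classCount_one]
    norm_num [refined, shiftChoose]
  | succ n hn ih =>
    intro m k p q hmk hp hpk hq hqm
    rw [classCount_succ (by omega) m (p + 1) (q + 1) (by omega) (by omega),
      refined_rec m k p q hp hpk hq hqm (by omega)]
    push_cast
    congr 1
    · split_ifs with h
      · rw [classCount_eq_sum (fun _ _ b => b - 1) (Icc q m)]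
        · push_cast
          refine sum_congr rfl fun t ht => ?_
          rw [mem_Icc] at ht
          rw [← ih m (k - 1) (p - 1) t (by omega) (by omega) (by omega) (by omega) ht.2]
          congr 1
          refine classCount_congr fun M hM => ?_
          omega
        · intro M hM hP
          have := bounds (by omega) M hM
          rw [mem_Icc]
          omega
      · rw [classCount_eq_zero, Nat.cast_zero]
        intro M hM hP
        have := two_le_rootVertexDegree hn hM
        omega
    · split_ifs with h
      · rw [classCount_eq_sum (fun _ a _ => a - 1) (Icc p k)]
        · push_cast
          refine sum_congr rfl fun t ht => ?_
          rw [mem_Icc] at ht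
          rw [← ih (m - 1) k t (q - 1) (by omega) (by omega) (by omega) (by omega) (by omega)]
          congr 1
          refine classCount_congr fun M hM => ?_
          omega
        · intro M hM hP
          have := bounds (by omega) M hM
          rw [mem_Icc]
          omega
      · rw [classCount_eq_zero, Nat.cast_zero]
        intro M hM hP
        have := hM.two_le_rootFaceDegree
        omega

theorem bipolarCountVertexFace_eq_refined {m k p q : ℕ} (hp : 1 ≤ p) (hpk : p ≤ k) (hq : 1 ≤ q)
    (hqm : q ≤ m) :
    (bipolarCountVertexFace (m + k) m (p + 1) (q + 1) : ℚ) = refined m k p q := by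
  rw [bipolarCountVertexFace_eq_classCount]
  exact classCount_eq_refined (by omega) m k p q rfl hp hpk hq hqm

/-- For `i = 2` the deletion term needs a root-vertex of degree one, impossible with `n ≥ 2` edges,
and the contraction term runs over all root-vertex degrees. -/
theorem bipolarCountFace_eq_succ {n : ℕ} (hn : 2 ≤ n) (m j : ℕ) (hj : 1 ≤ j) :
    bipolarCountFace n m j = bipolarCountVertexFace (n + 1) (m + 1) 2 (j + 1) := by
  rw [bipolarCountFace_eq_classCount, bipolarCountVertexFace_eq_classCount,
    classCount_succ (by omega) _ _ _ le_rfl (by omega)]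
  rw [classCount_eq_zero (P := fun v a b => v = m + 1 + 1 ∧ a + 1 = 2 ∧ j + 1 ≤ b), zero_add]
  · refine classCount_congr fun M hM => ?_
    have := two_le_rootVertexDegree hn hM
    omega
  · intro M hM hP
    have := two_le_rootVertexDegree hn hM
    omega

/-- Dually, for `j = 2` the contraction term needs a root-face of degree one and vanishes, while the
deletion term runs over all root-face degrees. Summing over `i` removes the remaining parameter,
with a shift by one. -/
theorem bipolarCount_eq_succ {n : ℕ} (hn : 1 ≤ n) (m : ℕ) :
    bipolarCount n m = bipolarCountFace (n + 1) m 2 := by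
  rw [bipolarCount_eq_classCount, bipolarCountFace_eq_classCount,
    classCount_eq_sum (fun _ a _ => a + 1) (Icc 2 (n + 3)),
    classCount_eq_sum (fun _ a _ => a) (Icc 2 (n + 3))]
  · refine sum_congr rfl fun i hi => ?_
    rw [mem_Icc] at hi
    have h := classCount_succ hn m i 2 hi.1 le_rfl
    rw [classCount_eq_zero (P := fun v a b => v = m ∧ i ≤ a ∧ b + 1 = 2), add_zero] at h
    · refine Eq.trans ?_ (h.symm.trans ?_)
      · refine classCount_congr fun M hM => ?_
        have := hM.two_le_rootFaceDegree
        omega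
      · refine classCount_congr fun M hM => ?_
        omega
    · intro M hM hP
      have := hM.two_le_rootFaceDegree
      omega
  · intro M hM hP
    have := bounds (by omega) M hM
    have := two_le_rootVertexDegree (by omega) hM
    rw [mem_Icc]
    omega
  · intro M hM hP
    have := bounds hn M hM
    have h2 : 0 < M.rootVertexDegree :=
      (Set.ncard_pos (Set.toFinite _)).2 ⟨M.root, Equiv.Perm.SameCycle.refl _ _⟩
    rw [mem_Icc]
    omega

theorem refined_one {m k q : ℕ} (hm : 1 ≤ m) (hk : 1 ≤ k) (hq : 1 ≤ q) (hqm : q ≤ m + 1) :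
    refined (m + 1) k 1 q = (q : ℚ) * (q - 1) / (((m : ℚ) + k - 1) * (m + k) ^ 2) *
      (m + k).choose m * (m + k).choose (m + 1) * Nat.multichoose (k - 1) (m + 1 - q) := by
  have hm0 : (m : ℚ) ≠ 0 := by exact_mod_cast (by omega : m ≠ 0)
  have hm1 : (m : ℚ) + 1 ≠ 0 := by exact_mod_cast (by omega : m + 1 ≠ 0)
  have hn0 : (m : ℚ) + k ≠ 0 := by exact_mod_cast (by omega : m + k ≠ 0)
  have hn1 : (m : ℚ) + k + 1 ≠ 0 := by exact_mod_cast (by omega : m + k + 1 ≠ 0)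
  have hn2 : (m : ℚ) + k - 1 ≠ 0 := by
    have : (2 : ℚ) ≤ m + k := by exact_mod_cast (by omega : 2 ≤ m + k)
    linarith
  have hk0 : (k : ℚ) ≠ 0 := by exact_mod_cast (by omega : k ≠ 0)
  have hx := mul_shiftChoose_one (k := m + 1) (by omega) (k - 1)
  have hy := mul_shiftChoose_one hk (m + 1 - q)
  rw [Nat.cast_sub hqm] at hy
  rw [Nat.cast_sub hk, Nat.add_sub_cancel] at hx
  push_cast at hx hy
  have hx' : (shiftChoose (m + 1) (k - 1) 1 : ℚ) = (k - 1) * Nat.multichoose m (k - 1) / m := by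
    field_simp; linear_combination hx
  have c1 : ((m + 1 + k).choose (m + 1) : ℚ) = (m + k + 1) / (m + 1) * (m + k).choose m := by
    have := Nat.add_one_mul_choose_eq (m + k) m
    rw [show m + k + 1 = m + 1 + k by ring] at this
    have h2 : ((m : ℚ) + 1 + k) * ((m + k).choose m : ℚ) =
        (m + 1 + k).choose (m + 1) * (m + 1) := by
      exact_mod_cast this
    field_simp
    linear_combination -h2
  have c2 : (Nat.multichoose m (k - 1) : ℚ) =
      (m + 1) * m / ((m + k) * (m + k - 1)) * (m + k).choose (m + 1) := by
    rw [Nat.multichoose_eq]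
    have h1 := Nat.add_one_mul_choose_eq (m + k - 1) m
    have h2 := Nat.add_one_mul_choose_eq (m + (k - 1) - 1) (m - 1)
    rw [show m + k - 1 + 1 = m + k by omega] at h1
    rw [show m + (k - 1) - 1 + 1 = m + k - 1 by omega, show m - 1 + 1 = m by omega] at h2
    rw [← Nat.choose_symm_of_eq_add (show m + (k - 1) - 1 = (m - 1) + (k - 1) by omega)]
    have h1' : ((m : ℚ) + k) * (m + k - 1).choose m = (m + k).choose (m + 1) * (m + 1) := by
      exact_mod_cast h1
    have h2' : ((m + k - 1 : ℕ) : ℚ) * (m + (k - 1) - 1).choose (m - 1) =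
        (m + k - 1).choose m * m := by exact_mod_cast h2
    rw [Nat.cast_sub (by omega)] at h2'
    push_cast at h2'
    field_simp
    linear_combination ((m : ℚ) + k) * h2' + (m : ℚ) * h1'
  rw [refined, c1, Nat.add_sub_cancel, hx', c2]
  push_cast
  by_cases hk1 : k = 1
  · subst hk1
    rcases Nat.eq_or_lt_of_le hqm with rfl | hlt
    · simp [Nat.multichoose_zero_right]
      field_simp
    · obtain ⟨y, hy⟩ : ∃ y, m + 1 - q = y + 1 := ⟨m - q, by omega⟩
      simp [hy]
  · have hk1' : (k : ℚ) - 1 ≠ 0 := by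
      have : (2 : ℚ) ≤ k := by exact_mod_cast (by omega : 2 ≤ k)
      linarith
    have hy' : (shiftChoose k (m + 1 - q) 1 : ℚ) =
        (m + 1 - q) * Nat.multichoose (k - 1) (m + 1 - q) / (k - 1) := by
      field_simp; linear_combination hy
    rw [hy', show (m : ℚ) + 1 + k - 1 = m + k by ring, show (m : ℚ) + 1 + k = m + k + 1 by ring]
    field_simp
    ring

theorem bipolarCountFace_eq {m k j : ℕ} (hm : 1 ≤ m) (hk : 1 ≤ k) (hj : 2 ≤ j) (hjm : j ≤ m + 1) :
    (bipolarCountFace (m + k) m j : ℚ) =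
      (j : ℚ) * (j - 1) / (((m : ℚ) + k - 1) * (m + k) ^ 2) *
      (m + k).choose m * (m + k).choose (m + 1) * Nat.multichoose (k - 1) (m + 1 - j) := by
  rw [bipolarCountFace_eq_succ (by omega) _ _ (by omega), show m + k + 1 = m + 1 + k by ring,
    bipolarCountVertexFace_eq_refined le_rfl hk (by omega) (by omega),
    refined_one hm hk (by omega) hjm]

theorem bipolarCount_eq {m k : ℕ} (hm : 1 ≤ m) (hk : 1 ≤ k) :
    (bipolarCount (m + k) m : ℚ) = 2 / (((m : ℚ) + k - 1) * (m + k) ^ 2) *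
      (m + k).choose (m - 1) * (m + k).choose m * (m + k).choose (m + 1) := by
  have hm0 : (m : ℚ) ≠ 0 := by exact_mod_cast (by omega : m ≠ 0)
  have hm1 : (m : ℚ) + 1 ≠ 0 := by exact_mod_cast (by omega : m + 1 ≠ 0)
  have hn0 : (m : ℚ) + k ≠ 0 := by exact_mod_cast (by omega : m + k ≠ 0)
  have hn1 : (m : ℚ) + k + 1 ≠ 0 := by exact_mod_cast (by omega : m + k + 1 ≠ 0)
  have hn2 : (m : ℚ) + k - 1 ≠ 0 := by
    have : (2 : ℚ) ≤ m + k := by exact_mod_cast (by omega : 2 ≤ m + k)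
    linarith
  rw [bipolarCount_eq_succ (by omega), show m + k + 1 = m + (k + 1) by ring,
    bipolarCountFace_eq hm (by omega) le_rfl (by omega), Nat.add_sub_cancel]
  have c1 : ((m + (k + 1)).choose m : ℚ) = (m + k + 1) / m * (m + k).choose (m - 1) := by
    have h := Nat.add_one_mul_choose_eq (m + k) (m - 1)
    rw [show m - 1 + 1 = m by omega] at h
    have h2 : ((m : ℚ) + k + 1) * (m + k).choose (m - 1) = (m + k + 1).choose m * m := by
      exact_mod_cast h
    rw [← add_assoc]
    field_simp
    linear_combination -h2
  have c2 : ((m + (k + 1)).choose (m + 1) : ℚ) = (m + k + 1) / (m + 1) * (m + k).choose m := by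
    have h2 : ((m : ℚ) + k + 1) * (m + k).choose m = (m + k + 1).choose (m + 1) * (m + 1) := by
      exact_mod_cast Nat.add_one_mul_choose_eq (m + k) m
    rw [← add_assoc]
    field_simp
    linear_combination -h2
  have c3 : (Nat.multichoose k (m + 1 - 2) : ℚ) =
      (m + 1) * m / ((m + k) * (m + k - 1)) * (m + k).choose (m + 1) := by
    rw [Nat.multichoose_eq, show k + (m + 1 - 2) - 1 = m + k - 2 by omega,
      show m + 1 - 2 = m - 1 by omega]
    have h1 := Nat.add_one_mul_choose_eq (m + k - 1) m
    have h2 := Nat.add_one_mul_choose_eq (m + k - 2) (m - 1)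
    rw [show m + k - 1 + 1 = m + k by omega] at h1
    rw [show m + k - 2 + 1 = m + k - 1 by omega, show m - 1 + 1 = m by omega] at h2
    have h1' : ((m : ℚ) + k) * (m + k - 1).choose m = (m + k).choose (m + 1) * (m + 1) := by
      exact_mod_cast h1
    have h2' : ((m + k - 1 : ℕ) : ℚ) * (m + k - 2).choose (m - 1) =
        (m + k - 1).choose m * m := by exact_mod_cast h2
    rw [Nat.cast_sub (by omega)] at h2'
    push_cast at h2'
    field_simp
    linear_combination ((m : ℚ) + k) * h2' + (m : ℚ) * h1'
  rw [c1, c2, c3]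
  push_cast
  have : (m : ℚ) + (k + 1) - 1 ≠ 0 := by intro h; apply hn0; linear_combination h
  have : (m : ℚ) + (k + 1) ≠ 0 := by intro h; apply hn1; linear_combination h
  field_simp
  ring

theorem binom_sub_two {k y : ℕ} (hk : 1 ≤ k) :
    binom ((y : ℤ) + k - 2) ((k : ℤ) - 2) = Nat.multichoose (k - 1) y := by
  rcases Nat.eq_or_lt_of_le hk with rfl | hk2
  · rcases y with (_ | y)
    · simp [binom]
    · have h : ((y + 1 : ℕ) : ℤ) + ((1 : ℕ) : ℤ) - 2 = (y : ℕ) := by push_cast; ring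
      rw [h, binom, if_neg (by norm_num), if_pos (by omega),
        show ((y : ℤ) - (((1 : ℕ) : ℤ) - 2)).toNat = y + 1 by omega, Ring.choose_natCast]
      simp
  · obtain ⟨l, rfl⟩ : ∃ l, k = l + 2 := ⟨k - 2, by omega⟩
    have h : (y : ℤ) + ((l + 2 : ℕ) : ℤ) - 2 = ((y + l : ℕ) : ℤ) := by push_cast; ring
    have h2 : ((l + 2 : ℕ) : ℤ) - 2 = (l : ℤ) := by push_cast; ring
    rw [h, h2, binom, if_pos (by omega), Int.toNat_natCast, Ring.choose_natCast,
      Nat.multichoose_eq]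
    rw [show l + 2 - 1 + y - 1 = y + l by omega, Nat.choose_symm_add]

theorem binom_sub_two' {k y : ℕ} (hk : 1 ≤ k) :
    binom ((y : ℤ) + k - 2) (y : ℤ) = Nat.multichoose (k - 1) y := by
  rw [binom, if_pos (by omega), Int.toNat_natCast]
  rcases Nat.eq_or_lt_of_le hk with rfl | hk2
  · rcases y with (_ | y)
    · simp
    · have h : ((y + 1 : ℕ) : ℤ) + ((1 : ℕ) : ℤ) - 2 = (y : ℕ) := by push_cast; ring
      rw [h, Ring.choose_natCast]
      simp
  · obtain ⟨l, rfl⟩ : ∃ l, k = l + 2 := ⟨k - 2, by omega⟩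
    have h : (y : ℤ) + ((l + 2 : ℕ) : ℤ) - 2 = ((y + l : ℕ) : ℤ) := by push_cast; ring
    rw [h, Ring.choose_natCast, Nat.multichoose_eq, show l + 2 - 1 + y - 1 = y + l by omega]

/-- In the excluded case the two sides differ: the extended binomial coefficient of `-1` over `0` is
`1`, but `shiftChoose` is `0`. -/
theorem binom_sub_one {k y : ℕ} (hk : 1 ≤ k) (h : ¬ (k = 1 ∧ y = 0)) :
    binom ((y : ℤ) + k - 2) ((k : ℤ) - 1) = shiftChoose k y 1 := by
  have e : (y : ℤ) + k - 2 = ((y + k - 2 : ℕ) : ℤ) := by omega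
  have e2 : (k : ℤ) - 1 = ((k - 1 : ℕ) : ℤ) := by omega
  rw [e, e2, binom, if_pos (by omega), Int.toNat_natCast, Ring.choose_natCast]
  rcases y with (_ | y)
  · simp only [shiftChoose]
    rw [Nat.choose_eq_zero_of_lt (by omega)]
    simp
  · simp only [shiftChoose, le_add_iff_nonneg_left, zero_le, if_true, Nat.add_sub_cancel]
    rw [Nat.multichoose_eq, show y + 1 + k - 2 = y + (k - 1) by omega,
      show k + y - 1 = y + (k - 1) by omega, Nat.choose_symm_add]

/-- The closed form in terms of the extended binomial coefficients. -/
theorem refined_eq_binom {m k p q : ℕ} (hp : 1 ≤ p) (hpk : p ≤ k) (hq : 1 ≤ q) (hqm : q ≤ m)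
    (hmk : 3 ≤ m + k) :
    refined m k p q = (p : ℚ) * q / (((m : ℚ) + k) * (m + k - 1)) * (m + k).choose m *
      ((binom (((m - q : ℕ) : ℤ) + k - 2) ((k : ℤ) - 2) : ℚ) *
        (binom (((k - p : ℕ) : ℤ) + m - 2) ((m : ℤ) - 2) : ℚ) -
      (binom (((m - q : ℕ) : ℤ) + k - 2) ((k : ℤ) - 1) : ℚ) *
        (binom (((k - p : ℕ) : ℤ) + m - 2) ((m : ℤ) - 1) : ℚ)) := by
  rw [refined, binom_sub_two (hp.trans hpk), binom_sub_two (hq.trans hqm)]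
  have : (binom (((m - q : ℕ) : ℤ) + k - 2) ((k : ℤ) - 1) : ℚ) *
        (binom (((k - p : ℕ) : ℤ) + m - 2) ((m : ℤ) - 1) : ℚ) =
        shiftChoose k (m - q) 1 * shiftChoose m (k - p) 1 := by
    -- When one factor is exceptional the other one vanishes, as `3 ≤ m + k` forbids both from being
    -- exceptional. With two edges both are, and the binomial form would give `0` in place of `1`.
    by_cases h1 : k = 1 ∧ m - q = 0
    · rw [binom_sub_one (k := m) (by omega) (by omega), h1.2, show k - p = 0 by omega]
      simp [shiftChoose]
    by_cases h2 : m = 1 ∧ k - p = 0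
    · rw [binom_sub_one (k := k) (by omega) (by omega), h2.2, show m - q = 0 by omega]
      simp [shiftChoose]
    rw [binom_sub_one (by omega) h1, binom_sub_one (by omega) h2]
    push_cast
    ring
  rw [this]
  push_cast
  ring

theorem bipolarCount_formula {n m : ℕ} (hm : 1 ≤ m) (hmn : m < n) :
    (bipolarCount n m : ℚ) = 2 / (((n : ℚ) - 1) * (n : ℚ) ^ 2) *
      (n.choose (m - 1) : ℚ) * (n.choose m : ℚ) * (n.choose (m + 1) : ℚ) := by
  obtain ⟨k, rfl⟩ := Nat.exists_eq_add_of_lt hmn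
  rw [add_assoc, bipolarCount_eq hm (by omega)]
  push_cast
  ring

theorem bipolarCountFace_formula {n m j : ℕ} (hm : 1 ≤ m) (hmn : m < n) (hj : 2 ≤ j)
    (hjm : j ≤ m + 1) :
    (bipolarCountFace n m j : ℚ) =
      (j : ℚ) * ((j : ℚ) - 1) / (((n : ℚ) - 1) * (n : ℚ) ^ 2) *
        (n.choose m : ℚ) * (n.choose (m + 1) : ℚ) *
        (binom ((n : ℤ) - j - 1) ((m : ℤ) - j + 1) : ℚ) := by
  obtain ⟨k, hk, rfl⟩ : ∃ k, 1 ≤ k ∧ n = m + k := ⟨n - m, by omega, by omega⟩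
  have h1 : ((m + k : ℕ) : ℤ) - j - 1 = ((m + 1 - j : ℕ) : ℤ) + k - 2 := by omega
  have h2 : (m : ℤ) - j + 1 = ((m + 1 - j : ℕ) : ℤ) := by omega
  rw [bipolarCountFace_eq hm hk hj hjm, h1, h2, binom_sub_two' hk]
  push_cast
  ring

theorem bipolarCountVertexFace_formula {n m i j : ℕ} (hn : 3 ≤ n) (hi : 2 ≤ i)
    (him : i + m ≤ n + 1) (hj : 2 ≤ j) (hjm : j ≤ m + 1) :
    (bipolarCountVertexFace n m i j : ℚ) =
        ((i : ℚ) - 1) * ((j : ℚ) - 1) / (((n : ℚ) - 1) * (n : ℚ)) * (n.choose m : ℚ) *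
          ((binom ((n : ℤ) - j - 1) ((n : ℤ) - m - 2) : ℚ) *
              (binom ((n : ℤ) - i - 1) ((m : ℤ) - 2) : ℚ) -
            (binom ((n : ℤ) - j - 1) ((n : ℤ) - m - 1) : ℚ) *
              (binom ((n : ℤ) - i - 1) ((m : ℤ) - 1) : ℚ)) := by
  obtain ⟨k, rfl⟩ : ∃ k, n = m + k := ⟨n - m, by omega⟩
  obtain ⟨p, rfl⟩ : ∃ p, i = p + 1 := ⟨i - 1, by omega⟩
  obtain ⟨q, rfl⟩ : ∃ q, j = q + 1 := ⟨j - 1, by omega⟩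
  have h1 : ((m + k : ℕ) : ℤ) - (q + 1 : ℕ) - 1 = ((m - q : ℕ) : ℤ) + k - 2 := by omega
  have h2 : ((m + k : ℕ) : ℤ) - (p + 1 : ℕ) - 1 = ((k - p : ℕ) : ℤ) + m - 2 := by omega
  have h3 : ((m + k : ℕ) : ℤ) - m - 2 = (k : ℤ) - 2 := by omega
  have h4 : ((m + k : ℕ) : ℤ) - m - 1 = (k : ℤ) - 1 := by omega
  rw [bipolarCountVertexFace_eq_refined (by omega) (by omega) (by omega) (by omega),
    refined_eq_binom (by omega) (by omega) (by omega) (by omega) hn, h1, h2, h3, h4]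
  push_cast
  ring

end BipolarMap

/-! ### Spaces of functions of polynomially growing dimension -/

namespace Holonomy

open Submodule

variable {X : Type*}

/-- A family of spaces of functions whose dimensions grow like a polynomial of degree `d`. -/
def Growth (W : ℕ → Submodule ℚ (X → ℚ)) (d : ℕ) : Prop :=
  ∃ C : ℕ, ∀ D : ℕ, ∃ s : Finset (X → ℚ), s.card ≤ C * (D + 1) ^ d ∧
    W D ≤ span ℚ (s : Set (X → ℚ))

theorem Growth.mono {V W : ℕ → Submodule ℚ (X → ℚ)} {d : ℕ} (hW : Growth W d)
    (h : ∀ D, V D ≤ W D) : Growth V d := by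
  obtain ⟨C, hC⟩ := hW
  refine ⟨C, fun D => ?_⟩
  obtain ⟨s, hs, hsW⟩ := hC D
  exact ⟨s, hs, (h D).trans hsW⟩

theorem Growth.sup {V W : ℕ → Submodule ℚ (X → ℚ)} {d : ℕ} (hV : Growth V d)
    (hW : Growth W d) : Growth (fun D => V D ⊔ W D) d := by
  classical
  obtain ⟨C, hC⟩ := hV
  obtain ⟨C', hC'⟩ := hW
  refine ⟨C + C', fun D => ?_⟩
  obtain ⟨s, hs, hsW⟩ := hC D
  obtain ⟨s', hs', hsW'⟩ := hC' D
  refine ⟨s ∪ s', (Finset.card_union_le _ _).trans (by rw [add_mul]; omega), ?_⟩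
  rw [Finset.coe_union, span_union]
  exact sup_le_sup hsW hsW'

theorem Growth.mul {V W : ℕ → Submodule ℚ (X → ℚ)} {d d' : ℕ} (hV : Growth V d)
    (hW : Growth W d') : Growth (fun D => V D * W D) (d + d') := by
  classical
  obtain ⟨C, hC⟩ := hV
  obtain ⟨C', hC'⟩ := hW
  refine ⟨C * C', fun D => ?_⟩
  obtain ⟨s, hs, hsW⟩ := hC D
  obtain ⟨s', hs', hsW'⟩ := hC' D
  refine ⟨(s ×ˢ s').image fun p => p.1 * p.2, ?_, ?_⟩
  · refine Finset.card_image_le.trans ?_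
    rw [Finset.card_product, pow_add]
    calc s.card * s'.card ≤ (C * (D + 1) ^ d) * (C' * (D + 1) ^ d') := Nat.mul_le_mul hs hs'
      _ = _ := by ring
  · refine (mul_le_mul' hsW hsW').trans ?_
    rw [span_mul_span]
    refine span_mono ?_
    rintro _ ⟨f, hf, g, hg, rfl⟩
    simp only [Finset.coe_image, Finset.coe_product]
    exact ⟨(f, g), ⟨hf, hg⟩, rfl⟩

theorem growth_singleton (g : ℕ → X → ℚ) : Growth (fun D => span ℚ {g D}) 0 :=
  ⟨1, fun D => ⟨{g D}, by simp, by simp⟩⟩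

/-- The functions that are affine in `a`. -/
def lin (a : X → ℤ) : Submodule ℚ (X → ℚ) := span ℚ {1, fun e => (a e : ℚ)}

theorem one_le_lin (a : X → ℤ) : 1 ≤ lin a := by
  rw [one_eq_span]
  exact span_mono (by simp)

theorem coe_mem_lin (a : X → ℤ) : (fun e => (a e : ℚ)) ∈ lin a := subset_span (by simp)

theorem const_mem_lin (a : X → ℤ) (c : ℚ) : (fun _ => c) ∈ lin a := by
  have h : (1 : X → ℚ) ∈ lin a := subset_span (by simp)
  have : (fun _ => c) = c • (1 : X → ℚ) := by ext; simp
  rw [this]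
  exact smul_mem _ _ h

theorem le_mul_of_one_le {V W : Submodule ℚ (X → ℚ)} (hW : 1 ≤ W) : V ≤ V * W := by
  calc V = V * 1 := (mul_one V).symm
    _ ≤ V * W := mul_le_mul' le_rfl hW

theorem pow_le_pow_of_one_le {W : Submodule ℚ (X → ℚ)} (hW : 1 ≤ W) {a b : ℕ} (h : a ≤ b) :
    W ^ a ≤ W ^ b := by
  obtain ⟨c, rfl⟩ := Nat.exists_eq_add_of_le h
  rw [pow_add]
  refine le_mul_of_one_le ?_
  induction c with
  | zero => simp
  | succ c ih =>
    rw [pow_succ]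
    exact (ih (by omega)).trans (le_mul_of_one_le hW)

theorem lin_pow_le (a : X → ℤ) (B : ℕ) :
    lin a ^ B ≤ span ℚ ((fun s : ℕ => (fun e => (a e : ℚ)) ^ s) '' Set.Iic B) := by
  induction B with
  | zero =>
    rw [pow_zero, one_eq_span]
    exact span_mono (by simp)
  | succ B ih =>
    rw [pow_succ]
    refine (mul_le_mul' ih le_rfl).trans ?_
    rw [lin, span_mul_span, span_le]
    rintro _ ⟨f, ⟨s, hs, rfl⟩, g, hg, rfl⟩
    have hs' : s ≤ B := hs
    refine subset_span ?_
    rcases hg with rfl | rfl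
    · exact ⟨s, Nat.le_succ_of_le hs', by simp⟩
    · exact ⟨s + 1, Nat.succ_le_succ hs', pow_succ _ _⟩

theorem growth_lin_pow (a : X → ℤ) (c : ℕ) : Growth (fun D => lin a ^ (c * (D + 1))) 1 := by
  classical
  refine ⟨c + 1, fun D => ⟨(Finset.Iic (c * (D + 1))).image fun s => (fun e => (a e : ℚ)) ^ s,
    Finset.card_image_le.trans ?_, ?_⟩⟩
  · rw [Nat.card_Iic, pow_one, add_mul]
    omega
  · rw [Finset.coe_image, Finset.coe_Iic]
    exact lin_pow_le a _

/-- The functions spanned by the indicators of `a = c`, for `|c| ≤ Q`. -/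
def del (a : X → ℤ) (Q : ℕ) : Submodule ℚ (X → ℚ) :=
  span ℚ ((fun c : ℤ => (fun e => if a e = c then (1 : ℚ) else 0)) '' Set.Icc (-(Q : ℤ)) Q)

theorem growth_del (a : X → ℤ) (c : ℕ) : Growth (fun D => del a (c * (D + 1))) 1 := by
  classical
  refine ⟨2 * c + 1, fun D => ⟨(Finset.Icc (-((c * (D + 1) : ℕ) : ℤ)) (c * (D + 1) : ℕ)).image
    fun c : ℤ => (fun e => if a e = c then (1 : ℚ) else 0), Finset.card_image_le.trans ?_, ?_⟩⟩
  · rw [Int.card_Icc]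
    generalize hq : c * (D + 1) = q
    have : (2 * c + 1) * (D + 1) ^ 1 = 2 * q + (D + 1) := by rw [← hq]; ring
    omega
  · rw [Finset.coe_image, Finset.coe_Icc]
    exact le_rfl

theorem indicator_mem_del (a : X → ℤ) {Q : ℕ} {c : ℤ} (h1 : -(Q : ℤ) ≤ c) (h2 : c ≤ Q) :
    (fun e => if a e = c then (1 : ℚ) else 0) ∈ del a Q :=
  subset_span ⟨c, ⟨h1, h2⟩, rfl⟩

theorem del_mul_le {a : X → ℤ} {Q : ℕ} {W V : Submodule ℚ (X → ℚ)}
    (h : ∀ c : ℤ, -(Q : ℤ) ≤ c → c ≤ Q → ∀ f ∈ W,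
      (fun e => if a e = c then f e else 0) ∈ V) : del a Q * W ≤ V := by
  rw [Submodule.mul_le]
  intro d hd f hf
  refine span_induction (p := fun d _ => d * f ∈ V) ?_ ?_ ?_ ?_ hd
  · rintro _ ⟨c, ⟨h1, h2⟩, rfl⟩
    have := h c h1 h2 f hf
    convert this using 1
    ext e
    simp
  · simp
  · intro x y _ _ hx hy
    rw [add_mul]
    exact add_mem hx hy
  · intro r x _ hx
    rw [smul_mul_assoc]
    exact smul_mem _ _ hx

/-- On the slices `i = c` with `x + i = k + 1` the coordinate `x` is affine in `k`. -/
theorem del_mul_lin_le {i x k : X → ℤ} (hx : ∀ e, x e + i e = k e + 1) (Q : ℕ) :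
    del i Q * lin x ≤ del i Q * lin k := by
  refine del_mul_le fun c h1 h2 f hf => ?_
  have h3 := indicator_mem_del i h1 h2
  obtain ⟨r, s, rfl⟩ := mem_span_pair.1 hf
  have : (fun e => if i e = c then (r • (1 : X → ℚ) + s • fun e => (x e : ℚ)) e else 0) =
      (fun e => if i e = c then (1 : ℚ) else 0) *
      ((fun _ => r + s * (1 - c)) + s • fun e => (k e : ℚ)) := by
    ext e
    have h4 := hx e
    by_cases h5 : i e = c
    · have h6 : (x e : ℚ) = k e + 1 - c := by
        have : x e = k e + 1 - c := by omega
        rw [this]; push_cast; ring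
      simp [h5, h6]
      ring
    · simp [h5]
  rw [this]
  exact mul_mem_mul h3 (add_mem (const_mem_lin _ _) (smul_mem _ _ (coe_mem_lin k)))

/-- On each slice `a` is constant, so polynomials in `a` cost no dimension there. -/
theorem del_mul_lin_self_le (a : X → ℤ) (Q : ℕ) : del a Q * lin a ≤ del a Q := by
  refine del_mul_le fun c h1 h2 f hf => ?_
  have h3 := indicator_mem_del a h1 h2
  obtain ⟨r, s, rfl⟩ := mem_span_pair.1 hf
  have : (fun e => if a e = c then (r • (1 : X → ℚ) + s • fun e => (a e : ℚ)) e else 0) =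
      (r + s * c) • (fun e => if a e = c then (1 : ℚ) else 0) := by
    ext e
    by_cases h5 : a e = c
    · simp [h5]
    · simp [h5]
  rw [this]
  exact smul_mem _ _ h3

theorem mul_pow_le_of_mul_le {V W : Submodule ℚ (X → ℚ)} (h : V * W ≤ V) (B : ℕ) :
    V * W ^ B ≤ V := by
  induction B with
  | zero => simp
  | succ B ih =>
    rw [pow_succ, ← mul_assoc]
    exact (mul_le_mul' ih le_rfl).trans h

theorem mul_pow_le_of_mul_le' {V W U : Submodule ℚ (X → ℚ)} (h : V * W ≤ V * U) (B : ℕ) :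
    V * W ^ B ≤ V * U ^ B := by
  induction B with
  | zero => simp
  | succ B ih =>
    calc V * W ^ (B + 1) = (V * W ^ B) * W := by rw [pow_succ, mul_assoc]
      _ ≤ (V * U ^ B) * W := mul_le_mul' ih le_rfl
      _ = (V * W) * U ^ B := by ring
      _ ≤ (V * U) * U ^ B := mul_le_mul' h le_rfl
      _ = V * U ^ (B + 1) := by ring

theorem prod_mem_pow {W : Submodule ℚ (X → ℚ)} {f : ℕ → X → ℚ} (h : ∀ t, f t ∈ W) (N : ℕ) :
    (fun e => ∏ t ∈ Finset.range N, f t e) ∈ W ^ N := by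
  induction N with
  | zero =>
    simp only [Finset.range_zero, Finset.prod_empty, pow_zero]
    exact Submodule.one_le.1 (le_refl (1 : Submodule ℚ (X → ℚ)))
  | succ N ih =>
    rw [pow_succ]
    have : (fun e => ∏ t ∈ Finset.range (N + 1), f t e) =
        (fun e => ∏ t ∈ Finset.range N, f t e) * f N := by
      ext e; simp [Finset.prod_range_succ]
    rw [this]
    exact mul_mem_mul ih (h N)

/-- `1 / z!`, with value `0` for negative `z`. -/
def invFact (z : ℤ) : ℚ := if 0 ≤ z then 1 / (z.toNat.factorial : ℚ) else 0

/-- `z!`, with value `1` for negative `z`. -/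
def fact (z : ℤ) : ℚ := z.toNat.factorial

theorem invFact_sub_one (z : ℤ) : invFact (z - 1) = z * invFact z := by
  unfold invFact
  rcases lt_trichotomy z 0 with h | rfl | h
  · rw [if_neg (by omega), if_neg (by omega), mul_zero]
  · simp
  · obtain ⟨n, rfl⟩ : ∃ n : ℕ, z = n + 1 := ⟨(z - 1).toNat, by omega⟩
    rw [if_pos (by omega), if_pos (by omega), show ((n : ℤ) + 1 - 1).toNat = n by omega,
      show ((n : ℤ) + 1).toNat = n + 1 by omega, Nat.factorial_succ]
    push_cast
    field_simp

theorem invFact_sub (z : ℤ) (N : ℕ) :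
    invFact (z - N) = invFact z * ∏ t ∈ Finset.range N, ((z : ℚ) - t) := by
  induction N with
  | zero => simp
  | succ N ih =>
    rw [Finset.prod_range_succ, ← mul_assoc, ← ih,
      show z - ((N + 1 : ℕ) : ℤ) = z - N - 1 by push_cast; ring, invFact_sub_one]
    push_cast
    ring

theorem fact_add {z : ℤ} (hz : 0 ≤ z) (N : ℕ) :
    fact (z + N) = fact z * ∏ t ∈ Finset.range N, ((z : ℚ) + (t + 1)) := by
  induction N with
  | zero => simp
  | succ N ih =>
    rw [Finset.prod_range_succ, ← mul_assoc, ← ih, fact, fact,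
      show (z + ((N + 1 : ℕ) : ℤ)).toNat = (z + N).toNat + 1 by omega, Nat.factorial_succ]
    have : (((z + N).toNat : ℕ) : ℚ) = z + N := by
      have : (((z + N).toNat : ℕ) : ℤ) = z + N := by omega
      exact_mod_cast this
    push_cast
    rw [this]
    ring

/-- The common factor of the hypergeometric terms below. -/
def hypBase (m k : X → ℤ) (R : ℕ) : X → ℚ := fun e =>
  if (R : ℤ) ≤ m e + k e then
    fact (m e + k e - R) * invFact (m e + R) * invFact (k e + R) else 0

/-- `hypBase` has the smallest numerator and the largest denominators allowed by shifts up to `R`.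
Each of the three factors is then recovered by at most `2 * R` affine factors, which explains the
exponent `6 * R`. The cut-off `R ≤ m + k` keeps the argument of the base factorial non-negative. -/
theorem hyp_mem (m k : X → ℤ) {R : ℕ} {s a b : ℤ} (hs : -(R : ℤ) ≤ s) (hs' : s ≤ R)
    (ha : -(R : ℤ) ≤ a) (ha' : a ≤ R) (hb : -(R : ℤ) ≤ b) (hb' : b ≤ R) :
    (fun e => if (R : ℤ) ≤ m e + k e then
      fact (m e + k e + s) * invFact (m e + a) * invFact (k e + b) else 0) ∈
      span ℚ {hypBase m k R} * (lin m * lin k) ^ (6 * R) := by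
  have hone : (1 : Submodule ℚ (X → ℚ)) ≤ lin m * lin k :=
    (one_le_lin m).trans (le_mul_of_one_le (one_le_lin k))
  have hm : ∀ c : ℚ, (fun e => (m e : ℚ) + c) ∈ lin m * lin k := fun c =>
    le_mul_of_one_le (one_le_lin k) (add_mem (coe_mem_lin m) (const_mem_lin m c))
  have hk : ∀ c : ℚ, (fun e => (k e : ℚ) + c) ∈ lin m * lin k := fun c => by
    rw [mul_comm]
    exact le_mul_of_one_le (one_le_lin m) (add_mem (coe_mem_lin k) (const_mem_lin k c))
  have hmk : ∀ c : ℚ, (fun e => (m e : ℚ) + k e + c) ∈ lin m * lin k := fun c => by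
    have := add_mem (hm 0) (hk c)
    convert this using 1
    ext e; simp [add_assoc]
  obtain ⟨N1, hN1⟩ : ∃ N : ℕ, s + R = N := ⟨(s + R).toNat, by omega⟩
  obtain ⟨N2, hN2⟩ : ∃ N : ℕ, R - a = N := ⟨(R - a).toNat, by omega⟩
  obtain ⟨N3, hN3⟩ : ∃ N : ℕ, R - b = N := ⟨(R - b).toNat, by omega⟩
  have p1 := pow_le_pow_of_one_le hone (show N1 ≤ 2 * R by omega)
    (prod_mem_pow (fun t => hmk (-R + (t + 1))) N1)
  have p2 := pow_le_pow_of_one_le hone (show N2 ≤ 2 * R by omega)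
    (prod_mem_pow (fun t => hm (R - t)) N2)
  have p3 := pow_le_pow_of_one_le hone (show N3 ≤ 2 * R by omega)
    (prod_mem_pow (fun t => hk (R - t)) N3)
  have p := mul_mem_mul (mem_span_singleton_self (hypBase m k R))
    (mul_mem_mul (mul_mem_mul p1 p2) p3)
  rw [← pow_add, ← pow_add, show 2 * R + 2 * R + 2 * R = 6 * R by ring] at p
  convert p using 1
  ext e
  simp only [hypBase, Pi.mul_apply]
  split_ifs with h
  · rw [show m e + k e + s = (m e + k e - R) + (N1 : ℕ) by omega, fact_add (by omega),
      show m e + a = (m e + R) - (N2 : ℕ) by omega, invFact_sub,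
      show k e + b = (k e + R) - (N3 : ℕ) by omega, invFact_sub]
    push_cast
    have h1 : ∀ t : ℕ, (m e : ℚ) + k e - R + (t + 1) = m e + k e + (-R + (t + 1)) := fun t => by
      ring
    have h2 : ∀ t : ℕ, (m e : ℚ) + R - t = m e + (R - t) := fun t => by ring
    have h3 : ∀ t : ℕ, (k e : ℚ) + R - t = k e + (R - t) := fun t => by ring
    simp only [h1, h2, h3]
    ring
  · simp

end Holonomy

/-! ### Shifted multiset coefficients -/

namespace Holonomy

open Submodule

variable {X : Type*}

theorem mem_del_mul_del (a b : X → ℤ) {Q : ℕ} (φ : ℤ → ℤ → ℚ)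
    (h : ∀ c c', φ c c' ≠ 0 → (-(Q : ℤ) ≤ c ∧ c ≤ Q) ∧ -(Q : ℤ) ≤ c' ∧ c' ≤ Q) :
    (fun e => φ (a e) (b e)) ∈ del a Q * del b Q := by
  have : (fun e => φ (a e) (b e)) =
      ∑ c ∈ Finset.Icc (-(Q : ℤ)) Q, ∑ c' ∈ Finset.Icc (-(Q : ℤ)) Q,
        φ c c' • ((fun e => if a e = c then (1 : ℚ) else 0) *
          (fun e => if b e = c' then (1 : ℚ) else 0)) := by
    ext e
    simp only [Finset.sum_apply, Pi.smul_apply, Pi.mul_apply, smul_eq_mul, mul_ite, mul_one,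
      mul_zero, Finset.sum_ite_eq, Finset.mem_Icc]
    by_cases h0 : φ (a e) (b e) = 0
    · simp only [h0]
      split_ifs <;> simp [h0]
    · obtain ⟨h1, h2⟩ := h _ _ h0
      simp [h1, h2]
  rw [this]
  refine sum_mem fun c hc => sum_mem fun c' hc' => smul_mem _ _ ?_
  rw [Finset.mem_Icc] at hc hc'
  exact mul_mem_mul (indicator_mem_del a hc.1 hc.2) (indicator_mem_del b hc'.1 hc'.2)

/-- The number of multisets of size `y` on `κ - 1` elements, with value `0` unless `1 ≤ κ` and
`0 ≤ y`. -/
def multi (κ y : ℤ) : ℚ :=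
  if 1 ≤ κ ∧ 0 ≤ y then (Nat.multichoose (κ - 1).toNat y.toNat : ℚ) else 0

/-- Without the hypothesis the only failure is `κ = 1`, `y = 0`, where `multi` is `1` but `invFact
(κ - 2)` is `0`. -/
theorem multi_eq {κ y : ℤ} (h : 2 ≤ κ + y) :
    multi κ y = fact (κ + y - 2) * invFact (κ - 2) * invFact y := by
  unfold multi
  split_ifs with h1
  · obtain ⟨u, rfl⟩ : ∃ u : ℕ, y = u := ⟨y.toNat, by omega⟩
    by_cases h2 : κ = 1
    · subst h2
      obtain ⟨v, rfl⟩ : ∃ v : ℕ, u = v + 1 := ⟨u - 1, by omega⟩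
      simp [invFact]
    · obtain ⟨w, rfl⟩ : ∃ w : ℕ, κ = w + 2 := ⟨(κ - 2).toNat, by omega⟩
      rw [fact, invFact, invFact, if_pos (by omega), if_pos (by omega), Nat.multichoose_eq,
        show ((w : ℤ) + 2 - 1).toNat + (u : ℤ).toNat - 1 = w + u by omega,
        show ((w : ℤ) + 2 + u - 2).toNat = w + u by omega,
        show ((w : ℤ) + 2 - 2).toNat = w by omega, Int.toNat_natCast,
        Nat.cast_choose ℚ (Nat.le_add_left u w), Nat.add_sub_cancel]
      field_simp
  · by_cases h2 : 0 ≤ y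
    · have : invFact (κ - 2) = 0 := if_neg (by omega)
      rw [this]; ring
    · have : invFact y = 0 := if_neg h2
      rw [this]; ring

/-- The space generating the shifts of `multi k y`, cut off at small values of `j`, where
`y + j = m + 1`. -/
def multiSpace (m k y j : X → ℤ) (R : ℕ) : Submodule ℚ (X → ℚ) :=
  span ℚ {hypBase k y R} + del k (2 * R) * del y (2 * R) + del j R * span ℚ {hypBase m k R}

/-- The three summands of `multiSpace` serve three purposes: the factorial expression where `k + y ≥
R`, the finitely many slices that meet the support where `k + y < R`, and the correction for the
cut-off `c ≤ j`. -/
theorem multi_mem (m k y j : X → ℤ) (hj : ∀ e, 0 ≤ j e) (hy : ∀ e, y e + j e = m e + 1)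
    {r R : ℕ} (hR : 4 * r + 4 ≤ R) {a b : ℤ} (ha : -(r : ℤ) ≤ a) (ha' : a ≤ r)
    (hb : -(r : ℤ) ≤ b) (hb' : b ≤ r) {c : ℕ} (hc : c ≤ r + 1) :
    ∃ f ∈ multiSpace m k y j R * (lin k * lin y * lin m) ^ (6 * R),
      ∀ e, (R : ℤ) ≤ m e + k e → f e = if (c : ℤ) ≤ j e then multi (k e - a) (y e - b) else 0 := by
  have hL : (1 : Submodule ℚ (X → ℚ)) ≤ (lin k * lin y * lin m) ^ (6 * R) := by
    refine one_le_pow_of_one_le' ?_ _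
    exact (one_le_lin k).trans ((le_mul_of_one_le (one_le_lin y)).trans
      (le_mul_of_one_le (one_le_lin m)))
  have hky : (lin k * lin y) ^ (6 * R) ≤ (lin k * lin y * lin m) ^ (6 * R) :=
    pow_le_pow_left' (le_mul_of_one_le (one_le_lin m)) _
  have hmk : (lin m * lin k) ^ (6 * R) ≤ (lin k * lin y * lin m) ^ (6 * R) := by
    refine pow_le_pow_left' ?_ _
    rw [show lin k * lin y * lin m = lin m * lin k * lin y by ring]
    exact le_mul_of_one_le (one_le_lin y)
  have hA : span ℚ {hypBase k y R} ≤ multiSpace m k y j R := le_sup_left.trans le_sup_left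
  have hB : del k (2 * R) * del y (2 * R) ≤ multiSpace m k y j R := le_sup_right.trans le_sup_left
  have hC : del j R * span ℚ {hypBase m k R} ≤ multiSpace m k y j R := le_sup_right
  have h1 : (fun e => if (R : ℤ) ≤ k e + y e then multi (k e - a) (y e - b) else 0) ∈
      multiSpace m k y j R * (lin k * lin y * lin m) ^ (6 * R) := by
    have := hyp_mem k y (R := R) (s := -a - b - 2) (a := -a - 2) (b := -b) (by omega) (by omega)
      (by omega) (by omega) (by omega) (by omega)
    refine mul_le_mul' hA hky ?_
    convert this using 1
    ext e
    split_ifs with h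
    · rw [multi_eq (by omega), show k e - a + (y e - b) - 2 = k e + y e + (-a - b - 2) by ring,
        show k e - a - 2 = k e + (-a - 2) by ring, show y e - b = y e + -b by ring]
    · rfl
  -- Non-vanishing bounds `k` and `y` from below by about `-r`, and their sum is below `R`, so both
  -- have absolute value at most `2 * R`.
  have h2 : (fun e => if k e + y e < (R : ℤ) then multi (k e - a) (y e - b) else 0) ∈
      multiSpace m k y j R * (lin k * lin y * lin m) ^ (6 * R) := by
    refine le_mul_of_one_le hL (hB ?_)
    refine mem_del_mul_del k y (fun c c' => if c + c' < (R : ℤ) then multi (c - a) (c' - b) else 0)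
      fun c c' h => ?_
    have h3 : c + c' < (R : ℤ) := by
      by_contra h3
      exact h (if_neg h3)
    rw [if_pos h3] at h
    have h4 : 1 ≤ c - a ∧ 0 ≤ c' - b := by
      by_contra h4
      exact h (if_neg h4)
    push_cast
    omega
  -- The cut-off is achieved by subtracting the slices `j = l` with `l < c`. There `y = m + 1 - l`,
  -- so the coefficient is a factorial term in `m` and `k` alone.
  have h3 : ∀ l ∈ Finset.range c, (fun e => (if j e = (l : ℤ) then (1 : ℚ) else 0) *
      (if (R : ℤ) ≤ m e + k e then multi (k e - a) (m e + 1 - l - b) else 0)) ∈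
      multiSpace m k y j R * (lin k * lin y * lin m) ^ (6 * R) := by
    intro l hl
    rw [Finset.mem_range] at hl
    have := hyp_mem m k (R := R) (s := -l - a - b - 1) (a := 1 - l - b) (b := -a - 2) (by omega)
      (by omega) (by omega) (by omega) (by omega) (by omega)
    refine mul_le_mul' hC hmk ?_
    rw [mul_assoc]
    refine mul_mem_mul (indicator_mem_del j (c := (l : ℤ)) (by omega) (by omega)) ?_
    convert this using 1
    ext e
    split_ifs with h
    · rw [multi_eq (by omega),
        show k e - a + (m e + 1 - l - b) - 2 = m e + k e + (-l - a - b - 1) by ring,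
        show k e - a - 2 = k e + (-a - 2) by ring,
        show m e + 1 - l - b = m e + (1 - l - b) by ring]
      ring
    · rfl
  refine ⟨_, sub_mem (add_mem h1 h2) (sum_mem h3), fun e he => ?_⟩
  simp only [Pi.sub_apply, Pi.add_apply, Finset.sum_apply, if_pos he]
  have h4 : (if (R : ℤ) ≤ k e + y e then multi (k e - a) (y e - b) else 0) +
      (if k e + y e < (R : ℤ) then multi (k e - a) (y e - b) else 0) =
      multi (k e - a) (y e - b) := by
    by_cases h : (R : ℤ) ≤ k e + y e
    · rw [if_pos h, if_neg (by omega), add_zero]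
    · rw [if_neg h, if_pos (by omega), zero_add]
  rw [h4]
  obtain ⟨t, ht⟩ := Int.eq_ofNat_of_zero_le (hj e)
  have h5 : ∀ l : ℕ, (j e = (l : ℤ)) ↔ (l = t) := fun l => by omega
  have h6 : y e - b = m e + 1 - t - b := by have := hy e; omega
  simp only [h5, ite_mul, one_mul, zero_mul, Finset.sum_ite_eq', Finset.mem_range, h6]
  split_ifs <;> first | omega | simp

theorem growth_two {m k : X → ℤ} (g : ℕ → X → ℚ) (c : ℕ) :
    Growth (fun D => span ℚ {g D} * (lin m * lin k) ^ (c * (D + 1))) 2 := by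
  refine ((growth_singleton g).mul ((growth_lin_pow m c).mul (growth_lin_pow k c))).mono fun D => ?_
  rw [mul_pow]

/-- Each summand has three free one-parameter families: polynomials in `k`, `y`, `m`; slices of `k`
and `y` with polynomials in `m`; slices of `j` with polynomials in `k` and `m`, those in `y` being
traded for `m`. -/
theorem growth_multiSpace {m k y j : X → ℤ} (hy : ∀ e, y e + j e = m e + 1) (g : ℕ → X → ℚ)
    (R c : ℕ) :
    Growth (fun D => span ℚ {g D} * (multiSpace m k y j (R * (D + 1)) *
      (lin k * lin y * lin m) ^ (c * (D + 1)))) 3 := by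
  have p1 := ((growth_singleton g).mul (growth_singleton fun D => hypBase k y (R * (D + 1)))).mul
    (((growth_lin_pow k c).mul (growth_lin_pow y c)).mul (growth_lin_pow m c))
  have p2 := (growth_singleton g).mul
    (((growth_del k (2 * R)).mul (growth_del y (2 * R))).mul (growth_lin_pow m c))
  have p3 := ((growth_singleton g).mul (growth_singleton fun D => hypBase m k (R * (D + 1)))).mul
    (((growth_del j R).mul (growth_lin_pow k c)).mul (growth_lin_pow m (2 * c)))
  refine ((p1.sup p2).sup p3).mono fun D => ?_
  simp only [← Submodule.add_eq_sup, multiSpace, mul_pow, mul_assoc 2]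
  generalize hE : c * (D + 1) = E
  generalize R * (D + 1) = Q
  simp only [add_mul, mul_add]
  have hk := mul_pow_le_of_mul_le (del_mul_lin_self_le k (2 * Q)) E
  have hy' := mul_pow_le_of_mul_le (del_mul_lin_self_le y (2 * Q)) E
  have hj := mul_pow_le_of_mul_le' (del_mul_lin_le hy Q) E
  refine add_le_add (add_le_add (le_of_eq (by ring)) ?_) ?_
  · calc span ℚ {g D} * (del k (2 * Q) * del y (2 * Q) * (lin k ^ E * lin y ^ E * lin m ^ E))
        = span ℚ {g D} * ((del k (2 * Q) * lin k ^ E) * (del y (2 * Q) * lin y ^ E) *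
          lin m ^ E) := by ring
      _ ≤ _ := by gcongr
  · calc span ℚ {g D} * (del j Q * span ℚ {hypBase m k Q} * (lin k ^ E * lin y ^ E * lin m ^ E))
        = span ℚ {g D} * span ℚ {hypBase m k Q} * ((del j Q * lin y ^ E) * lin k ^ E *
          lin m ^ E) := by ring
      _ ≤ span ℚ {g D} * span ℚ {hypBase m k Q} * ((del j Q * lin m ^ E) * lin k ^ E *
          lin m ^ E) := by gcongr
      _ = _ := by ring

/-- The product of two spaces with three summands each has nine terms. In each, the slices absorb or
trade polynomial factors until four one-parameter families are left. -/
theorem growth_multiSpace_mul {m k x y i j : X → ℤ} (hy : ∀ e, y e + j e = m e + 1)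
    (hx : ∀ e, x e + i e = k e + 1) (g : ℕ → X → ℚ) (R c : ℕ) :
    Growth (fun D => span ℚ {g D} * (multiSpace m k y j (R * (D + 1)) *
      multiSpace k m x i (R * (D + 1)) *
      (lin k * lin y * lin m * lin x) ^ (c * (D + 1)))) 4 := by
  have key : ∀ (f f' : ℕ → X → ℚ) (A B C E : ℕ → Submodule ℚ (X → ℚ)), Growth A 1 → Growth B 1 →
      Growth C 1 → Growth E 1 → Growth (fun D => span ℚ {g D} * span ℚ {f D} * span ℚ {f' D} *
        (A D * B D * C D * E D)) 4 := fun f f' A B C E hA hB hC hE =>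
    (((growth_singleton g).mul (growth_singleton f)).mul (growth_singleton f')).mul
      (((hA.mul hB).mul hC).mul hE)
  let h1 : ℕ → X → ℚ := fun D => hypBase k y (R * (D + 1))
  let h2 : ℕ → X → ℚ := fun D => hypBase m x (R * (D + 1))
  let g1 : ℕ → X → ℚ := fun D => hypBase m k (R * (D + 1))
  let g2 : ℕ → X → ℚ := fun D => hypBase k m (R * (D + 1))
  let u : ℕ → X → ℚ := fun _ => 1
  have l := fun a : X → ℤ => growth_lin_pow a c
  have l2 := fun a : X → ℤ => growth_lin_pow a (2 * c)
  have dd := fun a : X → ℤ => growth_del a (2 * R)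
  have d := fun a : X → ℤ => growth_del a R
  refine ((((((((key h1 h2 _ _ _ _ (l k) (l y) (l m) (l x)).sup
    (key h1 u _ _ _ _ (dd m) (dd x) (l k) (l y))).sup
    (key h1 g2 _ _ _ _ (d i) (l2 k) (l y) (l m))).sup
    (key u h2 _ _ _ _ (dd k) (dd y) (l m) (l x))).sup
    (key u u _ _ _ _ (dd k) (dd y) (dd m) (dd x))).sup
    (key u g2 _ _ _ _ (dd k) (dd y) (d i) (l m))).sup
    (key g1 h2 _ _ _ _ (d j) (l k) (l2 m) (l x))).sup
    (key g1 u _ _ _ _ (d j) (dd m) (dd x) (l k))).sup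
    (key g1 g2 _ _ _ _ (d j) (d i) (l2 k) (l2 m)) |>.mono fun D => ?_
  have hu : span ℚ {u D} = 1 := one_eq_span.symm
  simp only [← Submodule.add_eq_sup, multiSpace, mul_pow, mul_assoc 2, hu, h1, h2, g1, g2]
  generalize hE : c * (D + 1) = E
  generalize R * (D + 1) = Q
  generalize span ℚ {g D} = G
  generalize span ℚ {hypBase k y Q} = H1
  generalize span ℚ {hypBase m x Q} = H2
  generalize span ℚ {hypBase m k Q} = G1
  generalize span ℚ {hypBase k m Q} = G2
  have hs := fun a : X → ℤ => mul_pow_le_of_mul_le (del_mul_lin_self_le a (2 * Q)) E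
  have hj := mul_pow_le_of_mul_le' (del_mul_lin_le hy Q) E
  have hi := mul_pow_le_of_mul_le' (del_mul_lin_le hx Q) E
  have hk := hs k
  have hm := hs m
  have hxx := hs x
  have hyy := hs y
  clear hs
  have e2 : ∀ a : X → ℤ, lin a ^ (2 * E) = lin a ^ E * lin a ^ E := fun a => by ring
  rw [e2, e2]
  revert hj hi hk hm hxx hyy
  generalize lin k ^ E = lk
  generalize lin y ^ E = ly
  generalize lin m ^ E = lm
  generalize lin x ^ E = lx
  generalize del k (2 * Q) = dk
  generalize del y (2 * Q) = dy
  generalize del m (2 * Q) = dm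
  generalize del x (2 * Q) = dx
  generalize del i Q = di
  generalize del j Q = dj
  intro hj hi hk hm hxx hyy
  calc G * ((H1 + dk * dy + dj * G1) * (H2 + dm * dx + di * G2) * (lk * ly * lm * lx))
      = G * H1 * H2 * (lk * ly * lm * lx) + G * H1 * 1 * ((dm * lm) * (dx * lx) * lk * ly) +
        G * H1 * G2 * ((di * lx) * lk * ly * lm) + G * 1 * H2 * ((dk * lk) * (dy * ly) * lm * lx) +
        G * 1 * 1 * ((dk * lk) * (dy * ly) * (dm * lm) * (dx * lx)) +
        G * 1 * G2 * ((dk * lk) * (dy * ly) * (di * lx) * lm) +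
        G * G1 * H2 * ((dj * ly) * lk * lm * lx) +
        G * G1 * 1 * ((dj * ly) * (dm * lm) * (dx * lx) * lk) +
        G * G1 * G2 * ((dj * ly) * (di * lx) * lk * lm) := by ring
    _ ≤ G * H1 * H2 * (lk * ly * lm * lx) + G * H1 * 1 * (dm * dx * lk * ly) +
        G * H1 * G2 * ((di * lk) * lk * ly * lm) + G * 1 * H2 * (dk * dy * lm * lx) +
        G * 1 * 1 * (dk * dy * dm * dx) +
        G * 1 * G2 * ((dk * lk) * dy * di * lm) +
        G * G1 * H2 * ((dj * lm) * lk * lm * lx) +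
        G * G1 * 1 * (dj * (dm * lm) * dx * lk) +
        G * G1 * G2 * ((dj * lm) * (di * lk) * lk * lm) := by
      -- Two moves are needed here: slices of `i` turn polynomials in `x` into polynomials in `k`,
      -- which the slices of `k` then absorb. The term `q8` is symmetric.
      have q6 : (dk * lk) * (dy * ly) * (di * lx) * lm ≤ (dk * lk) * dy * di * lm := by
        calc (dk * lk) * (dy * ly) * (di * lx) * lm ≤ dk * dy * (di * lk) * lm := by gcongr
          _ = _ := by ring
      have q8 : (dj * ly) * (dm * lm) * (dx * lx) * lk ≤ dj * (dm * lm) * dx * lk := by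
        calc (dj * ly) * (dm * lm) * (dx * lx) * lk ≤ (dj * lm) * dm * dx * lk := by gcongr
          _ = _ := by ring
      gcongr
    _ ≤ G * H1 * H2 * (lk * ly * lm * lx) + G * H1 * 1 * (dm * dx * lk * ly) +
        G * H1 * G2 * ((di * lk) * lk * ly * lm) + G * 1 * H2 * (dk * dy * lm * lx) +
        G * 1 * 1 * (dk * dy * dm * dx) +
        G * 1 * G2 * (dk * dy * di * lm) +
        G * G1 * H2 * ((dj * lm) * lk * lm * lx) +
        G * G1 * 1 * (dj * dm * dx * lk) +
        G * G1 * G2 * ((dj * lm) * (di * lk) * lk * lm) := by gcongr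
    _ = _ := by ring

end Holonomy

/-! ### From small dimension to differential equations -/

namespace Holonomy

open Submodule

variable {d : ℕ}

/-- The functions that vanish outside the box of side `Q`. -/
def box (d Q : ℕ) : Submodule ℚ ((Fin d →₀ ℕ) → ℚ) :=
  span ℚ ((fun e : Fin d → Fin (Q + 1) => Pi.single (Finsupp.equivFunOnFinite.symm fun i =>
    (e i : ℕ)) (1 : ℚ)) '' Set.univ)

theorem growth_box (d c : ℕ) : Growth (fun D => box d (c * (D + 1))) d := by
  classical
  refine ⟨(c + 1) ^ d, fun D => ⟨Finset.univ.image fun e : Fin d → Fin (c * (D + 1) + 1) =>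
    Pi.single (Finsupp.equivFunOnFinite.symm fun i => (e i : ℕ)) (1 : ℚ),
    Finset.card_image_le.trans ?_, ?_⟩⟩
  · rw [Finset.card_univ, Fintype.card_fun, Fintype.card_fin, Fintype.card_fin, ← mul_pow]
    refine Nat.pow_le_pow_left ?_ d
    rw [add_mul]
    omega
  · rw [Finset.coe_image, Finset.coe_univ]
    exact le_rfl

theorem mem_box {Q : ℕ} {f : (Fin d →₀ ℕ) → ℚ} (h : ∀ e, f e ≠ 0 → ∀ i, e i ≤ Q) :
    f ∈ box d Q := by
  classical
  have : f = ∑ e : Fin d → Fin (Q + 1), f (Finsupp.equivFunOnFinite.symm fun i => (e i : ℕ)) •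
      Pi.single (Finsupp.equivFunOnFinite.symm fun i => (e i : ℕ)) (1 : ℚ) := by
    ext e
    rw [Finset.sum_apply]
    by_cases h0 : f e = 0
    · rw [h0, Finset.sum_eq_zero]
      intro e' _
      by_cases h1 : e = Finsupp.equivFunOnFinite.symm fun i => (e' i : ℕ)
      · simp [← h1, h0]
      · simp [Pi.single_eq_of_ne h1]
    · rw [Finset.sum_eq_single fun i => (⟨e i, Nat.lt_succ_of_le (h e h0 i)⟩ : Fin (Q + 1))]
      · have h1 : (Finsupp.equivFunOnFinite.symm fun i => e i) = e := by ext; simp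
        simp [h1]
      · intro e' _ hne
        have h1 : e ≠ Finsupp.equivFunOnFinite.symm fun i => (e' i : ℕ) := by
          intro h1
          apply hne
          ext i
          simp [h1]
        simp [Pi.single_eq_of_ne h1]
      · simp
  rw [this]
  exact sum_mem fun e _ => smul_mem _ _ (subset_span ⟨e, trivial, rfl⟩)

/-- The coefficients of `X ^ α * (X v) ^ r * (∂ / ∂ X v) ^ r F`. -/
noncomputable def shiftTerm (F : MvPowerSeries (Fin d) ℚ) (v : Fin d) (α : Fin d →₀ ℕ) (r : ℕ) :
    (Fin d →₀ ℕ) → ℚ := fun e =>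
  if α ≤ e then ((e v - α v).descFactorial r : ℚ) * F (e - α) else 0

theorem coeff_iterate_pderiv (F : MvPowerSeries (Fin d) ℚ) (v : Fin d) (r : ℕ)
    (n : Fin d →₀ ℕ) :
    MvPowerSeries.coeff n ((fun G => MvPowerSeries.pderiv ℚ v G)^[r] F) =
      ((n v + r).descFactorial r : ℚ) * F (n + Finsupp.single v r) := by
  induction r generalizing n with
  | zero => simp; rfl
  | succ r ih =>
    rw [Function.iterate_succ_apply', MvPowerSeries.coeff_pderiv, ih]
    have h1 : n + Finsupp.single v 1 + Finsupp.single v r = n + Finsupp.single v (r + 1) := by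
      rw [add_assoc, ← Finsupp.single_add, add_comm 1 r]
    have h2 : (n + Finsupp.single v 1 : Fin d →₀ ℕ) v + r = n v + (r + 1) := by simp; omega
    rw [h1, h2, Nat.descFactorial_succ, show n v + (r + 1) - r = n v + 1 by omega]
    push_cast
    ring

/-- The extra `(X v) ^ r` cancels the degree shift of the derivative. Only `α` moves the
coefficients, and `r` contributes a polynomial factor. -/
theorem coeff_monomial_mul_iterate_pderiv (F : MvPowerSeries (Fin d) ℚ) (v : Fin d)
    (α : Fin d →₀ ℕ) (r : ℕ) (c : ℚ) (e : Fin d →₀ ℕ) :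
    MvPowerSeries.coeff e (MvPowerSeries.monomial (α + Finsupp.single v r) c *
      (fun G => MvPowerSeries.pderiv ℚ v G)^[r] F) = c * shiftTerm F v α r e := by
  classical
  rw [MvPowerSeries.coeff_monomial_mul, coeff_iterate_pderiv, shiftTerm]
  by_cases h : α + Finsupp.single v r ≤ e
  · have h1 : α ≤ e := le_self_add.trans h
    rw [if_pos h, if_pos h1]
    obtain ⟨t, rfl⟩ := le_iff_exists_add.1 h
    have h2 : α + Finsupp.single v r + t - (α + Finsupp.single v r) = t := by simp
    have h3 : α + Finsupp.single v r + t - α = t + Finsupp.single v r := by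
      rw [add_assoc, add_tsub_cancel_left, add_comm]
    have h4 : (α + Finsupp.single v r + t : Fin d →₀ ℕ) v - α v = t v + r := by simp; omega
    rw [h2, h3, h4]
  · rw [if_neg h]
    split_ifs with h1
    · have h2 : (e v - α v) < r := by
        by_contra h2
        apply h
        intro i
        have h3 := h1 i
        by_cases h4 : i = v
        · subst h4
          simp; omega
        · simpa [Finsupp.single_apply, Ne.symm h4] using h3
      rw [Nat.descFactorial_of_lt h2]
      simp
    · simp

/-- A power series is D-finite as soon as the spaces spanned by its shifted derivatives are
small. -/
theorem isDFinite_of_growth {F : MvPowerSeries (Fin d) ℚ}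
    {W : ℕ → Submodule ℚ ((Fin d →₀ ℕ) → ℚ)} (hW : Growth W d)
    (h : ∀ (v : Fin d) (D : ℕ) (α : Fin d →₀ ℕ) (r : ℕ), (∀ i, α i ≤ D) → r ≤ D →
      shiftTerm F v α r ∈ W D) : IsDFinite F := by
  classical
  intro v
  obtain ⟨C, hC⟩ := hW
  obtain ⟨s, hs, hsW⟩ := hC C
  let mon : (Fin d → Fin (C + 1)) → (Fin d →₀ ℕ) := fun β =>
    Finsupp.equivFunOnFinite.symm fun i => (β i : ℕ)
  have hmon : Function.Injective mon := by
    intro β β' h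
    have h1 := Finsupp.equivFunOnFinite.symm.injective h
    funext i
    exact Fin.ext (congrFun h1 i)
  let f : (Fin d → Fin (C + 1)) × Fin (C + 1) → (Fin d →₀ ℕ) → ℚ := fun p =>
    shiftTerm F v (mon p.1) p.2
  have hf : ¬ LinearIndependent ℚ f := by
    intro hli
    have h1 := linearIndependent_le_span_aux' f hli (s : Set ((Fin d →₀ ℕ) → ℚ)) (by
      rintro _ ⟨p, rfl⟩
      exact hsW (h v C _ _ (fun i => Nat.lt_succ_iff.1 (p.1 i).2) (Nat.lt_succ_iff.1 p.2.2)))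
    simp only [Fintype.card_prod, Fintype.card_fun, Fintype.card_fin, Fintype.card_coe,
      Finset.coe_sort_coe] at h1
    have h2 : 0 < (C + 1) ^ d := by positivity
    nlinarith
  obtain ⟨g, hg, p₀, hp₀⟩ := Fintype.not_linearIndependent_iff.1 hf
  refine ⟨C, fun r => ∑ β, MvPolynomial.monomial (mon β + Finsupp.single v (r : ℕ)) (g (β, r)),
    fun h0 => ?_, ?_⟩
  -- For a fixed order `r` the monomials are distinct, so no cancellation can make the coefficient
  -- polynomials vanish.
  · apply hp₀
    have h1 := congrArg (MvPolynomial.coeff (mon p₀.1 + Finsupp.single v (p₀.2 : ℕ)))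
      (congrFun h0 p₀.2)
    simpa [MvPolynomial.coeff_sum, MvPolynomial.coeff_monomial, hmon.eq_iff] using h1
  · ext e
    have h1 := congrFun hg e
    rw [Fintype.sum_prod_type_right] at h1
    simp only [Finset.sum_apply, Pi.smul_apply, smul_eq_mul, Pi.zero_apply] at h1
    rw [map_sum, map_zero, ← h1]
    refine Finset.sum_congr rfl fun r _ => ?_
    rw [← MvPolynomial.coeToMvPowerSeries.ringHom_apply, map_sum, Finset.sum_mul, map_sum]
    refine Finset.sum_congr rfl fun β _ => ?_
    rw [MvPolynomial.coeToMvPowerSeries.ringHom_apply, MvPolynomial.coe_monomial,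
      coeff_monomial_mul_iterate_pderiv]

/-- It is enough to describe the shifted derivatives outside a box. -/
theorem isDFinite_of_growth_of_box {F : MvPowerSeries (Fin d) ℚ}
    {W : ℕ → Submodule ℚ ((Fin d →₀ ℕ) → ℚ)} (hW : Growth W d) (c : ℕ)
    (h : ∀ (v : Fin d) (D : ℕ) (α : Fin d →₀ ℕ) (r : ℕ), (∀ i, α i ≤ D) → r ≤ D →
      ∃ f ∈ W D, ∀ e, f e ≠ shiftTerm F v α r e → ∀ i, e i ≤ c * (D + 1)) : IsDFinite F := by
  refine isDFinite_of_growth (hW.sup (growth_box d c)) fun v D α r hα hr => ?_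
  obtain ⟨f, hf, hfe⟩ := h v D α r hα hr
  rw [← add_sub_cancel f (shiftTerm F v α r)]
  refine add_mem (mem_sup_left hf) (mem_sup_right (mem_box fun e he => hfe e fun h0 => he ?_))
  simp [h0]

end Holonomy

/-! ### The counts as products of factorials, for integer arguments -/

namespace BipolarMap

open OrientedMap Holonomy

/-- The number of bipolar orientations as a function of integer parameters. -/
def countFormula (n m : ℤ) : ℚ :=
  2 * (fact n * invFact (m - 1) * invFact (n - m + 1)) *
    (fact (n - 1) * invFact m * invFact (n - m)) *
    (fact (n - 2) * invFact (m + 1) * invFact (n - m - 1))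

/-- Dividing by `n` and `n - 1` is absorbed into smaller factorials, so no denominators remain. The
test `1 ≤ j` makes the formula vanish for negative `j`, where `multi` need not. -/
def countFaceFormula (n m j : ℤ) : ℚ :=
  (j : ℚ) * (j - 1) * (fact (n - 1) * invFact m * invFact (n - m)) *
    (fact (n - 2) * invFact (m + 1) * invFact (n - m - 1)) *
    if 1 ≤ j then multi (n - m) (m + 1 - j) else 0

def countVertexFaceFormula (n m i j : ℤ) : ℚ :=
  ((i : ℚ) - 1) * (j - 1) * (fact (n - 2) * invFact m * invFact (n - m)) *
    ((if 1 ≤ j then multi (n - m) (m + 1 - j) else 0) *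
        (if 1 ≤ i then multi m (n - m + 1 - i) else 0) -
      (if 1 ≤ j then multi (n - m + 1) (m - j) else 0) *
        (if 1 ≤ i then multi (m + 1) (n - m - i) else 0))

theorem invFact_of_neg {z : ℤ} (hz : z < 0) : invFact z = 0 := if_neg (by omega)

theorem invFact_natCast (a : ℕ) : invFact a = 1 / (a.factorial : ℚ) := by
  rw [invFact, if_pos (Int.natCast_nonneg a), Int.toNat_natCast]

theorem fact_natCast (a : ℕ) : fact a = (a.factorial : ℚ) := by
  rw [fact, Int.toNat_natCast]

theorem multi_of_neg {κ y : ℤ} (hy : y < 0) : multi κ y = 0 := if_neg (by omega)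

theorem multi_natCast (κ y : ℕ) : multi (κ + 1 : ℕ) y = Nat.multichoose κ y := by
  rw [multi, if_pos (by omega), show (((κ + 1 : ℕ) : ℤ) - 1).toNat = κ by omega, Int.toNat_natCast]

/-- Outside the admissible range both sides vanish, an inverse factorial having a negative argument.
The single-edge map is a true exception: for `n = m = 1` the formula gives `0`. -/
theorem bipolarCount_eq_countFormula {n : ℕ} (hn : 2 ≤ n) (m : ℕ) :
    (bipolarCount n m : ℚ) = countFormula n m := by
  by_cases h : 1 ≤ m ∧ m < n
  · obtain ⟨k, rfl⟩ : ∃ k, n = m + (k + 1) := ⟨n - m - 1, by omega⟩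
    obtain ⟨m, rfl⟩ : ∃ m', m = m' + 1 := ⟨m - 1, by omega⟩
    rw [bipolarCount_eq (by omega) (by omega), countFormula,
      show (((m + 1 + (k + 1) : ℕ) : ℤ) - ((m + 1 : ℕ) : ℤ) + 1) = (k + 2 : ℕ) by push_cast; ring,
      show (((m + 1 + (k + 1) : ℕ) : ℤ) - ((m + 1 : ℕ) : ℤ) - 1) = (k : ℕ) by push_cast; ring,
      show (((m + 1 + (k + 1) : ℕ) : ℤ) - ((m + 1 : ℕ) : ℤ)) = (k + 1 : ℕ) by push_cast; ring,
      show (((m + 1 + (k + 1) : ℕ) : ℤ) - 1) = (m + k + 1 : ℕ) by push_cast; ring,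
      show (((m + 1 + (k + 1) : ℕ) : ℤ) - 2) = (m + k : ℕ) by push_cast; ring,
      show (((m + 1 : ℕ) : ℤ) - 1) = (m : ℕ) by push_cast; ring,
      show (((m + 1 : ℕ) : ℤ) + 1) = (m + 2 : ℕ) by push_cast; ring]
    simp only [invFact_natCast, fact_natCast]
    rw [Nat.cast_choose ℚ (show m + 1 - 1 ≤ m + 1 + (k + 1) by omega),
      Nat.cast_choose ℚ (show m + 1 ≤ m + 1 + (k + 1) by omega),
      Nat.cast_choose ℚ (show m + 1 + 1 ≤ m + 1 + (k + 1) by omega),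
      show m + 1 - 1 = m by omega, show m + 1 + (k + 1) - m = k + 2 by omega,
      show m + 1 + (k + 1) - (m + 1) = k + 1 by omega,
      show m + 1 + (k + 1) - (m + 1 + 1) = k by omega,
      show m + 1 + (k + 1) = m + k + 1 + 1 by ring, Nat.factorial_succ (m + k + 1),
      Nat.factorial_succ (m + k)]
    have h1 : ((m : ℚ) + 1 + (k + 1) - 1) ≠ 0 := by
      have : ((m : ℚ) + 1 + (k + 1) - 1) = ((m + k + 1 : ℕ) : ℚ) := by push_cast; ring
      rw [this]; positivity
    push_cast
    field_simp
    ring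
  · rw [bipolarCount_eq_classCount, classCount_eq_zero, countFormula]
    · by_cases h1 : 1 ≤ m
      · rw [invFact_of_neg (show (n : ℤ) - m - 1 < 0 by omega)]
        simp
      · rw [invFact_of_neg (show (m : ℤ) - 1 < 0 by omega)]
        simp
    · intro M hM hP
      have := bounds (by omega) M hM
      have := two_le_rootVertexDegree hn hM
      omega

theorem bipolarCountFace_eq_countFaceFormula {n : ℕ} (hn : 2 ≤ n) (m j : ℕ) :
    (bipolarCountFace n m j : ℚ) = countFaceFormula n m j := by
  by_cases h : m < n ∧ 2 ≤ j ∧ j ≤ m + 1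
  · obtain ⟨k, rfl⟩ : ∃ k, n = m + (k + 1) := ⟨n - m - 1, by omega⟩
    obtain ⟨m, rfl⟩ : ∃ m', m = m' + 1 := ⟨m - 1, by omega⟩
    obtain ⟨y, hy⟩ : ∃ y, m + 2 = y + j := ⟨m + 2 - j, by omega⟩
    rw [bipolarCountFace_eq (by omega) (by omega) (by omega) (by omega), countFaceFormula,
      if_pos (by omega), show ((m + 1 : ℕ) : ℤ) + 1 - j = y by omega,
      show (((m + 1 + (k + 1) : ℕ) : ℤ) - ((m + 1 : ℕ) : ℤ) - 1) = (k : ℕ) by push_cast; ring,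
      show (((m + 1 + (k + 1) : ℕ) : ℤ) - ((m + 1 : ℕ) : ℤ)) = (k + 1 : ℕ) by push_cast; ring,
      show (((m + 1 + (k + 1) : ℕ) : ℤ) - 1) = (m + k + 1 : ℕ) by push_cast; ring,
      show (((m + 1 + (k + 1) : ℕ) : ℤ) - 2) = (m + k : ℕ) by push_cast; ring,
      show (((m + 1 : ℕ) : ℤ) + 1) = (m + 2 : ℕ) by push_cast; ring]
    simp only [invFact_natCast, fact_natCast, multi_natCast]
    rw [Nat.cast_choose ℚ (show m + 1 ≤ m + 1 + (k + 1) by omega),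
      Nat.cast_choose ℚ (show m + 1 + 1 ≤ m + 1 + (k + 1) by omega),
      show m + 1 + (k + 1) - (m + 1) = k + 1 by omega,
      show m + 1 + (k + 1) - (m + 1 + 1) = k by omega, show m + 1 + 1 - j = y by omega,
      show k + 1 - 1 = k by omega,
      show m + 1 + (k + 1) = m + k + 1 + 1 by ring, Nat.factorial_succ (m + k + 1),
      Nat.factorial_succ (m + k)]
    have h1 : ((m : ℚ) + 1 + (k + 1) - 1) ≠ 0 := by
      have : ((m : ℚ) + 1 + (k + 1) - 1) = ((m + k + 1 : ℕ) : ℚ) := by push_cast; ring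
      rw [this]; positivity
    push_cast
    field_simp
    ring
  · rw [bipolarCountFace_eq_classCount, classCount_eq_zero, countFaceFormula]
    · rw [Nat.cast_zero, eq_comm]
      by_cases h1 : m < n
      · by_cases h2 : 2 ≤ j
        · rw [multi_of_neg (show (m : ℤ) + 1 - j < 0 by omega)]
          simp
        · have : j = 0 ∨ j = 1 := by omega
          rcases this with rfl | rfl <;> simp
      · rw [invFact_of_neg (show (n : ℤ) - m - 1 < 0 by omega)]
        simp
    · intro M hM hP
      have := bounds (by omega) M hM
      have := two_le_rootVertexDegree hn hM
      have := hM.two_le_rootFaceDegree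
      omega

theorem cast_shiftChoose_one (κ y : ℕ) (z : ℤ) (hz : z + 1 = y) :
    (shiftChoose κ y 1 : ℚ) = multi (κ + 1 : ℕ) z := by
  cases y with
  | zero => rw [multi_of_neg (by omega)]; simp [shiftChoose]
  | succ y =>
    obtain rfl : z = y := by omega
    rw [multi_natCast]
    simp [shiftChoose]

theorem bipolarCountVertexFace_eq_countVertexFaceFormula {n : ℕ} (hn : 2 ≤ n) (m i j : ℕ) :
    (bipolarCountVertexFace n m i j : ℚ) = countVertexFaceFormula n m i j := by
  by_cases h : 2 ≤ i ∧ i + m ≤ n + 1 ∧ 2 ≤ j ∧ j ≤ m + 1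
  · obtain ⟨k, rfl⟩ : ∃ k, n = m + (k + 1) := ⟨n - m - 1, by omega⟩
    obtain ⟨m, rfl⟩ : ∃ m', m = m' + 1 := ⟨m - 1, by omega⟩
    obtain ⟨y, hy⟩ : ∃ y, m + 2 = y + j := ⟨m + 2 - j, by omega⟩
    obtain ⟨x, hx⟩ : ∃ x, k + 2 = x + i := ⟨k + 2 - i, by omega⟩
    have h0 := bipolarCountVertexFace_eq_refined (m := m + 1) (k := k + 1) (p := i - 1) (q := j - 1)
      (by omega) (by omega) (by omega) (by omega)
    rw [show i - 1 + 1 = i by omega, show j - 1 + 1 = j by omega] at h0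
    rw [h0, refined, countVertexFaceFormula, if_pos (by omega), if_pos (by omega),
      if_pos (by omega), if_pos (by omega), show ((m + 1 : ℕ) : ℤ) + 1 - j = y by omega,
      show (((m + 1 + (k + 1) : ℕ) : ℤ) - ((m + 1 : ℕ) : ℤ) + 1) - i = x by omega,
      show m + 1 - (j - 1) = y by omega, show k + 1 - (i - 1) = x by omega,
      cast_shiftChoose_one _ y (((m + 1 : ℕ) : ℤ) - j) (by omega),
      cast_shiftChoose_one _ x (((m + 1 + (k + 1) : ℕ) : ℤ) - ((m + 1 : ℕ) : ℤ) - i) (by omega),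
      show (((m + 1 + (k + 1) : ℕ) : ℤ) - ((m + 1 : ℕ) : ℤ)) = (k + 1 : ℕ) by push_cast; ring,
      show (((m + 1 + (k + 1) : ℕ) : ℤ) - 2) = (m + k : ℕ) by push_cast; ring]
    have e1 : ∀ a : ℕ, ((a : ℤ) + 1) = ((a + 1 : ℕ) : ℤ) := fun a => by push_cast; rfl
    rw [e1 (k + 1), e1 (m + 1)]
    simp only [invFact_natCast, fact_natCast, multi_natCast]
    rw [Nat.cast_choose ℚ (show m + 1 ≤ m + 1 + (k + 1) by omega),
      show m + 1 + (k + 1) - (m + 1) = k + 1 by omega,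
      show k + 1 - 1 = k by omega, show m + 1 - 1 = m by omega,
      show m + 1 + (k + 1) = m + k + 1 + 1 by ring, Nat.factorial_succ (m + k + 1),
      Nat.factorial_succ (m + k)]
    have h1 : ((m : ℚ) + 1 + (k + 1) - 1) ≠ 0 := by
      have : ((m : ℚ) + 1 + (k + 1) - 1) = ((m + k + 1 : ℕ) : ℚ) := by push_cast; ring
      rw [this]; positivity
    rw [Nat.cast_sub (by omega), Nat.cast_sub (by omega)]
    push_cast
    field_simp
    ring
  · rw [bipolarCountVertexFace_eq_classCount, classCount_eq_zero, countVertexFaceFormula]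
    · rw [Nat.cast_zero, eq_comm]
      by_cases h1 : 2 ≤ i
      · by_cases h2 : 2 ≤ j
        · by_cases h3 : i + m ≤ n + 1
          · rw [multi_of_neg (show (m : ℤ) + 1 - j < 0 by omega),
              multi_of_neg (show (m : ℤ) - j < 0 by omega)]
            simp
          · rw [multi_of_neg (show (n : ℤ) - m + 1 - i < 0 by omega),
              multi_of_neg (show (n : ℤ) - m - i < 0 by omega)]
            simp
        · have : j = 0 ∨ j = 1 := by omega
          rcases this with rfl | rfl <;> simp
      · have : i = 0 ∨ i = 1 := by omega
        rcases this with rfl | rfl <;> simp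
    · intro M hM hP
      have := bounds (by omega) M hM
      have := two_le_rootVertexDegree hn hM
      have := hM.two_le_rootFaceDegree
      omega

end BipolarMap

/-! ### A D-finiteness criterion for explicit coefficients -/

namespace Holonomy

open Submodule

variable {d : ℕ}

theorem cast_descFactorial_eq_prod (n r : ℕ) :
    (n.descFactorial r : ℚ) = ∏ t ∈ Finset.range r, ((n : ℚ) - t) := by
  induction r with
  | zero => simp
  | succ r ih =>
    rw [Nat.descFactorial_succ, Finset.prod_range_succ, ← ih]
    by_cases h : r ≤ n
    · rw [Nat.cast_mul, Nat.cast_sub h, mul_comm]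
    · rw [Nat.descFactorial_of_lt (by omega)]
      simp

/-- A power series is D-finite as soon as its coefficients are given by a formula whose shifts lie
in small spaces. -/
theorem isDFinite_of_formula {F : MvPowerSeries (Fin (d + 1)) ℚ} (f : (Fin (d + 1) → ℤ) → ℚ)
    (hF : ∀ e : Fin (d + 1) →₀ ℕ, 2 ≤ e 0 → F e = f fun i => (e i : ℤ))
    (hneg : ∀ z, (∃ i, z i < 0) → f z = 0)
    (hsupp : ∀ e : Fin (d + 1) →₀ ℕ, F e ≠ 0 → ∀ i, e i ≤ e 0 + 2)
    (V : ℕ → Submodule ℚ ((Fin (d + 1) →₀ ℕ) → ℚ)) (L : Submodule ℚ ((Fin (d + 1) →₀ ℕ) → ℚ))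
    (hL : 1 ≤ L) (hcoord : ∀ i, (fun e : Fin (d + 1) →₀ ℕ => (e i : ℚ)) ∈ L)
    (hV : Growth (fun D => V D * L ^ (D + 1)) (d + 1)) {R : ℕ} (hR : 2 ≤ R)
    (h : ∀ (D : ℕ) (α : Fin (d + 1) →₀ ℕ), (∀ i, α i ≤ D) →
      (fun e : Fin (d + 1) →₀ ℕ => if ((R * (D + 1) : ℕ) : ℤ) ≤ (e 0 : ℤ) then
        f fun i => (e i : ℤ) - α i else 0) ∈ V D) : IsDFinite F := by
  refine isDFinite_of_growth_of_box hV (R + 2) fun v D α r hα hr => ?_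
  have h1 := prod_mem_pow (W := L) (f := fun t e => (e v : ℚ) - (α v + t)) (fun t => by
    refine sub_mem (hcoord v) ?_
    have h2 : (1 : (Fin (d + 1) →₀ ℕ) → ℚ) ∈ L := Submodule.one_le.1 hL
    have h3 := smul_mem L ((α v : ℚ) + t) h2
    convert h3 using 1
    ext e
    simp) r
  refine ⟨_, mul_mem_mul (h D α hα) (pow_le_pow_of_one_le hL (by omega) h1), fun e he => ?_⟩
  -- For `e 0 ≥ R * (D + 1)` the formula applies to the shifted exponent, or vanishes if that is
  -- negative. For smaller `e 0` the support condition bounds all coordinates, so the error lies in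
  -- a box of side `(R + 2) * (D + 1)`.
  have hRD : R * (D + 1) + D + 1 ≤ (R + 2) * (D + 1) := by nlinarith
  have hRD' : 2 * (D + 1) ≤ R * (D + 1) := Nat.mul_le_mul_right _ hR
  simp only [Pi.mul_apply, shiftTerm] at he
  split_ifs at he with h2 h3 h3
  · exfalso
    apply he
    have h4 := hα 0
    rw [hF (e - α) (by rw [Finsupp.tsub_apply]; omega), mul_comm]
    have h5 : (fun i => (((e - α) i : ℕ) : ℤ)) = fun i => (e i : ℤ) - α i := by
      funext i
      have := h3 i
      rw [Finsupp.tsub_apply]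
      omega
    rw [h5, cast_descFactorial_eq_prod, Nat.cast_sub (h3 v)]
    simp only [sub_sub]
  · exfalso
    apply he
    rw [hneg _ _, zero_mul]
    by_contra h4
    push Not at h4
    exact h3 fun i => by have := h4 i; omega
  · intro i
    have h4 : F (e - α) ≠ 0 := fun h4 => he (by rw [h4]; simp)
    have h5 := hsupp _ h4 i
    have h6 := hα i
    rw [Finsupp.tsub_apply, Finsupp.tsub_apply] at h5
    omega
  · simp at he

end Holonomy

/-! ### D-finiteness of the three generating functions -/

namespace BipolarMap

open OrientedMap Holonomy Submodule

theorem isDFinite_bipolarGF : IsDFinite bipolarGF := by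
  let m : (Fin 2 →₀ ℕ) → ℤ := fun e => e 1
  let k : (Fin 2 →₀ ℕ) → ℤ := fun e => e 0 - e 1
  have hmk : ∀ e, m e + k e = e 0 := fun e => by simp [m, k]
  have hone : 1 ≤ lin m * lin k := (one_le_lin m).trans (le_mul_of_one_le (one_le_lin k))
  let g : ℕ → (Fin 2 →₀ ℕ) → ℚ := fun D => hypBase m k (8 * (D + 1))
  refine isDFinite_of_formula (fun z => countFormula (z 0) (z 1))
    (fun e he => bipolarCount_eq_countFormula he _) ?_ ?_
    (fun D => span ℚ {g D * g D * g D} * (lin m * lin k) ^ (144 * (D + 1))) (lin m * lin k) hone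
    ?_ ?_ (R := 8) (by norm_num) ?_
  · intro z hz
    rw [Fin.exists_fin_two] at hz
    unfold countFormula
    by_cases h : z 1 < 0
    · rw [invFact_of_neg (show z 1 - 1 < 0 by omega)]; ring
    · rw [invFact_of_neg (show z 0 - z 1 < 0 by omega)]; ring
  · intro e he
    have he' : bipolarCount (e 0) (e 1) ≠ 0 := fun h => he (by simp [bipolarGF, h])
    rw [Fin.forall_fin_two]
    by_contra hno
    apply he'
    rw [bipolarCount_eq_classCount]
    refine classCount_eq_zero fun M hM hP => ?_
    have h1 : 1 ≤ e 0 := by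
      by_contra h
      have h0 : e 0 = 0 := by omega
      apply he'
      rw [bipolarCount_eq_classCount, h0, classCount_zero]
    have := bounds h1 M hM
    omega
  · intro i
    revert i
    rw [Fin.forall_fin_two]
    have h1 := le_mul_of_one_le (one_le_lin k) (coe_mem_lin m)
    have h2 := le_mul_of_one_le (one_le_lin m) (coe_mem_lin k)
    rw [mul_comm] at h2
    refine ⟨?_, ?_⟩
    · convert add_mem h1 h2 using 1
      ext e
      simp [m, k]
    · exact h1
  · refine (growth_two (m := m) (k := k) (fun D => g D * g D * g D) 145).mono fun D => ?_
    rw [mul_assoc, ← pow_add, show 144 * (D + 1) + (D + 1) = 145 * (D + 1) by ring]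
  · intro D α hα
    have ha := hα 0
    have hb := hα 1
    have p := fun s a b h1 h2 h3 h4 h5 h6 => hyp_mem m k (R := 8 * (D + 1)) (s := s) (a := a)
      (b := b) h1 h2 h3 h4 h5 h6
    have p1 := p (-α 0) (-α 1 - 1) (α 1 - α 0 + 1) (by omega) (by omega) (by omega) (by omega)
      (by omega) (by omega)
    have p2 := p (-α 0 - 1) (-α 1) (α 1 - α 0) (by omega) (by omega) (by omega) (by omega)
      (by omega) (by omega)
    have p3 := p (-α 0 - 2) (-α 1 + 1) (α 1 - α 0 - 1) (by omega) (by omega) (by omega) (by omega)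
      (by omega) (by omega)
    have q := smul_mem _ (2 : ℚ) (mul_mem_mul (mul_mem_mul p1 p2) p3)
    have e1 : ∀ (f : (Fin 2 →₀ ℕ) → ℚ) (P : Submodule ℚ ((Fin 2 →₀ ℕ) → ℚ)),
        span ℚ {f} * P * (span ℚ {f} * P) * (span ℚ {f} * P) =
        span ℚ {f * f * f} * P ^ 3 := fun f P => by
      rw [← Set.singleton_mul_singleton, ← Set.singleton_mul_singleton, ← span_mul_span,
        ← span_mul_span]
      ring
    -- Three factorial terms, each needing degree `6 * R` with `R = 8 * (D + 1)`.
    rw [e1, ← pow_mul, show 6 * (8 * (D + 1)) * 3 = 144 * (D + 1) by ring] at q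
    convert q using 1
    ext e
    simp only [Pi.smul_apply, Pi.mul_apply, smul_eq_mul, hmk]
    split_ifs
    · simp only [countFormula, m, k]
      ring_nf
    · ring

end BipolarMap

namespace BipolarMap

open OrientedMap Holonomy Submodule

variable {X : Type*}

theorem span_singleton_mul_singleton (f g : X → ℚ) :
    span ℚ {f} * span ℚ {g} = span ℚ {f * g} := by
  rw [span_mul_span, Set.singleton_mul_singleton]

theorem isDFinite_bipolarGFFace : IsDFinite bipolarGFFace := by
  let m : (Fin 3 →₀ ℕ) → ℤ := fun e => e 1
  let k : (Fin 3 →₀ ℕ) → ℤ := fun e => e 0 - e 1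
  let j : (Fin 3 →₀ ℕ) → ℤ := fun e => e 2
  let y : (Fin 3 →₀ ℕ) → ℤ := fun e => m e + 1 - j e
  have hmk : ∀ e, m e + k e = e 0 := fun e => by simp [m, k]
  have hy : ∀ e, y e + j e = m e + 1 := fun e => by simp [y]
  let L := lin k * lin y * lin m
  have hk1 := one_le_lin k
  have hy1 := one_le_lin y
  have hm1 := one_le_lin m
  have hk : lin k ≤ L := (le_mul_of_one_le hy1).trans (le_mul_of_one_le hm1)
  have hm : lin m ≤ L := by
    calc lin m ≤ lin m * lin k := le_mul_of_one_le hk1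
      _ ≤ lin m * lin k * lin y := le_mul_of_one_le hy1
      _ = L := by ring
  have hyL : lin y ≤ L := by
    calc lin y ≤ lin y * lin k := le_mul_of_one_le hk1
      _ ≤ lin y * lin k * lin m := le_mul_of_one_le hm1
      _ = L := by ring
  have hmkL : lin m * lin k ≤ L := by
    calc lin m * lin k ≤ lin m * lin k * lin y := le_mul_of_one_le hy1
      _ = L := by ring
  have hone : 1 ≤ L := hk1.trans hk
  have hconst : ∀ c : ℚ, (fun _ => c) ∈ L := fun c => hk (const_mem_lin k c)
  have hjL : (fun e : Fin 3 →₀ ℕ => (e 2 : ℚ)) ∈ L := by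
    convert sub_mem (add_mem (hm (coe_mem_lin m)) (hconst 1)) (hyL (coe_mem_lin y)) using 1
    ext e
    simp [y, j]
  let g : ℕ → (Fin 3 →₀ ℕ) → ℚ := fun D => hypBase m k (8 * (D + 1))
  refine isDFinite_of_formula (fun z => countFaceFormula (z 0) (z 1) (z 2))
    (fun e he => bipolarCountFace_eq_countFaceFormula he _ _) ?_ ?_
    (fun D => span ℚ {g D * g D} * (multiSpace m k y j (8 * (D + 1)) * L ^ (146 * (D + 1)))) L hone
    ?_ ?_ (R := 8) (by norm_num) ?_
  · rintro z ⟨i, hi⟩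
    simp only [countFaceFormula]
    by_cases h : z 1 < 0
    · rw [invFact_of_neg h]; ring
    · by_cases h' : z 0 - z 1 < 0
      · rw [invFact_of_neg h']; ring
      · rw [if_neg, mul_zero]
        fin_cases i <;> simp at hi <;> omega
  · intro e he
    have he' : bipolarCountFace (e 0) (e 1) (e 2) ≠ 0 := fun h => he (by simp [bipolarGFFace, h])
    by_contra hno
    apply he'
    rw [bipolarCountFace_eq_classCount]
    refine classCount_eq_zero fun M hM hP => ?_
    have h1 : 1 ≤ e 0 := by
      by_contra h
      have h0 : e 0 = 0 := by omega
      apply he'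
      rw [bipolarCountFace_eq_classCount, h0, classCount_zero]
    have := bounds h1 M hM
    apply hno
    intro i
    fin_cases i <;> simp <;> omega
  · intro i
    fin_cases i
    · convert add_mem (hm (coe_mem_lin m)) (hk (coe_mem_lin k)) using 1
      ext e
      simp [m, k]
    · exact hm (coe_mem_lin m)
    · exact hjL
  · refine (growth_multiSpace (k := k) hy (fun D => g D * g D) 8 147).mono fun D => ?_
    rw [mul_assoc, mul_assoc, ← pow_add, show 146 * (D + 1) + (D + 1) = 147 * (D + 1) by ring]
  · intro D α hα
    have ha := hα 0
    have hb := hα 1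
    have hc := hα 2
    have p := fun s a b h1 h2 h3 h4 h5 h6 => hyp_mem m k (R := 8 * (D + 1)) (s := s) (a := a)
      (b := b) h1 h2 h3 h4 h5 h6
    have p1 := p (-α 0 - 1) (-α 1) (α 1 - α 0) (by omega) (by omega) (by omega) (by omega)
      (by omega) (by omega)
    have p2 := p (-α 0 - 2) (-α 1 + 1) (α 1 - α 0 - 1) (by omega) (by omega) (by omega) (by omega)
      (by omega) (by omega)
    -- After a shift by `α` the test `1 ≤ j` becomes `α 2 + 1 ≤ j`, the cut-off `c`. The shifts are
    -- at most `D`, and `R = 8 * (D + 1)` leaves room for `4 * r + 4 ≤ R`.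
    obtain ⟨f, hf, hfe⟩ := multi_mem m k y j (fun e => by simp [j]) hy (r := D + 1)
      (R := 8 * (D + 1)) (by omega) (a := α 0 - α 1) (b := α 1 - α 2) (by omega) (by omega)
      (by omega) (by omega) (c := α 2 + 1) (by omega)
    have l1 := sub_mem hjL (hconst (α 2))
    have l2 := sub_mem hjL (hconst (α 2 + 1))
    have hpow := pow_le_pow_left' hmkL (6 * (8 * (D + 1)))
    have q := mul_mem_mul (mul_mem_mul (mul_mem_mul l1 l2) (mul_mem_mul
      (mul_le_mul' le_rfl hpow p1) (mul_le_mul' le_rfl hpow p2))) hf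
    have e1 : ∀ (f : (Fin 3 →₀ ℕ) → ℚ) (P Q S : Submodule ℚ ((Fin 3 →₀ ℕ) → ℚ)),
        L * L * (span ℚ {f} * P * (span ℚ {f} * P)) * (S * P) =
        span ℚ {f * f} * (S * (L ^ 2 * P ^ 3)) := fun f P Q S => by
      rw [← span_singleton_mul_singleton]
      ring
    rw [e1 _ _ 1, ← pow_mul, ← pow_add] at q
    have q' := mul_le_mul' le_rfl (mul_le_mul' le_rfl (pow_le_pow_of_one_le hone
      (show 2 + 6 * (8 * (D + 1)) * 3 ≤ 146 * (D + 1) by omega))) q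
    convert q' using 1
    ext e
    simp only [Pi.sub_apply, Pi.mul_apply, hmk]
    split_ifs with h
    · rw [hfe e (by rw [hmk]; exact h)]
      have h1 : ((1 : ℤ) ≤ (e 2 : ℤ) - α 2) ↔ (((α 2 + 1 : ℕ) : ℤ) ≤ j e) := by
        simp only [j]; omega
      have h2 : ((e 0 : ℤ) - α 0 - (e 1 - α 1)) = k e - (α 0 - α 1) := by simp only [k]; ring
      have h3 : ((e 1 : ℤ) - α 1 + 1 - (e 2 - α 2)) = y e - (α 1 - α 2) := by
        simp only [y, m, j]; ring
      simp only [countFaceFormula, h1, h2, h3]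
      simp only [m, k]
      push_cast
      ring_nf
    · ring

theorem isDFinite_bipolarGFVertexFace : IsDFinite bipolarGFVertexFace := by
  let m : (Fin 4 →₀ ℕ) → ℤ := fun e => e 1
  let k : (Fin 4 →₀ ℕ) → ℤ := fun e => e 0 - e 1
  let i : (Fin 4 →₀ ℕ) → ℤ := fun e => e 2
  let j : (Fin 4 →₀ ℕ) → ℤ := fun e => e 3
  let x : (Fin 4 →₀ ℕ) → ℤ := fun e => k e + 1 - i e
  let y : (Fin 4 →₀ ℕ) → ℤ := fun e => m e + 1 - j e
  have hmk : ∀ e, m e + k e = e 0 := fun e => by simp [m, k]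
  have hkm : ∀ e, k e + m e = e 0 := fun e => by simp [m, k]
  have hy : ∀ e, y e + j e = m e + 1 := fun e => by simp [y]
  have hx : ∀ e, x e + i e = k e + 1 := fun e => by simp [x]
  let L := lin k * lin y * lin m * lin x
  have hk1 := one_le_lin k
  have hy1 := one_le_lin y
  have hm1 := one_le_lin m
  have hx1 := one_le_lin x
  have hkymL : lin k * lin y * lin m ≤ L := le_mul_of_one_le hx1
  have hmxkL : lin m * lin x * lin k ≤ L := by
    calc lin m * lin x * lin k ≤ lin m * lin x * lin k * lin y := le_mul_of_one_le hy1
      _ = L := by ring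
  have hmkL : lin m * lin k ≤ L := by
    refine le_trans ?_ hmxkL
    calc lin m * lin k ≤ lin m * lin k * lin x := le_mul_of_one_le hx1
      _ = _ := by ring
  have hm : lin m ≤ L := (le_mul_of_one_le hk1).trans hmkL
  have hk : lin k ≤ L := by
    refine le_trans ?_ hmkL
    rw [mul_comm]
    exact le_mul_of_one_le hm1
  have hyL : lin y ≤ L := by
    refine le_trans ?_ hkymL
    calc lin y ≤ lin y * lin k := le_mul_of_one_le hk1
      _ ≤ lin y * lin k * lin m := le_mul_of_one_le hm1
      _ = _ := by ring
  have hxL : lin x ≤ L := by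
    refine le_trans ?_ hmxkL
    calc lin x ≤ lin x * lin m := le_mul_of_one_le hm1
      _ ≤ lin x * lin m * lin k := le_mul_of_one_le hk1
      _ = _ := by ring
  have hone : 1 ≤ L := hk1.trans hk
  have hconst : ∀ c : ℚ, (fun _ => c) ∈ L := fun c => hk (const_mem_lin k c)
  have hjL : (fun e : Fin 4 →₀ ℕ => (e 3 : ℚ)) ∈ L := by
    convert sub_mem (add_mem (hm (coe_mem_lin m)) (hconst 1)) (hyL (coe_mem_lin y)) using 1
    ext e
    simp [y, j]
  have hiL : (fun e : Fin 4 →₀ ℕ => (e 2 : ℚ)) ∈ L := by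
    convert sub_mem (add_mem (hk (coe_mem_lin k)) (hconst 1)) (hxL (coe_mem_lin x)) using 1
    ext e
    simp [x, i]
  let g : ℕ → (Fin 4 →₀ ℕ) → ℚ := fun D => hypBase m k (16 * (D + 1))
  refine isDFinite_of_formula (fun z => countVertexFaceFormula (z 0) (z 1) (z 2) (z 3))
    (fun e he => bipolarCountVertexFace_eq_countVertexFaceFormula he _ _ _) ?_ ?_
    (fun D => span ℚ {g D} * (multiSpace m k y j (16 * (D + 1)) *
      multiSpace k m x i (16 * (D + 1)) * L ^ (290 * (D + 1)))) L hone
    ?_ ?_ (R := 16) (by norm_num) ?_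
  · rintro z ⟨v, hv⟩
    simp only [countVertexFaceFormula]
    by_cases h : z 1 < 0
    · rw [invFact_of_neg h]; ring
    · by_cases h' : z 0 - z 1 < 0
      · rw [invFact_of_neg h']; ring
      · have h2 : z 2 < 1 ∨ z 3 < 1 := by
          fin_cases v <;> simp at hv <;> omega
        rcases h2 with h2 | h2
        · rw [if_neg (show ¬ 1 ≤ z 2 by omega), if_neg (show ¬ 1 ≤ z 2 by omega)]; ring
        · rw [if_neg (show ¬ 1 ≤ z 3 by omega), if_neg (show ¬ 1 ≤ z 3 by omega)]; ring
  · intro e he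
    have he' : bipolarCountVertexFace (e 0) (e 1) (e 2) (e 3) ≠ 0 := fun h =>
      he (by simp [bipolarGFVertexFace, h])
    by_contra hno
    apply he'
    rw [bipolarCountVertexFace_eq_classCount]
    refine classCount_eq_zero fun M hM hP => ?_
    have h1 : 1 ≤ e 0 := by
      by_contra h
      have h0 : e 0 = 0 := by omega
      apply he'
      rw [bipolarCountVertexFace_eq_classCount, h0, classCount_zero]
    have := bounds h1 M hM
    apply hno
    intro v
    fin_cases v <;> simp <;> omega
  · intro v
    fin_cases v
    · convert add_mem (hm (coe_mem_lin m)) (hk (coe_mem_lin k)) using 1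
      ext e
      simp [m, k]
    · exact hm (coe_mem_lin m)
    · exact hiL
    · exact hjL
  · refine (growth_multiSpace_mul hy hx g 16 291).mono fun D => ?_
    rw [mul_assoc, mul_assoc, ← pow_add, show 290 * (D + 1) + (D + 1) = 291 * (D + 1) by ring]
  · intro D α hα
    have ha := hα 0
    have hb := hα 1
    have hc := hα 2
    have hd := hα 3
    have p1 := hyp_mem m k (R := 16 * (D + 1)) (s := -α 0 - 2) (a := -α 1) (b := α 1 - α 0)
      (by omega) (by omega) (by omega) (by omega) (by omega) (by omega)
    -- The shift `α 0 - α 1 - α 2` can reach `-2 * D`, hence `r = 2 * (D + 1)` and the larger `R`.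
    -- The roles of `m, y, j` and `k, x, i` are dual in `u` and `w`.
    have u := fun a b c h1 h2 h3 h4 h5 => multi_mem m k y j (fun e => by simp [j]) hy
      (r := 2 * (D + 1)) (R := 16 * (D + 1)) (by omega) (a := a) (b := b) h1 h2 h3 h4 (c := c) h5
    have w := fun a b c h1 h2 h3 h4 h5 => multi_mem k m x i (fun e => by simp [i]) hx
      (r := 2 * (D + 1)) (R := 16 * (D + 1)) (by omega) (a := a) (b := b) h1 h2 h3 h4 (c := c) h5
    obtain ⟨f1, hf1, hfe1⟩ := u (α 0 - α 1) (α 1 - α 3) (α 3 + 1) (by omega) (by omega)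
      (by omega) (by omega) (by omega)
    obtain ⟨f2, hf2, hfe2⟩ := u (α 0 - α 1 - 1) (α 1 - α 3 + 1) (α 3 + 1) (by omega) (by omega)
      (by omega) (by omega) (by omega)
    obtain ⟨f3, hf3, hfe3⟩ := w (α 1) (α 0 - α 1 - α 2) (α 2 + 1) (by omega) (by omega)
      (by omega) (by omega) (by omega)
    obtain ⟨f4, hf4, hfe4⟩ := w (α 1 - 1) (α 0 - α 1 - α 2 + 1) (α 2 + 1) (by omega) (by omega)
      (by omega) (by omega) (by omega)
    have l1 := sub_mem hiL (hconst (α 2 + 1))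
    have l2 := sub_mem hjL (hconst (α 3 + 1))
    have hpow := pow_le_pow_left' hmkL (6 * (16 * (D + 1)))
    have hpow' := pow_le_pow_left' hkymL (6 * (16 * (D + 1)))
    have hpow'' := pow_le_pow_left' hmxkL (6 * (16 * (D + 1)))
    have q := mul_mem_mul (mul_mem_mul (mul_mem_mul l1 l2) (mul_le_mul' le_rfl hpow p1))
      (sub_mem (mul_mem_mul (mul_le_mul' le_rfl hpow' hf1) (mul_le_mul' le_rfl hpow'' hf3))
        (mul_mem_mul (mul_le_mul' le_rfl hpow' hf2) (mul_le_mul' le_rfl hpow'' hf4)))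
    have e1 : ∀ G P S T : Submodule ℚ ((Fin 4 →₀ ℕ) → ℚ),
        L * L * (G * P) * (S * P * (T * P)) = G * (S * T * (L ^ 2 * P ^ 3)) := fun G P S T => by
      ring
    rw [e1, ← pow_mul, ← pow_add] at q
    have q' := mul_le_mul' le_rfl (mul_le_mul' le_rfl (pow_le_pow_of_one_le hone
      (show 2 + 6 * (16 * (D + 1)) * 3 ≤ 290 * (D + 1) by omega))) q
    convert q' using 1
    ext e
    simp only [Pi.sub_apply, Pi.mul_apply, hmk]
    split_ifs with h
    · rw [hfe1 e (by rw [hmk]; exact h), hfe2 e (by rw [hmk]; exact h),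
        hfe3 e (by rw [hkm]; exact h), hfe4 e (by rw [hkm]; exact h)]
      have h1 : ((1 : ℤ) ≤ (e 3 : ℤ) - α 3) ↔ (((α 3 + 1 : ℕ) : ℤ) ≤ j e) := by
        simp only [j]; omega
      have h2 : ((1 : ℤ) ≤ (e 2 : ℤ) - α 2) ↔ (((α 2 + 1 : ℕ) : ℤ) ≤ i e) := by
        simp only [i]; omega
      have h3 : multi ((e 0 : ℤ) - α 0 - (e 1 - α 1)) ((e 1 : ℤ) - α 1 + 1 - (e 3 - α 3)) =
          multi (k e - (α 0 - α 1)) (y e - (α 1 - α 3)) := by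
        congr 1 <;> simp only [k, y, m, j] <;> ring
      have h4 : multi ((e 0 : ℤ) - α 0 - (e 1 - α 1) + 1) ((e 1 : ℤ) - α 1 - (e 3 - α 3)) =
          multi (k e - (α 0 - α 1 - 1)) (y e - (α 1 - α 3 + 1)) := by
        congr 1 <;> simp only [k, y, m, j] <;> ring
      have h5 : multi ((e 1 : ℤ) - α 1) ((e 0 : ℤ) - α 0 - (e 1 - α 1) + 1 - (e 2 - α 2)) =
          multi (m e - α 1) (x e - (α 0 - α 1 - α 2)) := by
        congr 1; simp only [x, k, i]; ring
      have h6 : multi ((e 1 : ℤ) - α 1 + 1) ((e 0 : ℤ) - α 0 - (e 1 - α 1) - (e 2 - α 2)) =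
          multi (m e - (α 1 - 1)) (x e - (α 0 - α 1 - α 2 + 1)) := by
        congr 1 <;> simp only [x, m, k, i] <;> ring
      have h7 : fact ((e 0 : ℤ) - α 0 - 2) = fact ((e 0 : ℤ) + (-α 0 - 2)) := by
        congr 1; ring
      have h8 : invFact ((e 1 : ℤ) - α 1) = invFact (m e + -α 1) := by
        congr 1
      have h9 : invFact ((e 0 : ℤ) - α 0 - (e 1 - α 1)) = invFact (k e + (α 1 - α 0)) := by
        congr 1; simp only [k]; ring
      simp only [countVertexFaceFormula, h3, h4, h5, h6, h7, h8, h9, h1, h2]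
      push_cast
      ring
    · ring

end BipolarMap

theorem mainTheorem8 :
    (∀ n m : ℕ, 1 ≤ m → m < n →
      (bipolarCount n m : ℚ) =
        2 / (((n : ℚ) - 1) * (n : ℚ) ^ 2) *
          (n.choose (m - 1) : ℚ) * (n.choose m : ℚ) * (n.choose (m + 1) : ℚ)) ∧
    (∀ n m j : ℕ, 1 ≤ m → m < n → 2 ≤ j → j ≤ m + 1 →
      (bipolarCountFace n m j : ℚ) =
        (j : ℚ) * ((j : ℚ) - 1) / (((n : ℚ) - 1) * (n : ℚ) ^ 2) *
          (n.choose m : ℚ) * (n.choose (m + 1) : ℚ) *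
          (binom ((n : ℤ) - j - 1) ((m : ℤ) - j + 1) : ℚ)) ∧
    (∀ n m i j : ℕ, 3 ≤ n → 1 ≤ m → m < n →
      2 ≤ i → (i : ℤ) ≤ (n : ℤ) - m + 1 → 2 ≤ j → j ≤ m + 1 →
      (bipolarCountVertexFace n m i j : ℚ) =
        ((i : ℚ) - 1) * ((j : ℚ) - 1) / (((n : ℚ) - 1) * (n : ℚ)) * (n.choose m : ℚ) *
          ((binom ((n : ℤ) - j - 1) ((n : ℤ) - m - 2) : ℚ) *
              (binom ((n : ℤ) - i - 1) ((m : ℤ) - 2) : ℚ) -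
            (binom ((n : ℤ) - j - 1) ((n : ℤ) - m - 1) : ℚ) *
              (binom ((n : ℤ) - i - 1) ((m : ℤ) - 1) : ℚ))) ∧
    IsDFinite bipolarGF ∧ IsDFinite bipolarGFFace ∧ IsDFinite bipolarGFVertexFace := by
  refine ⟨fun n m hm hmn => BipolarMap.bipolarCount_formula hm hmn,
    fun n m j hm hmn hj hjm => BipolarMap.bipolarCountFace_formula hm hmn hj hjm,
    fun n m i j hn _ _ hi him hj hjm =>
      BipolarMap.bipolarCountVertexFace_formula hn hi (by omega) hj hjm,
    BipolarMap.isDFinite_bipolarGF, BipolarMap.isDFinite_bipolarGFFace,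
    BipolarMap.isDFinite_bipolarGFVertexFace⟩
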